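/- Let $M$ be a compact smooth $n$-dimensional manifold without boundary, let $k\in\{0,\dots,n-1\}$, and let $f:S^k\times B^{n-k}\hookrightarrow M$ be a smooth embedding ($B^m$ is the open unit ball of $\mathbb R^m$). Attach to $M\times[0,1]$ a $(k+1)$-dimensional handle along $f(S^k\times B^{n-k})\times\{0\}$; call the result $\Omega_1$ and let $B^{k+1}\times S^{n-k-1}\subset\partial\Omega_1$ be the part of the boundary of the handle that lies in $\partial\Omega_1$. Then attach to $\Omega_1$ the dual handle, i.e. the $(n-k)$-dimensional handle attached along the embedding $S^{n-k-1}\times B^{k+1}\to\partial\Omega_1$ given by the inclusion of $B^{k+1}\times S^{n-k-1}$ (factors exchanged), and let $\Omega''$ be the resulting $(n+1)$-dimensional smooth manifold with boundary. Then $\partial\Omega''$ is diffeomorphic to $M\sqcup M$, and $M\times[0,1]$ is (up to diffeomorphism) obtained from $\Omega''$ by an interior surgery of dimension $n-k$, i.e. by a surgery along an embedding $S^{n-k}\times B^{k+1}\hookrightarrow\operatorname{int}\Omega''$. Conventions. The surgery on a manifold $X$ along an embedding $\varphi:S^{d}\times B^{r}\to \operatorname{int}X$, $d+r=\dim X$,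 is the smooth manifold $\big(X\setminus\varphi(S^{d}\times\{0\})\big)\cup\big(B^{d+1}\times S^{r-1}\big)$ with $\varphi(u,\theta v)\sim(\theta u,v)$ for $u\in S^{d}$, $v\in S^{r-1}$, $0<\theta<1$. Attaching a $p$-dimensional handle to $X$ along an embedding $h:S^{p-1}\times B^{q}\to\partial X$, $p+q=\dim X$, means the corresponding half-surgery: extend $h$ to an embedding $F$ of $S^{p-1}\times B_-^{q+1}$ onto an open subset of $X$ with $F(x,(y,0))=h(x,y)$, where $B_-^{q+1}=\{y\in B^{q+1}: y_{q+1}\le 0\}$, and glue the handle $B^p\times S^{q}_-$, $S^q_-=\{y\in S^q:y_{q+1}\le 0\}$, to $X\setminus F(S^{p-1}\times\{0\})$ by $F(u,\theta v)\sim(\theta u,v)$ for $u\in S^{p-1}$, $v\in S^q_-$, $0<\theta<1$. The choice of $F$ is arbitrary. -/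

import Mathlib

open Set Metric
open scoped Manifold ContDiff

/-- Euclidean space `ℝ^d`. Unit spheres `S^(d-1) = sphere 0 1` and open unit balls
`B^d = ball 0 1` are taken as subsets of it. -/
abbrev Euc (d : ℕ) : Type := EuclideanSpace ℝ (Fin d)

/-- Euclidean space `ℝ^(d+1) = ℝ^d × ℝ` (with the Euclidean norm), with its last coordinate
singled out. -/
abbrev EucSucc (d : ℕ) : Type := WithLp 2 (Euc d × ℝ)

/-- The closed half-space `{y_(d+1) ≤ 0}` of `ℝ^(d+1)`. So `ball 0 1 ∩ lowerHalf d` is the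
half-ball `B_-^(d+1)` and `sphere 0 1 ∩ lowerHalf d` is the closed half-sphere `S_-^d`. -/
def lowerHalf (d : ℕ) : Set (EucSucc d) := {y | y.snd ≤ 0}

section SmoothMaps

variable {E H X : Type*} [NormedAddCommGroup E] [NormedSpace ℝ E] [TopologicalSpace H]
  [TopologicalSpace X] [ChartedSpace H X]
  {E' H' Y : Type*} [NormedAddCommGroup E'] [NormedSpace ℝ E'] [TopologicalSpace H']
  [TopologicalSpace Y] [ChartedSpace H' Y]

/-- `f` restricts to a diffeomorphism from `s` onto an open subset of `Y`, i.e. it is a smooth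
embedding of codimension zero of `s`, with open image. It is used where `s` is an open subset
of a manifold, or a submanifold (possibly with boundary, or of positive codimension) of a
Euclidean space, such as `S^k × B^m`; in the latter case smoothness on `s` is smoothness of maps
on a subset of the Euclidean space, as usual. The values of `f` outside `s` play no role. -/
def IsOpenSmoothEmbeddingOn (I : ModelWithCorners ℝ E H) (J : ModelWithCorners ℝ E' H')
    (f : X → Y) (s : Set X) : Prop :=
  IsOpen (f '' s) ∧ ContMDiffOn I J ∞ f s ∧
    ∃ g : Y → X, ContMDiffOn J I ∞ g (f '' s) ∧ ∀ x ∈ s, g (f x) = x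

end SmoothMaps

section Surgery

variable {V W : Type*} [NormedAddCommGroup V] [NormedSpace ℝ V]
  [NormedAddCommGroup W] [NormedSpace ℝ W]
  {E H X : Type*} [NormedAddCommGroup E] [NormedSpace ℝ E] [TopologicalSpace H]
  [TopologicalSpace X] [ChartedSpace H X]
  {E' H' Y : Type*} [NormedAddCommGroup E'] [NormedSpace ℝ E'] [TopologicalSpace H']
  [TopologicalSpace Y] [ChartedSpace H' Y]

/-- Let `S`, `B` be the unit sphere and the open unit ball of `V`, let `K` be a cone in `W`
(the whole space, or a closed half-space), and let `B_K`, `S_K` be the intersections of `K` with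
the open unit ball and with the unit sphere of `W`.
Let `φ : S × B_K → X` be a smooth embedding onto an open subset of `X`.
`IsSurgeryAlong I J K φ a b` says that the manifold `Y` is the result of the surgery along `φ`:
it is, through the maps `a` and `b`, the union of `X \ φ(S × {0})` and of `B × S_K`, glued along
open subsets by
`φ (u, θ v) ∼ (θ u, v)` for `u ∈ S`, `v ∈ S_K`, `0 < θ < 1`.
(This is the usual smooth form of removing `φ(S × B_K)` and gluing in `closure B × S_K` along
`S × S_K`.) The smooth manifold `Y` is determined by this up to diffeomorphism. -/
structure IsSurgeryAlong (I : ModelWithCorners ℝ E H) (J : ModelWithCorners ℝ E' H')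
    (K : Set W) (φ : V × W → X) (a : X → Y) (b : V × W → Y) : Prop where
  embedding : IsOpenSmoothEmbeddingOn 𝓘(ℝ, V × W) I φ (sphere 0 1 ×ˢ (ball 0 1 ∩ K))
  old_part : IsOpenSmoothEmbeddingOn I J a (φ '' (sphere 0 1 ×ˢ {0}))ᶜ
  new_part : IsOpenSmoothEmbeddingOn 𝓘(ℝ, V × W) J b (ball 0 1 ×ˢ (sphere 0 1 ∩ K))
  cover : a '' (φ '' (sphere 0 1 ×ˢ {0}))ᶜ ∪ b '' (ball 0 1 ×ˢ (sphere 0 1 ∩ K)) = univ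
  glue : ∀ x ∈ (φ '' (sphere 0 1 ×ˢ {0}))ᶜ, ∀ z ∈ ball (0 : V) 1, ∀ v ∈ sphere (0 : W) 1 ∩ K,
    a x = b (z, v) ↔
      ∃ u ∈ sphere (0 : V) 1, ∃ θ ∈ Ioo (0 : ℝ) 1, z = θ • u ∧ x = φ (u, θ • v)

/-- `Y` is obtained from `X` (of dimension `d + r`, possibly with boundary) by an interior surgery
of dimension `d`, i.e. by the surgery along some embedding `φ : S^d × B^r → X` with image in the
interior of `X`. -/
def IsObtainedByInteriorSurgery (d r : ℕ) (I : ModelWithCorners ℝ E H)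
    (J : ModelWithCorners ℝ E' H') (X Y : Type*) [TopologicalSpace X] [ChartedSpace H X]
    [TopologicalSpace Y] [ChartedSpace H' Y] : Prop :=
  ∃ (φ : Euc (d + 1) × Euc r → X) (a : X → Y) (b : Euc (d + 1) × Euc r → Y),
    φ '' (sphere 0 1 ×ˢ ball 0 1) ⊆ I.interior X ∧ IsSurgeryAlong I J univ φ a b

/-- `Y` is obtained from the manifold with boundary `X` by attaching a `p`-dimensional handle
along the embedding `f : S^(p-1) × B^q → ∂X`. The attachment is expressed as a half-surgery, so
that `Y` is smooth without any smoothing of corners: with a collar of `∂X`, the map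
`f` is extended to an embedding `F : S^(p-1) × B_-^(q+1) → X` with `F(x, (y, 0)) = f(x, y)`, and
`Y` is the union of `X \ F(S^(p-1) × {0})` and of the handle `B^p × S_-^q`, glued by
`F(u, θ v) ∼ (θ u, v)`; the maps `a` and `b` are the inclusions of these two pieces in `Y`.
(The handle `B^p × S_-^q` is diffeomorphic to the product of `B^p` and a closed `q`-ball.
On the boundary, this is the surgery along `f`, with `B^p × S^(q-1)` as the new part.) -/
def IsHandleAttachment {p q : ℕ} (I : ModelWithCorners ℝ E H) (J : ModelWithCorners ℝ E' H')
    (f : Euc p × Euc q → X) (a : X → Y) (b : Euc p × EucSucc q → Y) : Prop :=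
  ∃ F : Euc p × EucSucc q → X,
    (∀ x ∈ sphere (0 : Euc p) 1, ∀ y ∈ ball (0 : Euc q) 1,
      F (x, WithLp.toLp 2 (y, 0)) = f (x, y)) ∧
    IsSurgeryAlong I J (lowerHalf q) F a b

/-- If `b : B^p × S_-^q → Y` is the inclusion of a handle, this is the attaching map
`S^(q-1) × B^p → ∂Y`, `(v, z) ↦ b (z, v)`, of the dual handle (the embedding that defines the dual
surgery): the inclusion in `∂Y` of the boundary part `B^p × S^(q-1)` of the handle. -/
def dualAttachingMap {p q : ℕ} (b : Euc p × EucSucc q → Y) : Euc q × Euc p → Y :=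
  fun w => b (w.2, WithLp.toLp 2 (w.1, 0))

end Surgery

/-!
Write `p = k + 1` and `q = n - k`, and let `X = M × [0, 1]`. The first handle `B^p × S_-^q` is glued
to `X` along `S^(p-1) × B_-^(q+1)`, and the dual handle `B^q × S_-^p` is glued along a collar of
the part `B^p × S^(q-1)` of the boundary of the first one. The two attachments together amount to a
single surgery along an embedded sphere `S^(p-1)` in the interior of `X`, namely the attaching sphere
of the first handle pushed into the interior. Such a surgery does not change the boundary, and it is
undone by the surgery along the sphere `S^q` in the new part. Three steps make this precise.

* The dual handle is attached by means of some extension of the attaching map to a collar, and this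
  extension is arbitrary. By the uniqueness of collars it agrees near the attaching sphere with the
  explicit collar `handleCollar` of `B^p × S^(q-1)`, up to a diffeomorphism that is the identity
  outside of a neighbourhood of the attaching sphere (`exists_straightening`). A surgery depends
  only on the germ of the embedding (`IsSurgeryAlong.exists_of_eq_near`) and is natural for
  diffeomorphisms (`IsSurgeryAlong.comp_diffeo`), so that the collar may be taken to be
  `handleCollar` (`exists_isSurgeryAlong_handleCollar`).

* In the coordinates `(u, (y, t))` of `S^(p-1) × B_-^(q+1)`, a slide in the direction of `t`, with
  compact support, identifies the complement of the arcs `{u} × {0} × [-1/2, 0]` with the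
  complement of the attaching sphere `{u} × {0} × {0}` (`slide`, `isOpenSmoothEmbeddingOn_arcSlide`).
  The half-open arcs `{u} × {0} × (-1/2, 0]` become the core `{0} × S_-^p` of the dual handle,
  without its pole. This embeds the complement of the sphere `S^(p-1) × {(0, -1/2)}` into the result
  of both attachments (`dualOld`). What remains of the two handles is filled by a product
  `B^p × S^q` (`dualNew`): the complement of the pole of `S^q` lies in the first handle
  (`lowerChart`), and the upper half of `S^q` in the dual handle (`upperChart`). All formulas are
  explicit, and the slide is chosen such that in suitable coordinates `coreMap` around the pushed
  sphere both parts are glued precisely as in a surgery (`dualOld_coreMap`). Hence the two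
  attachments are one interior surgery (`exists_isSurgeryAlong_univ`).

* The image of `S^(p-1) × B^(q+1)` under an open embedding consists of interior points, and so does
  that of `B^p × S^q`. Therefore the boundary is carried over unchanged
  (`IsSurgeryAlong.boundary_eq`); for `M × [0, 1]` it is the union of two copies of `M`
  (`range_endsMap`). The definition of surgery is symmetric in the old and the new part up to the
  exchange of the factors, which gives the surgery in the opposite direction
  (`IsSurgeryAlong.symm`, `IsSurgeryAlong.isObtainedByInteriorSurgery`).

A technical point in the uniqueness of collars is that the unit sphere is treated as a subset of a
vector space `V`. Maps of a collar of the sphere are extended to homogeneous maps of a cone over it,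
whose domain has unique derivatives.
-/

set_option linter.unusedSectionVars false

/-! ### Open smooth embeddings of subsets -/

namespace IsOpenSmoothEmbeddingOn

variable {E H X : Type*} [NormedAddCommGroup E] [NormedSpace ℝ E] [TopologicalSpace H]
  [TopologicalSpace X] [ChartedSpace H X]
  {E' H' Y : Type*} [NormedAddCommGroup E'] [NormedSpace ℝ E'] [TopologicalSpace H']
  [TopologicalSpace Y] [ChartedSpace H' Y]
  {E'' H'' Z : Type*} [NormedAddCommGroup E''] [NormedSpace ℝ E''] [TopologicalSpace H'']
  [TopologicalSpace Z] [ChartedSpace H'' Z]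
  {I : ModelWithCorners ℝ E H} {J : ModelWithCorners ℝ E' H'} {K : ModelWithCorners ℝ E'' H''}
  {f : X → Y} {s : Set X}

theorem injOn (hf : IsOpenSmoothEmbeddingOn I J f s) : InjOn f s := by
  obtain ⟨-, -, g, -, hg⟩ := hf
  exact fun x hx y hy h => by rw [← hg x hx, ← hg y hy, h]

theorem contMDiffOn_leftInv (hf : IsOpenSmoothEmbeddingOn I J f s) {g : Y → X}
    (hg : ∀ x ∈ s, g (f x) = x) : ContMDiffOn J I ∞ g (f '' s) := by
  obtain ⟨-, -, g', hg', h⟩ := hf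
  refine hg'.congr ?_
  rintro _ ⟨x, hx, rfl⟩
  rw [hg x hx, h x hx]

theorem congr (hf : IsOpenSmoothEmbeddingOn I J f s) {f' : X → Y} (h : EqOn f' f s) :
    IsOpenSmoothEmbeddingOn I J f' s := by
  obtain ⟨ho, hs, g, hg, hgf⟩ := hf
  rw [← h.image_eq] at ho hg
  exact ⟨ho, hs.congr h, g, hg, fun x hx => by rw [h hx, hgf x hx]⟩

theorem isOpen_image_inter (hf : IsOpenSmoothEmbeddingOn I J f s) {U : Set X} (hU : IsOpen U) :
    IsOpen (f '' (s ∩ U)) := by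
  obtain ⟨ho, -, g, hg, hgf⟩ := hf
  have : f '' (s ∩ U) = f '' s ∩ g ⁻¹' U := by
    ext y
    constructor
    · rintro ⟨x, ⟨hx, hxU⟩, rfl⟩
      exact ⟨⟨x, hx, rfl⟩, by simpa [hgf x hx] using hxU⟩
    · rintro ⟨⟨x, hx, rfl⟩, hxU⟩
      exact ⟨x, ⟨hx, by simpa [hgf x hx] using hxU⟩, rfl⟩
  rw [this]
  exact hg.continuousOn.isOpen_inter_preimage ho hU

theorem inter_open (hf : IsOpenSmoothEmbeddingOn I J f s) {U : Set X} (hU : IsOpen U) :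
    IsOpenSmoothEmbeddingOn I J f (s ∩ U) := by
  refine ⟨hf.isOpen_image_inter hU, hf.2.1.mono inter_subset_left, ?_⟩
  obtain ⟨-, -, g, hg, hgf⟩ := hf
  exact ⟨g, hg.mono (image_mono inter_subset_left), fun x hx => hgf x hx.1⟩

/-- Precomposition with a change of coordinates `h`, whose inverse `k` is defined on a relatively
open subset of the source of the embedding `φ`. Neither source has to be open. -/
theorem comp_of_inverse {φ : Y → Z} {D : Set Y} (hφ : IsOpenSmoothEmbeddingOn J K φ D)
    {h : X → Y} {k : Y → X} {O : Set Y} (hO : IsOpen O) (hh : ContMDiffOn I J ∞ h s)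
    (hk : ContMDiffOn J I ∞ k (D ∩ O)) (hs : MapsTo h s (D ∩ O)) (ks : MapsTo k (D ∩ O) s)
    (kh : ∀ x ∈ s, k (h x) = x) (hk' : ∀ y ∈ D ∩ O, h (k y) = y) :
    IsOpenSmoothEmbeddingOn I K (φ ∘ h) s := by
  have him : (φ ∘ h) '' s = φ '' (D ∩ O) := by
    rw [image_comp]
    congr 1
    exact Subset.antisymm hs.image_subset fun y hy => ⟨k y, ks hy, hk' y hy⟩
  have hφ' := hφ.inter_open hO
  refine ⟨him ▸ hφ'.1, hφ'.2.1.comp hh hs, ?_⟩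
  obtain ⟨-, -, g, hg, hgf⟩ := hφ'
  refine ⟨k ∘ g, ?_, fun x hx => by simp [hgf _ (hs hx), kh x hx]⟩
  rw [him]
  refine hk.comp hg ?_
  rintro _ ⟨y, hy, rfl⟩
  simpa [hgf y hy] using hy

theorem comp {g : Y → Z} {t : Set Y} (hg : IsOpenSmoothEmbeddingOn J K g t)
    (hf : IsOpenSmoothEmbeddingOn I J f s) (hst : MapsTo f s t) :
    IsOpenSmoothEmbeddingOn I K (g ∘ f) s := by
  have him : t ∩ f '' s = f '' s := inter_eq_right.2 hst.image_subset
  obtain ⟨ho, hs, k, hk, hkf⟩ := hf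
  refine hg.comp_of_inverse (k := k) ho hs (him.symm ▸ hk) ?_ ?_ hkf ?_
  · exact fun x hx => ⟨hst hx, x, hx, rfl⟩
  · rintro _ ⟨-, x, hx, rfl⟩
    rwa [hkf x hx]
  · rintro _ ⟨-, x, hx, rfl⟩
    rw [hkf x hx]

/-- Two open smooth embeddings with the same source differ by a diffeomorphism of their images. -/
theorem transition (hf : IsOpenSmoothEmbeddingOn I J f s) {φ : X → Z}
    (hφ : IsOpenSmoothEmbeddingOn I K φ s) {f' : Y → X} (hf' : ∀ x ∈ s, f' (f x) = x) :
    IsOpenSmoothEmbeddingOn J K (φ ∘ f') (f '' s) := by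
  have him : (φ ∘ f') '' (f '' s) = φ '' s := by
    rw [image_image]
    exact image_congr fun x hx => by simp [hf' x hx]
  refine ⟨him ▸ hφ.1, hφ.2.1.comp (hf.contMDiffOn_leftInv hf') ?_, ?_⟩
  · rintro _ ⟨x, hx, rfl⟩
    rwa [mem_preimage, hf' x hx]
  · obtain ⟨-, -, k, hk, hkφ⟩ := hφ
    refine ⟨f ∘ k, ?_, ?_⟩
    · rw [him]
      refine hf.2.1.comp hk ?_
      rintro _ ⟨x, hx, rfl⟩
      rwa [mem_preimage, hkφ x hx]
    · rintro _ ⟨x, hx, rfl⟩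
      simp [hf' x hx, hkφ x hx]

/-- Open smooth embeddings can be glued along relatively open subsets, provided that the result
is injective. -/
theorem of_union {U₁ U₂ : Set X} (hU₁ : IsOpen U₁) (hU₂ : IsOpen U₂) (hs : s ⊆ U₁ ∪ U₂)
    (h₁ : IsOpenSmoothEmbeddingOn I J f (s ∩ U₁)) (h₂ : IsOpenSmoothEmbeddingOn I J f (s ∩ U₂))
    (hinj : InjOn f s) : IsOpenSmoothEmbeddingOn I J f s := by
  classical
  have hsu : s = (s ∩ U₁) ∪ (s ∩ U₂) := by
    rw [← inter_union_distrib_left, inter_eq_left.2 hs]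
  have him : f '' s = f '' (s ∩ U₁) ∪ f '' (s ∩ U₂) := by
    rw [← image_union, ← hsu]
  refine ⟨him ▸ h₁.1.union h₂.1, ?_, ?_⟩
  · intro x hx
    rcases hs hx with hxU | hxU
    · exact (h₁.2.1 x ⟨hx, hxU⟩).mono_of_mem_nhdsWithin
        (Filter.inter_mem self_mem_nhdsWithin (mem_nhdsWithin_of_mem_nhds (hU₁.mem_nhds hxU)))
    · exact (h₂.2.1 x ⟨hx, hxU⟩).mono_of_mem_nhdsWithin
        (Filter.inter_mem self_mem_nhdsWithin (mem_nhdsWithin_of_mem_nhds (hU₂.mem_nhds hxU)))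
  · obtain ⟨ho₁, -, g₁, hg₁, hgf₁⟩ := h₁
    obtain ⟨ho₂, -, g₂, hg₂, hgf₂⟩ := h₂
    let g : Y → X := fun y => if y ∈ f '' (s ∩ U₁) then g₁ y else g₂ y
    have hgf : ∀ x ∈ s, g (f x) = x := by
      intro x hx
      by_cases hy : f x ∈ f '' (s ∩ U₁)
      · simp only [g, hy, if_true]
        obtain ⟨x', hx', hxx⟩ := hy
        obtain rfl := hinj hx'.1 hx hxx
        exact hgf₁ x' hx'
      · simp only [g, hy, if_false]
        rcases hs hx with hxU | hxU
        · exact absurd ⟨x, ⟨hx, hxU⟩, rfl⟩ hy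
        · exact hgf₂ x ⟨hx, hxU⟩
    refine ⟨g, ?_, hgf⟩
    rw [him]
    have e₁ : ContMDiffOn J I ∞ g (f '' (s ∩ U₁)) := by
      refine hg₁.congr ?_
      rintro _ ⟨x, hx, rfl⟩
      rw [hgf x hx.1, hgf₁ x hx]
    have e₂ : ContMDiffOn J I ∞ g (f '' (s ∩ U₂)) := by
      refine hg₂.congr ?_
      rintro _ ⟨x, hx, rfl⟩
      rw [hgf x hx.1, hgf₂ x hx]
    exact e₁.union_of_isOpen e₂ ho₁ ho₂

theorem isLocalDiffeomorphAt (hf : IsOpenSmoothEmbeddingOn I J f s) (hs : IsOpen s) {x : X}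
    (hx : x ∈ s) : IsLocalDiffeomorphAt I J ∞ f x := by
  obtain ⟨ho, hf, g, hg, hgf⟩ := hf
  refine ⟨{ toFun := f, invFun := g, source := s, target := f '' s,
            map_source' := fun x hx => ⟨x, hx, rfl⟩, map_target' := ?_,
            left_inv' := hgf, right_inv' := ?_, open_source := hs, open_target := ho,
            contMDiffOn_toFun := hf, contMDiffOn_invFun := hg }, hx, fun _ _ => rfl⟩
  · rintro _ ⟨x, hx, rfl⟩
    rwa [hgf x hx]
  · rintro _ ⟨x, hx, rfl⟩
    rw [hgf x hx]

theorem isInteriorPoint_iff (hf : IsOpenSmoothEmbeddingOn I J f s) (hs : IsOpen s) {x : X}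
    (hx : x ∈ s) : J.IsInteriorPoint (f x) ↔ I.IsInteriorPoint x :=
  ((hf.isLocalDiffeomorphAt hs hx).isInteriorPoint_iff (by simp)).symm

theorem isOpenSmoothEmbeddingOn_id {s : Set X} (hs : IsOpen s) :
    IsOpenSmoothEmbeddingOn I I (fun x : X => x) s :=
  ⟨by simpa using hs, contMDiffOn_id, fun x => x, contMDiffOn_id, fun _ _ => rfl⟩

end IsOpenSmoothEmbeddingOn

/-! ### Smoothness of inverse maps on sets with boundary -/

open scoped Topology in
/-- The easy part of the inverse function theorem, within sets: a continuous right inverse of a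
smooth map with injective derivatives is smooth. There is no condition on the set `t`. -/
theorem ContDiffOn.of_rightInvOn {E : Type*} [NormedAddCommGroup E] [NormedSpace ℝ E]
    [FiniteDimensional ℝ E] {f g : E → E} {s t : Set E} (hf : ContDiffOn ℝ ∞ f s)
    (hs : UniqueDiffOn ℝ s) (hinj : ∀ x ∈ s, Function.Injective (fderivWithin ℝ f s x))
    (hg : ContinuousOn g t) (hgs : MapsTo g t s) (hfg : ∀ y ∈ t, f (g y) = y) :
    ContDiffOn ℝ ∞ g t := by
  have : CompleteSpace E := FiniteDimensional.complete ℝ E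
  have hequiv : ∀ x ∈ s, ∃ e : E ≃L[ℝ] E, (e : E →L[ℝ] E) = fderivWithin ℝ f s x := by
    intro x hx
    refine ⟨(LinearEquiv.ofInjectiveEndo (fderivWithin ℝ f s x : E →ₗ[ℝ] E)
      (hinj x hx)).toContinuousLinearEquiv, ?_⟩
    ext v
    rfl
  have hderiv : ∀ y ∈ t, HasFDerivWithinAt g
      (ContinuousLinearMap.inverse (fderivWithin ℝ f s (g y))) t y := by
    intro y hy
    obtain ⟨e, he⟩ := hequiv _ (hgs hy)
    rw [← he, ContinuousLinearMap.inverse_equiv]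
    refine HasFDerivWithinAt.of_local_left_inverse (f := f) (t := s) ?_ ?_ hy ?_
    · exact (hg y hy).tendsto_nhdsWithin hgs
    · rw [he]
      exact ((hf.differentiableOn (by simp)) _ (hgs hy)).hasFDerivWithinAt
    · filter_upwards [self_mem_nhdsWithin] with z hz using hfg z hz
  have hf' : ContDiffOn ℝ ∞ (fderivWithin ℝ f s) s :=
    hf.fderivWithin hs (by simp)
  rw [contDiffOn_infty]
  intro n
  induction n with
  | zero => exact contDiffOn_zero.2 hg
  | succ n ih =>
    intro y hy
    push_cast
    rw [contDiffWithinAt_succ_iff_hasFDerivWithinAt (by simp)]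
    refine ⟨t, by simpa [insert_eq_of_mem hy] using self_mem_nhdsWithin, by simp,
      fun y => ContinuousLinearMap.inverse (fderivWithin ℝ f s (g y)), hderiv, ?_⟩
    obtain ⟨e, he⟩ := hequiv _ (hgs hy)
    have h1 : ContDiffAt ℝ n (ContinuousLinearMap.inverse : (E →L[ℝ] E) → _)
        (fderivWithin ℝ f s (g y)) := by
      rw [← he]
      exact contDiffAt_map_inverse e
    have h2 : ContDiffWithinAt ℝ n (fun y => fderivWithin ℝ f s (g y)) t y :=
      ((hf'.of_le (by exact_mod_cast le_top)).comp ih hgs) y hy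
    exact h1.comp_contDiffWithinAt y h2

/-- A part of the half-space `{t ≤ 0}` cut out by an open set has unique derivatives. -/
theorem uniqueDiffOn_inter_snd_nonpos {E : Type*} [NormedAddCommGroup E] [NormedSpace ℝ E]
    {O : Set (E × ℝ)} (hO : IsOpen O) : UniqueDiffOn ℝ (O ∩ {x | x.2 ≤ 0}) := by
  rw [inter_comm]
  refine UniqueDiffOn.inter ?_ hO
  have : {x : E × ℝ | x.2 ≤ 0} = univ ×ˢ Iic 0 := by ext; simp
  rw [this]
  exact uniqueDiffOn_univ.prod (uniqueDiffOn_Iic 0)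

section Fibrewise

variable {E : Type*} [NormedAddCommGroup E] [NormedSpace ℝ E] {O D' : Set (E × ℝ)}
  {T τ : E × ℝ → ℝ}

open scoped Topology in
/-- A solution `τ` of `T (x, τ (x, s)) = s` is continuous if `T` is continuous and strictly
increasing in the second variable: nearby values of `T` on both sides of `τ (x, s)` enclose `s`. -/
theorem continuousOn_of_fibrewise_inverse (hO : IsOpen O)
    (hT : ContinuousOn T (O ∩ {x | x.2 ≤ 0}))
    (hmono : ∀ x, StrictMonoOn (fun t => T (x, t)) {t | (x, t) ∈ O ∩ {x | x.2 ≤ 0}})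
    (hτ : ∀ y ∈ D', (y.1, τ y) ∈ O ∩ {x | x.2 ≤ 0}) (hTτ : ∀ y ∈ D', T (y.1, τ y) = y.2) :
    ContinuousOn τ D' := by
  rintro ⟨x, s⟩ hxs
  have h0 : (x, τ (x, s)) ∈ O ∩ {x | x.2 ≤ 0} := hτ _ hxs
  have hnear : ∀ᶠ t in 𝓝 (τ (x, s)), (x, t) ∈ O :=
    (Continuous.prodMk_right x).continuousAt.preimage_mem_nhds (hO.mem_nhds h0.1)
  -- values of `T` at fixed heights depend continuously on the base point
  have hcont : ∀ t, (x, t) ∈ O ∩ {x | x.2 ≤ 0} → ∀ᶠ y in 𝓝[D'] (x, s), (y.1, t) ∈ O := by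
    intro t ht
    have : ContinuousAt (fun y : E × ℝ => (y.1, t)) (x, s) := by fun_prop
    exact nhdsWithin_le_nhds (this.preimage_mem_nhds (hO.mem_nhds ht.1))
  have hlim : ∀ t, (x, t) ∈ O ∩ {x | x.2 ≤ 0} →
      Filter.Tendsto (fun y : E × ℝ => T (y.1, t) - y.2) (𝓝[D'] (x, s)) (𝓝 (T (x, t) - s)) := by
    intro t ht
    have h1 : Filter.Tendsto (fun y : E × ℝ => (y.1, t)) (𝓝[D'] (x, s))
        (𝓝[O ∩ {x | x.2 ≤ 0}] (x, t)) := by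
      refine tendsto_nhdsWithin_iff.2 ⟨?_, ?_⟩
      · have : ContinuousAt (fun y : E × ℝ => (y.1, t)) (x, s) := by fun_prop
        exact this.tendsto.mono_left nhdsWithin_le_nhds
      · filter_upwards [hcont t ht] with y hy using ⟨hy, ht.2⟩
    have h2 : Filter.Tendsto (fun y : E × ℝ => y.2) (𝓝[D'] (x, s)) (𝓝 s) :=
      (continuous_snd.tendsto (x, s)).mono_left nhdsWithin_le_nhds
    exact ((hT _ ht).tendsto.comp h1).sub h2
  have hTs : T (x, τ (x, s)) = s := hTτ _ hxs
  refine tendsto_order.2 ⟨fun a ha => ?_, fun b hb => ?_⟩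
  · obtain ⟨l, hl, hlO⟩ := exists_Ioc_subset_of_mem_nhds hnear ⟨a, ha⟩
    obtain ⟨t, ht1, ht2⟩ := exists_between (max_lt ha hl)
    have htD : (x, t) ∈ O ∩ {x | x.2 ≤ 0} :=
      ⟨hlO ⟨(le_max_right _ _).trans_lt ht1, ht2.le⟩, ht2.le.trans h0.2⟩
    have hlt : T (x, t) - s < 0 := by
      have := hmono x htD h0 ht2
      simp only [hTs] at this
      linarith
    filter_upwards [(hlim t htD).eventually_lt_const hlt, hcont t htD, self_mem_nhdsWithin]
      with y hy hyO hyD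
    refine ((le_max_left _ _).trans_lt ht1).trans ?_
    refine ((hmono y.1).lt_iff_lt ⟨hyO, htD.2⟩ (hτ y hyD)).1 ?_
    simp only [hTτ y hyD]
    linarith
  · rcases eq_or_lt_of_le (show τ (x, s) ≤ 0 from h0.2) with h00 | h00
    · filter_upwards [self_mem_nhdsWithin] with y hyD
      exact (show τ y ≤ 0 from (hτ y hyD).2).trans_lt (h00 ▸ hb)
    · obtain ⟨l, hl, hlO⟩ := exists_Ico_subset_of_mem_nhds hnear ⟨b, hb⟩
      obtain ⟨t, ht1, ht2⟩ := exists_between (lt_min (lt_min hb hl) h00)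
      have htD : (x, t) ∈ O ∩ {x | x.2 ≤ 0} :=
        ⟨hlO ⟨ht1.le, ht2.trans_le ((min_le_left _ _).trans (min_le_right _ _))⟩,
          (ht2.trans_le (min_le_right _ _)).le⟩
      have hlt : 0 < T (x, t) - s := by
        have := hmono x h0 htD ht1
        simp only [hTs] at this
        linarith
      filter_upwards [(hlim t htD).eventually_const_lt hlt, hcont t htD, self_mem_nhdsWithin]
        with y hy hyO hyD
      refine lt_trans ?_ (ht2.trans_le ((min_le_left _ _).trans (min_le_left _ _)))
      refine ((hmono y.1).lt_iff_lt (hτ y hyD) ⟨hyO, htD.2⟩).1 ?_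
      simp only [hTτ y hyD]
      linarith

/-- The inverse of a smooth map of the form `(x, t) ↦ (x, T (x, t))` that is strictly increasing
in `t`, on a part of the half-space `{t ≤ 0}`. -/
theorem contDiffOn_of_fibrewise_inverse [FiniteDimensional ℝ E] (hO : IsOpen O)
    (hT : ContDiffOn ℝ ∞ T (O ∩ {x | x.2 ≤ 0}))
    (hmono : ∀ x, StrictMonoOn (fun t => T (x, t)) {t | (x, t) ∈ O ∩ {x | x.2 ≤ 0}})
    {T' : E × ℝ → ℝ}
    (hder : ∀ y ∈ O ∩ {x | x.2 ≤ 0},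
      HasDerivWithinAt (fun t => T (y.1, t)) (T' y) {t | (y.1, t) ∈ O ∩ {x | x.2 ≤ 0}} y.2)
    (hpos : ∀ y ∈ O ∩ {x | x.2 ≤ 0}, T' y ≠ 0)
    (hτ : ∀ y ∈ D', (y.1, τ y) ∈ O ∩ {x | x.2 ≤ 0}) (hTτ : ∀ y ∈ D', T (y.1, τ y) = y.2) :
    ContDiffOn ℝ ∞ τ D' := by
  have hτc := continuousOn_of_fibrewise_inverse hO hT.continuousOn hmono hτ hTτ
  set D := O ∩ {x : E × ℝ | x.2 ≤ 0} with hD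
  have hU : UniqueDiffOn ℝ D := uniqueDiffOn_inter_snd_nonpos hO
  have hf : ContDiffOn ℝ ∞ (fun y : E × ℝ => (y.1, T y)) D := contDiffOn_fst.prodMk hT
  have hg : ContDiffOn ℝ ∞ (fun y : E × ℝ => (y.1, τ y)) D' := by
    refine hf.of_rightInvOn hU ?_ (continuousOn_fst.prodMk hτc) hτ ?_
    · rintro ⟨x, t⟩ hy
      rw [injective_iff_map_eq_zero]
      rintro ⟨v, r⟩ hvr
      have hdT := (hT.differentiableOn (by simp) _ hy).hasFDerivWithinAt
      have hd : HasFDerivWithinAt (fun y : E × ℝ => (y.1, T y))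
          ((ContinuousLinearMap.fst ℝ E ℝ).prod (fderivWithin ℝ T D (x, t))) D (x, t) :=
        hasFDerivWithinAt_fst.prodMk hdT
      rw [hd.fderivWithin (hU _ hy)] at hvr
      simp only [ContinuousLinearMap.prod_apply, ContinuousLinearMap.coe_fst', Prod.mk_eq_zero]
        at hvr
      obtain ⟨rfl, h2⟩ := hvr
      -- the derivative of `T` in the direction `(0, 1)` is `T'`
      have hline : HasDerivWithinAt (fun t => T (x, t)) (fderivWithin ℝ T D (x, t) (0, 1))
          {t | (x, t) ∈ D} t := by
        have hl : HasDerivWithinAt (fun t : ℝ => (x, t)) ((0 : E), (1 : ℝ)) {t | (x, t) ∈ D} t :=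
          (hasDerivWithinAt_const t _ x).prodMk (hasDerivWithinAt_id t _)
        exact hdT.comp_hasDerivWithinAt t hl (fun _ h => h)
      have huniq : UniqueDiffWithinAt ℝ {t | (x, t) ∈ D} t := by
        have : {t : ℝ | (x, t) ∈ D} = Iic 0 ∩ {t | (x, t) ∈ O} := by
          ext; simp [hD, and_comm]
        rw [this]
        exact ((uniqueDiffOn_Iic 0).inter (hO.preimage (Continuous.prodMk_right x))) t
          ⟨hy.2, hy.1⟩
      have heq : fderivWithin ℝ T D (x, t) (0, 1) = T' (x, t) :=
        huniq.eq_deriv _ hline (hder _ hy)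
      have : (0, r) = r • ((0 : E), (1 : ℝ)) := by simp
      rw [this, map_smul, heq, smul_eq_mul, mul_eq_zero] at h2
      simpa [hpos _ hy] using h2
    · intro y hy
      simp [hTτ y hy]
  exact hg.snd

end Fibrewise

/-! ### Cut-off functions and maps preserving the fibres of a collar -/

section Collar

variable {V U : Type*} [NormedAddCommGroup V] [InnerProductSpace ℝ V]
  [NormedAddCommGroup U] [InnerProductSpace ℝ U]

/-- A smooth function on `ℝ`, increasing from `0` on `t ≤ -r/2` to `1` on `t ≥ -r/4`. -/
noncomputable def heightCutoff (r t : ℝ) : ℝ := Real.smoothTransition (4 * t / r + 2)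

/-- A smooth function of `‖z‖²`, equal to `1` for `‖z‖ ≤ r/4` and to `0` for `‖z‖ ≥ r/2`. -/
noncomputable def radialCutoff (r : ℝ) (z : U) : ℝ :=
  Real.smoothTransition ((4 - 16 * (‖z‖ ^ 2 / r ^ 2)) / 3)

theorem heightCutoff_contDiff (r : ℝ) : ContDiff ℝ ∞ (heightCutoff r) :=
  Real.smoothTransition.contDiff.comp (by fun_prop)

theorem radialCutoff_contDiff (r : ℝ) : ContDiff ℝ ∞ (radialCutoff r : U → ℝ) :=
  Real.smoothTransition.contDiff.comp
    (((contDiff_const.sub (contDiff_const.mul ((contDiff_norm_sq ℝ).div_const _))).div_const _))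

theorem heightCutoff_nonneg (r t : ℝ) : 0 ≤ heightCutoff r t := Real.smoothTransition.nonneg _
theorem heightCutoff_le_one (r t : ℝ) : heightCutoff r t ≤ 1 := Real.smoothTransition.le_one _
theorem radialCutoff_nonneg (r : ℝ) (z : U) : 0 ≤ radialCutoff r z :=
  Real.smoothTransition.nonneg _
theorem radialCutoff_le_one (r : ℝ) (z : U) : radialCutoff r z ≤ 1 :=
  Real.smoothTransition.le_one _

theorem heightCutoff_eq_zero {r t : ℝ} (hr : 0 < r) (ht : t ≤ -r / 2) : heightCutoff r t = 0 := by
  refine Real.smoothTransition.zero_of_nonpos ?_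
  have : 4 * t / r ≤ -2 := by rw [div_le_iff₀ hr]; linarith
  linarith

theorem heightCutoff_eq_one {r t : ℝ} (hr : 0 < r) (ht : -r / 4 ≤ t) : heightCutoff r t = 1 := by
  refine Real.smoothTransition.one_of_one_le ?_
  have : -1 ≤ 4 * t / r := by rw [le_div_iff₀ hr]; linarith
  linarith

theorem radialCutoff_eq_zero {r : ℝ} {z : U} (hr : 0 < r) (hz : r / 2 ≤ ‖z‖) :
    radialCutoff r z = 0 := by
  refine Real.smoothTransition.zero_of_nonpos ?_
  have : 1 / 4 ≤ ‖z‖ ^ 2 / r ^ 2 := by rw [le_div_iff₀ (by positivity)]; nlinarith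
  linarith

theorem radialCutoff_eq_one {r : ℝ} {z : U} (hr : 0 < r) (hz : ‖z‖ ≤ r / 4) :
    radialCutoff r z = 1 := by
  refine Real.smoothTransition.one_of_one_le ?_
  have : ‖z‖ ^ 2 / r ^ 2 ≤ 1 / 16 := by
    rw [div_le_iff₀ (by positivity)]; nlinarith [norm_nonneg z]
  linarith

theorem heightCutoff_monotone {r : ℝ} (hr : 0 < r) : Monotone (heightCutoff r) := by
  intro a b hab
  exact Real.smoothTransition.monotone (by gcongr)


/-- The part `‖z‖ < r`, `-r < t ≤ 0` of the half-space `{t ≤ 0}` over `V × U ∋ (v, z)`, with the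
origin of `V` removed. It is a conical version of `S × {‖z‖ < r} × (-r, 0]`, where `S` is the unit
sphere of `V`, and unlike that set it has unique derivatives. -/
def coneCollar (V U : Type*) [NormedAddCommGroup V] [NormedAddCommGroup U] (r : ℝ) :
    Set ((V × U) × ℝ) :=
  {y | y.1.1 ≠ 0 ∧ ‖y.1.2‖ < r ∧ -r < y.2} ∩ {y | y.2 ≤ 0}

theorem isOpen_coneCollar_aux (r : ℝ) :
    IsOpen {y : (V × U) × ℝ | y.1.1 ≠ 0 ∧ ‖y.1.2‖ < r ∧ -r < y.2} := by
  have h1 : IsOpen {y : (V × U) × ℝ | y.1.1 ≠ 0} :=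
    isOpen_ne_fun (by fun_prop) (by fun_prop)
  have h2 : IsOpen {y : (V × U) × ℝ | ‖y.1.2‖ < r} := isOpen_lt (by fun_prop) (by fun_prop)
  have h3 : IsOpen {y : (V × U) × ℝ | -r < y.2} := isOpen_lt (by fun_prop) (by fun_prop)
  exact h1.inter (h2.inter h3)

theorem fibre_coneCollar {r : ℝ} {x : V × U} (hv : x.1 ≠ 0) (hz : ‖x.2‖ < r) :
    {t | (x, t) ∈ coneCollar V U r} = Ioc (-r) 0 := by
  ext t
  simp [coneCollar, hv, hz]

/-- Cutting off a height function `S` between `t` and `0`: equal to `S` near `z = 0`, `t = 0`, and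
to `t` away from it. The result is again increasing in `t`, because `S ≥ t`. -/
noncomputable def cutoffHeight (r : ℝ) (S : (V × U) × ℝ → ℝ) (y : (V × U) × ℝ) : ℝ :=
  y.2 + radialCutoff r y.1.2 * heightCutoff r y.2 * (S y - y.2)

theorem cutoffHeight_eq_left {r : ℝ} (hr : 0 < r) {S : (V × U) × ℝ → ℝ} {y : (V × U) × ℝ}
    (hz : ‖y.1.2‖ ≤ r / 4) (ht : -r / 4 ≤ y.2) : cutoffHeight r S y = S y := by
  simp [cutoffHeight, radialCutoff_eq_one hr hz, heightCutoff_eq_one hr ht]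

theorem cutoffHeight_eq_right {r : ℝ} (hr : 0 < r) {S : (V × U) × ℝ → ℝ} {y : (V × U) × ℝ}
    (h : r / 2 ≤ ‖y.1.2‖ ∨ y.2 ≤ -r / 2) : cutoffHeight r S y = y.2 := by
  rcases h with h | h
  · simp [cutoffHeight, radialCutoff_eq_zero hr h]
  · simp [cutoffHeight, heightCutoff_eq_zero hr h]

/-- The cut-off of a height function with `S ≥ t` that is strictly increasing along the fibres is a
diffeomorphism of the collar, fibrewise over `{t = 0}`. -/
theorem exists_inverse_cutoffHeight [FiniteDimensional ℝ V] [FiniteDimensional ℝ U] {r : ℝ}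
    (hr : 0 < r) {S S' : (V × U) × ℝ → ℝ} (hS : ContDiffOn ℝ ∞ S (coneCollar V U r))
    (hS0 : ∀ x : V × U, x.1 ≠ 0 → ‖x.2‖ < r → S (x, 0) = 0)
    (hS' : ∀ y ∈ coneCollar V U r,
      HasDerivWithinAt (fun t => S (y.1, t)) (S' y) (Ioc (-r) 0) y.2)
    (hpos : ∀ y ∈ coneCollar V U r, 0 < S' y) (hle : ∀ y ∈ coneCollar V U r, y.2 ≤ S y) :
    ∃ τ : (V × U) × ℝ → ℝ, ContDiffOn ℝ ∞ τ (coneCollar V U r) ∧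
      ContDiffOn ℝ ∞ (cutoffHeight r S) (coneCollar V U r) ∧
      ∀ y ∈ coneCollar V U r, (y.1, cutoffHeight r S y) ∈ coneCollar V U r ∧
        (y.1, τ y) ∈ coneCollar V U r ∧
        cutoffHeight r S (y.1, τ y) = y.2 ∧ τ (y.1, cutoffHeight r S y) = y.2 := by
  set D := coneCollar V U r with hD
  set M := cutoffHeight r S with hM
  have hMs : ContDiffOn ℝ ∞ M D := by
    refine contDiffOn_snd.add (ContDiffOn.mul (ContDiffOn.mul ?_ ?_) (hS.sub contDiffOn_snd))
    · exact (radialCutoff_contDiff r).comp_contDiffOn (contDiff_snd.comp contDiff_fst).contDiffOn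
    · exact (heightCutoff_contDiff r).comp_contDiffOn contDiff_snd.contDiffOn
  -- the derivative in the direction of the fibres
  let M' : (V × U) × ℝ → ℝ := fun y =>
    1 + (radialCutoff r y.1.2 * deriv (heightCutoff r) y.2 * (S y - y.2)
      + radialCutoff r y.1.2 * heightCutoff r y.2 * (S' y - 1))
  have hMder : ∀ y ∈ D, HasDerivWithinAt (fun t => M (y.1, t)) (M' y) (Ioc (-r) 0) y.2 := by
    intro y hy
    have h1 := (((heightCutoff_contDiff r).differentiable (by simp)) y.2).hasDerivAt
    have h2 := (h1.hasDerivWithinAt (s := Ioc (-r) 0)).const_mul (radialCutoff r y.1.2)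
    exact (hasDerivWithinAt_id y.2 _).add (h2.mul ((hS' y hy).sub (hasDerivWithinAt_id y.2 _)))
  have hMpos : ∀ y ∈ D, 0 < M' y := by
    intro y hy
    have a1 := radialCutoff_nonneg r y.1.2
    have a2 := radialCutoff_le_one r y.1.2
    have a3 := heightCutoff_nonneg r y.2
    have a4 := heightCutoff_le_one r y.2
    have a5 : 0 ≤ deriv (heightCutoff r) y.2 := (heightCutoff_monotone hr).deriv_nonneg
    have a6 := hpos y hy
    have a7 := hle y hy
    set w := radialCutoff r y.1.2 * heightCutoff r y.2 with hw
    have w0 : 0 ≤ w := mul_nonneg a1 a3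
    have w1 : w ≤ 1 := mul_le_one₀ a2 a3 a4
    have b1 : 0 ≤ radialCutoff r y.1.2 * deriv (heightCutoff r) y.2 * (S y - y.2) :=
      mul_nonneg (mul_nonneg a1 a5) (sub_nonneg.2 a7)
    have b2 : 0 < 1 - w + w * S' y := by
      rcases eq_or_lt_of_le w0 with h | h
      · rw [← h]; simp
      · have := mul_pos h a6
        linarith
    simp only [M', ← hw]
    linarith
  have hfib : ∀ y ∈ D, {t | (y.1, t) ∈ D} = Ioc (-r) 0 :=
    fun y hy => fibre_coneCollar hy.1.1 hy.1.2.1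
  have hmono : ∀ x : V × U, StrictMonoOn (fun t => M (x, t)) {t | (x, t) ∈ D} := by
    intro x
    by_cases hx : x.1 ≠ 0 ∧ ‖x.2‖ < r
    · rw [fibre_coneCollar hx.1 hx.2]
      have hmem : ∀ t ∈ Ioc (-r) 0, (x, t) ∈ D := fun t ht => ⟨⟨hx.1, hx.2, ht.1⟩, ht.2⟩
      refine strictMonoOn_of_hasDerivWithinAt_pos (convex_Ioc _ _) (f' := fun t => M' (x, t))
        ?_ ?_ ?_
      · exact fun t ht => (hMder _ (hmem t ht)).continuousWithinAt
      · exact fun t ht => (hMder _ (hmem t (interior_subset ht))).mono interior_subset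
      · exact fun t ht => hMpos _ (hmem t (interior_subset ht))
    · have : {t | (x, t) ∈ D} = ∅ := by
        ext t
        simp only [mem_ofPred_eq, mem_empty_iff_false, iff_false]
        exact fun h => hx ⟨h.1.1, h.1.2.1⟩
      rw [this]
      exact Set.subsingleton_empty.strictMonoOn _
  have h0 : ∀ y ∈ D, M (y.1, 0) = 0 := by
    intro y hy
    simp [hM, cutoffHeight, hS0 y.1 hy.1.1 hy.1.2.1]
  have h0D : ∀ y ∈ D, (y.1, (0 : ℝ)) ∈ D := fun y hy =>
    ⟨⟨hy.1.1, hy.1.2.1, by simpa using hr⟩, (le_refl (0 : ℝ) :)⟩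
  have hmap : ∀ y ∈ D, (y.1, M y) ∈ D := by
    intro y hy
    refine ⟨⟨hy.1.1, hy.1.2.1, ?_⟩, ?_⟩
    · refine hy.1.2.2.trans_le ?_
      exact le_add_of_nonneg_right (mul_nonneg (mul_nonneg (radialCutoff_nonneg _ _)
        (heightCutoff_nonneg _ _)) (sub_nonneg.2 (hle y hy)))
    · show M y ≤ 0
      rw [← h0 y hy]
      exact (hmono y.1).monotoneOn hy (h0D y hy) hy.2
  -- surjectivity on the fibres, by the intermediate value theorem
  have hsurj : ∀ y ∈ D, ∃ t, (y.1, t) ∈ D ∧ M (y.1, t) = y.2 := by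
    intro y hy
    rcases le_total y.2 (-r / 2) with h | h
    · exact ⟨y.2, hy, cutoffHeight_eq_right hr (Or.inr h)⟩
    · have hc : ContinuousOn (fun t => M (y.1, t)) (Icc (-r / 2) 0) := by
        intro t ht
        have : t ∈ Ioc (-r) 0 := ⟨by linarith [ht.1], ht.2⟩
        have htD : (y.1, t) ∈ D := ⟨⟨hy.1.1, hy.1.2.1, this.1⟩, this.2⟩
        refine ((hMder _ htD).continuousWithinAt).mono fun t' ht' => ⟨by linarith [ht'.1], ht'.2⟩
      have e1 : M (y.1, -r / 2) = -r / 2 := cutoffHeight_eq_right hr (Or.inr le_rfl)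
      obtain ⟨t, ht, hMt⟩ := intermediate_value_Icc (by linarith) hc
        (show y.2 ∈ Icc (M (y.1, -r / 2)) (M (y.1, 0)) by rw [e1, h0 y hy]; exact ⟨h, hy.2⟩)
      exact ⟨t, ⟨⟨hy.1.1, hy.1.2.1, by linarith [ht.1]⟩, ht.2⟩, hMt⟩
  choose! τ hτD hτ using hsurj
  refine ⟨τ, ?_, hMs, fun y hy => ⟨hmap y hy, hτD y hy, hτ y hy, ?_⟩⟩
  · refine contDiffOn_of_fibrewise_inverse (isOpen_coneCollar_aux r) hMs hmono (T' := M') ?_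
      (fun y hy => (hMpos y hy).ne') hτD hτ
    intro y hy
    have := hMder y hy
    rwa [← hfib y hy] at this
  · have h1 := hmap y hy
    exact (hmono y.1).injOn (hτD (y.1, M y) h1) hy (hτ (y.1, M y) h1)

end Collar

/-! ### Families of diffeomorphisms close to the identity -/

section Collar

variable {V U : Type*} [NormedAddCommGroup V] [InnerProductSpace ℝ V]
  [NormedAddCommGroup U] [InnerProductSpace ℝ U]
  [FiniteDimensional ℝ V] [FiniteDimensional ℝ U]

/-- A height function `T` on the collar, increasing along the fibres, can be replaced by one that
agrees with `T` near `z = 0`, `t = 0` and with `t` away from it. It is the composition of the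
cut-off version of `T / C` and of the inverse of the cut-off version of `t / C`. -/
theorem exists_height_straightening {r : ℝ} (hr : 0 < r) {T T' : (V × U) × ℝ → ℝ}
    (hT : ContDiffOn ℝ ∞ T (coneCollar V U r))
    (hT0 : ∀ x : V × U, x.1 ≠ 0 → ‖x.2‖ < r → T (x, 0) = 0)
    (hT' : ∀ y ∈ coneCollar V U r,
      HasDerivWithinAt (fun t => T (y.1, t)) (T' y) (Ioc (-r) 0) y.2)
    (hpos : ∀ y ∈ coneCollar V U r, 0 < T' y) {C : ℝ} (hC : 1 ≤ C)
    (hle : ∀ y ∈ coneCollar V U r, C * y.2 ≤ T y) :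
    ∃ T₁ τ₁ : (V × U) × ℝ → ℝ, ContDiffOn ℝ ∞ T₁ (coneCollar V U r) ∧
      ContDiffOn ℝ ∞ τ₁ (coneCollar V U r) ∧
      (∀ y ∈ coneCollar V U r, (y.1, T₁ y) ∈ coneCollar V U r ∧ (y.1, τ₁ y) ∈ coneCollar V U r ∧
        T₁ (y.1, τ₁ y) = y.2 ∧ τ₁ (y.1, T₁ y) = y.2) ∧
      (∀ x : V × U, x.1 ≠ 0 → ‖x.2‖ < r → T₁ (x, 0) = 0) ∧
      (∀ y ∈ coneCollar V U r, r / 2 ≤ ‖y.1.2‖ ∨ y.2 ≤ -r / 2 → T₁ y = y.2) ∧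
      ∃ ρ > 0, ∀ y ∈ coneCollar V U r, ‖y.1.2‖ ≤ ρ → -ρ ≤ y.2 → T₁ y = T y := by
  have hC0 : 0 < C := by linarith
  have key : ∀ y ∈ coneCollar V U r, y.2 ≤ T y / C := fun y hy => by
    rw [le_div_iff₀ hC0]; linarith [hle y hy]
  have key' : ∀ y ∈ coneCollar V U r, y.2 ≤ y.2 / C := fun y hy => by
    have hy2 : y.2 ≤ 0 := hy.2
    rw [le_div_iff₀ hC0]; nlinarith
  have hTneg : ∀ y ∈ coneCollar V U r, T y ≤ 0 := by
    intro y hy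
    have hmono : MonotoneOn (fun t => T (y.1, t)) (Ioc (-r) 0) := by
      have hmem : ∀ t ∈ Ioc (-r) 0, (y.1, t) ∈ coneCollar V U r :=
        fun t ht => ⟨⟨hy.1.1, hy.1.2.1, ht.1⟩, ht.2⟩
      refine (strictMonoOn_of_hasDerivWithinAt_pos (convex_Ioc _ _)
        (f' := fun t => T' (y.1, t)) ?_ ?_ ?_).monotoneOn
      · exact fun t ht => (hT' _ (hmem t ht)).continuousWithinAt
      · exact fun t ht => (hT' _ (hmem t (interior_subset ht))).mono interior_subset
      · exact fun t ht => hpos _ (hmem t (interior_subset ht))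
    rw [← hT0 y.1 hy.1.1 hy.1.2.1]
    exact hmono ⟨hy.1.2.2, hy.2⟩ ⟨by linarith, le_rfl⟩ hy.2
  obtain ⟨τm, hτm, hm, hM⟩ := exists_inverse_cutoffHeight hr (S := fun y => T y / C)
    (S' := fun y => T' y / C) (hT.div_const _) (fun x h1 h2 => by simp [hT0 x h1 h2])
    (fun y hy => (hT' y hy).div_const _) (fun y hy => div_pos (hpos y hy) hC0) key
  obtain ⟨τk, hτk, hk, hK⟩ := exists_inverse_cutoffHeight hr
    (S := fun y : (V × U) × ℝ => y.2 / C)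
    (S' := fun y => 1 / C) (contDiffOn_snd.div_const _) (fun x h1 h2 => by simp)
    (fun y hy => (hasDerivWithinAt_id _ _).div_const _) (fun y hy => div_pos one_pos hC0) key'
  set m := cutoffHeight r (fun y : (V × U) × ℝ => T y / C)
  set k := cutoffHeight r (fun y : (V × U) × ℝ => y.2 / C) with hkdef
  refine ⟨fun y => τk (y.1, m y), fun y => τm (y.1, k y), ?_, ?_, ?_, ?_, ?_, ?_⟩
  · exact hτk.comp (contDiffOn_fst.prodMk hm) fun y hy => (hM y hy).1
  · exact hτm.comp (contDiffOn_fst.prodMk hk) fun y hy => (hK y hy).1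
  · intro y hy
    have h1 := (hM y hy).1
    have h2 := (hK y hy).1
    refine ⟨(hK _ h1).2.1, (hM _ h2).2.1, ?_, ?_⟩
    · show τk (y.1, m (y.1, τm (y.1, k y))) = y.2
      rw [(hM _ h2).2.2.1]
      exact (hK y hy).2.2.2
    · show τm (y.1, k (y.1, τk (y.1, m y))) = y.2
      rw [(hK _ h1).2.2.1]
      exact (hM y hy).2.2.2
  · intro x h1 h2
    have hx : (x, (0 : ℝ)) ∈ coneCollar V U r := ⟨⟨h1, h2, by simpa using hr⟩, (le_refl (0 : ℝ) :)⟩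
    have em : m (x, 0) = 0 := by simp [m, cutoffHeight, hT0 x h1 h2]
    have ek : k (x, 0) = 0 := by simp [k, cutoffHeight]
    show τk (x, m (x, 0)) = 0
    have := (hK _ hx).2.2.2
    rw [ek] at this
    rwa [em]
  · intro y hy h
    have em : m y = y.2 := cutoffHeight_eq_right hr h
    have ek : k y = y.2 := cutoffHeight_eq_right hr h
    show τk (y.1, m y) = y.2
    have := (hK _ hy).2.2.2
    rw [ek] at this
    rwa [em]
  · refine ⟨r / (4 * C), by positivity, fun y hy h1 h2 => ?_⟩
    have hq : r / (4 * C) ≤ r / 4 := by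
      gcongr
      linarith
    have hqC : C * (r / (4 * C)) = r / 4 := by field_simp
    have hT4 : -r / 4 ≤ T y := by
      have := hle y hy
      have : C * (-(r / (4 * C))) ≤ C * y.2 := by gcongr
      linarith
    have hTD : (y.1, T y) ∈ coneCollar V U r :=
      ⟨⟨hy.1.1, hy.1.2.1, show -r < T y by linarith⟩, hTneg y hy⟩
    have em : m y = T y / C := cutoffHeight_eq_left hr (h1.trans hq) (by linarith)
    have ek : k (y.1, T y) = T y / C := cutoffHeight_eq_left hr (h1.trans hq) hT4
    show τk (y.1, m y) = T y
    rw [em, ← ek]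
    exact (hK _ hTD).2.2.2

end Collar

theorem exists_norm_sub_le_of_isCompact {E G : Type*} [NormedAddCommGroup E]
    [NormedAddCommGroup G] {K : Set E} (hK : IsCompact K) {a ε : ℝ} (ha : 0 < a) (hε : 0 < ε)
    {F : E × ℝ → G} (hF : ContinuousOn F (K ×ˢ Icc (-a) 0)) :
    ∃ b, 0 < b ∧ b ≤ a ∧ ∀ x ∈ K, ∀ t ∈ Icc (-b) 0, ‖F (x, t) - F (x, 0)‖ ≤ ε := by
  have hu := (hK.prod isCompact_Icc).uniformContinuousOn_of_continuous hF
  obtain ⟨d, hd, h⟩ := Metric.uniformContinuousOn_iff.1 hu ε hε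
  refine ⟨min a (d / 2), by positivity, min_le_left _ _, fun x hx t ht => ?_⟩
  have h1 : -(min a (d / 2)) ≤ t := ht.1
  have h2 : min a (d / 2) ≤ a := min_le_left _ _
  have h3 : min a (d / 2) ≤ d / 2 := min_le_right _ _
  rw [← dist_eq_norm]
  refine (h (x, t) ⟨hx, by linarith, ht.2⟩ (x, 0) ⟨hx, by linarith, le_rfl⟩ ?_).le
  rw [Prod.dist_eq, dist_self, Real.dist_eq, sub_zero]
  rw [max_lt_iff]
  exact ⟨hd, by rw [abs_of_nonpos ht.2]; linarith⟩

section Collar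

variable {V U : Type*} [NormedAddCommGroup V] [InnerProductSpace ℝ V]
  [NormedAddCommGroup U] [InnerProductSpace ℝ U]
  [FiniteDimensional ℝ V] [FiniteDimensional ℝ U]

theorem cut_mem_coneCollar {r : ℝ} {y : (V × U) × ℝ} (hy : y ∈ coneCollar V U r) {c : ℝ}
    (h0 : 0 ≤ c) (h1 : c ≤ 1) : (y.1, c * y.2) ∈ coneCollar V U r := by
  have hy2 : y.2 ≤ 0 := hy.2
  have hy3 : -r < y.2 := hy.1.2.2
  exact ⟨⟨hy.1.1, hy.1.2.1, show -r < c * y.2 by nlinarith⟩, show c * y.2 ≤ 0 by nlinarith⟩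

/-- A perturbation of the identity that is small in a uniform sense on an annulus: the norm of the
first component is preserved and the difference with the identity is Lipschitz at small distances.
This provides a bijection of the annulus. The image is open and closed in the slices `{v} × ball`,
which are connected and in which the map is the identity near the boundary. -/
theorem bijOn_annulus_of_small [Nontrivial U] {r : ℝ} (hr : 0 < r) {h : V × U → V × U}
    {h' : V × U → (V × U) →L[ℝ] (V × U)}
    (hnorm : ∀ x : V × U, x.1 ≠ 0 → ‖x.2‖ < r → ‖(h x).1‖ = ‖x.1‖)
    (hid : ∀ x : V × U, x.1 ≠ 0 → ‖x.2‖ < r → r / 2 ≤ ‖x.2‖ → h x = x)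
    (hsmall : ∀ x : V × U, 1 / 4 ≤ ‖x.1‖ → ‖x.1‖ ≤ 3 → ‖x.2‖ < r → ‖h x - x‖ ≤ min (1 / 16) (r / 8))
    (hder : ∀ x : V × U, x.1 ≠ 0 → ‖x.2‖ < r → HasStrictFDerivAt h (h' x) x)
    (hder' : ∀ x : V × U, 1 / 4 ≤ ‖x.1‖ → ‖x.1‖ ≤ 3 → ‖x.2‖ < r →
      ‖h' x - ContinuousLinearMap.id ℝ _‖ ≤ 1 / 2) :
    BijOn h {x | 1 / 2 < ‖x.1‖ ∧ ‖x.1‖ < 2 ∧ ‖x.2‖ < r} {x | 1 / 2 < ‖x.1‖ ∧ ‖x.1‖ < 2 ∧ ‖x.2‖ < r} ∧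
    ∀ x y : V × U, 1 / 2 < ‖x.1‖ ∧ ‖x.1‖ < 2 ∧ ‖x.2‖ < r → 1 / 2 < ‖y.1‖ ∧ ‖y.1‖ < 2 ∧ ‖y.2‖ < r →
      ‖x - y‖ < 1 / 4 → ‖(h x - x) - (h y - y)‖ ≤ 1 / 2 * ‖x - y‖ := by
  set W : Set (V × U) := {x | 1 / 2 < ‖x.1‖ ∧ ‖x.1‖ < 2 ∧ ‖x.2‖ < r} with hW
  have hne : ∀ x : V × U, 1 / 4 ≤ ‖x.1‖ → x.1 ≠ 0 := fun x hx h => by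
    rw [h, norm_zero] at hx; norm_num at hx
  have hneW : ∀ x ∈ W, x.1 ≠ 0 := fun x hx => hne x (by linarith [hx.1])
  have hWo : IsOpen W := by
    have h1 : IsOpen {x : V × U | 1 / 2 < ‖x.1‖} := isOpen_lt (by fun_prop) (by fun_prop)
    have h2 : IsOpen {x : V × U | ‖x.1‖ < 2} := isOpen_lt (by fun_prop) (by fun_prop)
    have h3 : IsOpen {x : V × U | ‖x.2‖ < r} := isOpen_lt (by fun_prop) (by fun_prop)
    exact h1.inter (h2.inter h3)
  have hlip : ∀ x ∈ W, ∀ y ∈ W, ‖x - y‖ < 1 / 4 →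
      ‖(h x - x) - (h y - y)‖ ≤ 1 / 2 * ‖x - y‖ := by
    intro x hx y hy hxy
    have hseg : ∀ w ∈ segment ℝ y x, 1 / 4 ≤ ‖w.1‖ ∧ ‖w.1‖ ≤ 3 ∧ ‖w.2‖ < r := by
      intro w hw
      have h1 : ‖w - x‖ ≤ ‖x - y‖ := by
        rw [segment_symm] at hw
        have := norm_sub_le_of_mem_segment hw
        rwa [norm_sub_rev x y]
      have h2 : ‖w.1 - x.1‖ < 1 / 4 := (norm_fst_le (w - x)).trans_lt (h1.trans_lt hxy)
      have h3 := norm_sub_norm_le x.1 w.1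
      have h4 := norm_sub_norm_le w.1 x.1
      rw [norm_sub_rev] at h3
      refine ⟨by linarith [hx.1], by linarith [hx.2.1], ?_⟩
      obtain ⟨a, b, ha, hb, hab, rfl⟩ := hw
      have := (convex_ball (0 : U) r) (x := y.2) (by simpa using hy.2.2) (y := x.2)
        (by simpa using hx.2.2) ha hb hab
      simpa using this
    have := (convex_segment y x).norm_image_sub_le_of_norm_hasFDerivWithin_le
      (f := fun x => h x - x) (f' := fun x => h' x - ContinuousLinearMap.id ℝ _) (C := 1 / 2)
      (fun w hw => ((hder w (hne w (hseg w hw).1) (hseg w hw).2.2).hasFDerivAt.sub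
        (hasFDerivAt_id w)).hasFDerivWithinAt)
      (fun w hw => hder' w (hseg w hw).1 (hseg w hw).2.1 (hseg w hw).2.2)
      (left_mem_segment ℝ y x) (right_mem_segment ℝ y x)
    exact this
  have hsm : ∀ x ∈ W, ‖h x - x‖ ≤ 1 / 16 ∧ ‖h x - x‖ ≤ r / 8 := fun x hx =>
    le_min_iff.1 (hsmall x (by linarith [hx.1]) (by linarith [hx.2.1]) hx.2.2)
  have hmaps : MapsTo h W W := by
    intro x hx
    have hn := hnorm x (hneW x hx) hx.2.2
    refine ⟨hn ▸ hx.1, hn ▸ hx.2.1, ?_⟩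
    rcases le_or_gt (r / 2) ‖x.2‖ with hz | hz
    · rw [hid x (hneW x hx) hx.2.2 hz]
      exact hx.2.2
    · have h1 : ‖(h x).2 - x.2‖ ≤ r / 8 := (norm_snd_le (h x - x)).trans (hsm x hx).2
      have := norm_sub_norm_le (h x).2 x.2
      linarith
  refine ⟨⟨hmaps, ?_, ?_⟩, fun x y hx hy => hlip x hx y hy⟩
  · intro x hx y hy hxy
    have h1 : ‖x - y‖ < 1 / 4 := by
      have e : x - y = (h y - y) - (h x - x) := by rw [hxy]; abel
      rw [e]
      calc _ ≤ ‖h y - y‖ + ‖h x - x‖ := norm_sub_le _ _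
        _ < 1 / 4 := by linarith [(hsm x hx).1, (hsm y hy).1]
    have h2 := hlip x hx y hy h1
    have e : (h x - x) - (h y - y) = y - x := by rw [hxy]; abel
    rw [e, norm_sub_rev] at h2
    have : ‖x - y‖ = 0 := le_antisymm (by linarith) (norm_nonneg _)
    exact sub_eq_zero.1 (norm_eq_zero.1 this)
  · -- surjectivity on the slices `{v} × ball`, which are connected
    have hopen : IsOpen (h '' W) := by
      rw [isOpen_iff_mem_nhds]
      rintro _ ⟨x, hx, rfl⟩
      have hsurj : (h' x).range = ⊤ := by
        have : CompleteSpace (V × U) := FiniteDimensional.complete ℝ _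
        have hinj : Function.Injective (h' x) := by
          rw [injective_iff_map_eq_zero]
          intro w hw
          have h1 := (h' x - ContinuousLinearMap.id ℝ _).le_of_opNorm_le
            (hder' x (by linarith [hx.1]) (by linarith [hx.2.1]) hx.2.2) w
          simp only [sub_apply, hw, ContinuousLinearMap.id_apply, zero_sub,
            norm_neg] at h1
          have : ‖w‖ = 0 := le_antisymm (by linarith) (norm_nonneg _)
          exact norm_eq_zero.1 this
        exact LinearMap.range_eq_top.2 (LinearMap.injective_iff_surjective.1 hinj)
      have hmap := (hder x (hneW x hx) hx.2.2).map_nhds_eq_of_surj hsurj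
      rw [← hmap]
      exact Filter.image_mem_map (hWo.mem_nhds hx)
    rintro ⟨v, z₀⟩ hvz
    have hv0 : v ≠ 0 := hneW _ hvz
    let Kc : Set (V × U) := sphere 0 ‖v‖ ×ˢ closedBall 0 (r * (5 / 8))
    have hKc : IsCompact Kc := (isCompact_sphere _ _).prod (isCompact_closedBall _ _)
    have hKW : Kc ⊆ W := by
      rintro ⟨v', z'⟩ ⟨h1, h2⟩
      simp only [mem_sphere_iff_norm, sub_zero, mem_closedBall, dist_zero_right] at h1 h2
      exact ⟨by simpa [h1] using hvz.1, by simpa [h1] using hvz.2.1,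
        show ‖z'‖ < r by linarith⟩
    have hKcl : IsClosed (h '' Kc) := by
      refine (hKc.image_of_continuousOn fun x hx => ?_).isClosed
      have hxW := hKW hx
      exact (hder x (hneW x hxW) hxW.2.2).continuousAt.continuousWithinAt
    obtain ⟨z₁, hz₁⟩ : ∃ z₁ : U, ‖z₁‖ = r * (3 / 4) := exists_norm_eq U (by positivity)
    have hsub : ball (0 : U) r ⊆ {z | (v, z) ∈ h '' W} := by
      refine IsPreconnected.subset_left_of_subset_union (u := {z | (v, z) ∈ h '' W})
        (v := {z | (v, z) ∉ h '' Kc} ∩ ball 0 (r * (5 / 8))) ?_ ?_ ?_ ?_ ?_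
        (convex_ball (0 : U) r).isPreconnected
      · exact hopen.preimage (by fun_prop : Continuous fun z : U => (v, z))
      · exact (hKcl.isOpen_compl.preimage (by fun_prop : Continuous fun z : U => (v, z))).inter
          isOpen_ball
      · rw [Set.disjoint_left]
        rintro z ⟨x, hx, hxz⟩ ⟨hz1, hz2⟩
        have hn := hnorm x (hneW x hx) hx.2.2
        rw [hxz] at hn
        have hzb : r * (5 / 8) < ‖x.2‖ := by
          by_contra! hcon
          exact hz1 ⟨x, ⟨by simpa using hn.symm, by simpa using hcon⟩, hxz⟩
        rw [hid x (hneW x hx) hx.2.2 (by linarith)] at hxz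
        rw [hxz] at hzb
        simp only [mem_ball, dist_zero_right] at hz2
        exact absurd hzb (not_lt.2 hz2.le)
      · intro z hz
        simp only [mem_ball, dist_zero_right] at hz
        have hvzW : (v, z) ∈ W := ⟨hvz.1, hvz.2.1, hz⟩
        rcases le_or_gt (r / 2) ‖z‖ with hz' | hz'
        · exact Or.inl ⟨(v, z), hvzW, hid _ hv0 hz hz'⟩
        · by_cases hzK : (v, z) ∈ h '' Kc
          · exact Or.inl (image_mono hKW hzK)
          · exact Or.inr ⟨hzK, by simp only [mem_ball, dist_zero_right]; linarith⟩
      · have hz1r : ‖z₁‖ < r := by rw [hz₁]; linarith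
        exact ⟨z₁, by simpa using hz1r, (v, z₁), ⟨hvz.1, hvz.2.1, hz1r⟩,
          hid _ hv0 hz1r (by show r / 2 ≤ ‖z₁‖; rw [hz₁]; linarith)⟩
    exact hsub (by simpa using hvz.2.2)

end Collar

section Collar

variable {V U : Type*} [NormedAddCommGroup V] [InnerProductSpace ℝ V]
  [NormedAddCommGroup U] [InnerProductSpace ℝ U]
  [FiniteDimensional ℝ V] [FiniteDimensional ℝ U]

/-- The part `1/2 < ‖v‖ < 2` of the conical collar. -/
def annulusCollar (V U : Type*) [NormedAddCommGroup V] [NormedAddCommGroup U] (r : ℝ) :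
    Set ((V × U) × ℝ) :=
  {y | 1 / 2 < ‖y.1.1‖ ∧ ‖y.1.1‖ < 2} ∩ coneCollar V U r

open scoped Topology in
/-- A family `X (·, t)` of maps with `X (·, 0) = id` is replaced by a family of diffeomorphisms of
the collar that preserve the height `t`, agreeing with `X` near `z = 0`, `t = 0` and with the
identity away from it. The cut-off is applied to the time `t` and not to the values of `X`, so that
the norm of the first component stays preserved. -/
theorem exists_horizontal_straightening [Nontrivial U] {r : ℝ} (hr : 0 < r)
    {X : (V × U) × ℝ → V × U} (hX : ContDiffOn ℝ ∞ X (coneCollar V U r))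
    (hX0 : ∀ x : V × U, x.1 ≠ 0 → ‖x.2‖ < r → X (x, 0) = x)
    (hnorm : ∀ y ∈ coneCollar V U r, ‖(X y).1‖ = ‖y.1.1‖) :
    ∃ P P' : (V × U) × ℝ → V × U, ContDiffOn ℝ ∞ P (annulusCollar V U r) ∧
      ContDiffOn ℝ ∞ P' (annulusCollar V U r) ∧
      (∀ y ∈ annulusCollar V U r, (P y, y.2) ∈ annulusCollar V U r ∧
        (P' y, y.2) ∈ annulusCollar V U r ∧ P (P' y, y.2) = y.1 ∧ P' (P y, y.2) = y.1 ∧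
        ‖(P y).1‖ = ‖y.1.1‖) ∧
      (∀ y ∈ annulusCollar V U r, y.2 = 0 → P y = y.1) ∧
      (∀ y ∈ annulusCollar V U r, r / 2 ≤ ‖y.1.2‖ ∨ y.2 ≤ -r / 2 → P y = y.1) ∧
      ∃ ρ > 0, ∀ y ∈ annulusCollar V U r, ‖y.1.2‖ ≤ ρ → -ρ ≤ y.2 → P y = X y := by
  set Y := coneCollar V U r with hYdef
  have hYu : UniqueDiffOn ℝ Y := uniqueDiffOn_inter_snd_nonpos (isOpen_coneCollar_aux r)
  let H : (V × U) × ℝ → V × U := fun y => X (y.1, radialCutoff r y.1.2 * y.2)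
  have hH : ContDiffOn ℝ ∞ H Y := by
    refine hX.comp (contDiffOn_fst.prodMk (ContDiffOn.mul ?_ contDiffOn_snd)) ?_
    · exact (radialCutoff_contDiff r).comp_contDiffOn (contDiff_snd.comp contDiff_fst).contDiffOn
    · exact fun y hy => cut_mem_coneCollar hy (radialCutoff_nonneg _ _) (radialCutoff_le_one _ _)
  have hHn : ∀ y ∈ Y, ‖(H y).1‖ = ‖y.1.1‖ := fun y hy =>
    hnorm _ (cut_mem_coneCollar hy (radialCutoff_nonneg _ _) (radialCutoff_le_one _ _))
  have hH0 : ∀ x : V × U, x.1 ≠ 0 → ‖x.2‖ < r → H (x, 0) = x := fun x h1 h2 => by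
    simp [H, hX0 x h1 h2]
  have hHid : ∀ y ∈ Y, r / 2 ≤ ‖y.1.2‖ → H y = y.1 := fun y hy h => by
    simp [H, radialCutoff_eq_zero hr h, hX0 y.1 hy.1.1 hy.1.2.1]
  set W : Set (V × U) := {x | x.1 ≠ 0 ∧ ‖x.2‖ < r} with hW
  have hWo : IsOpen W := by
    have h1 : IsOpen {x : V × U | x.1 ≠ 0} := isOpen_ne_fun (by fun_prop) (by fun_prop)
    have h2 : IsOpen {x : V × U | ‖x.2‖ < r} := isOpen_lt (by fun_prop) (by fun_prop)
    exact h1.inter h2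
  have hmem : ∀ x ∈ W, ∀ t ∈ Ioc (-r) 0, (x, t) ∈ Y := fun x hx t ht => ⟨⟨hx.1, hx.2, ht.1⟩, ht.2⟩
  let DH : (V × U) × ℝ → (V × U) →L[ℝ] (V × U) := fun y =>
    (fderivWithin ℝ H Y y).comp (ContinuousLinearMap.inl ℝ (V × U) ℝ)
  have hDHc : ContinuousOn DH Y :=
    (hH.continuousOn_fderivWithin hYu (by simp)).clm_comp continuousOn_const
  have hDH : ∀ x ∈ W, ∀ t ∈ Ioc (-r) 0, HasStrictFDerivAt (fun x => H (x, t)) (DH (x, t)) x := by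
    intro x hx t ht
    have h1 : ContDiffOn ℝ ∞ (fun x => H (x, t)) W :=
      hH.comp (contDiff_prodMk_left t).contDiffOn fun x hx => hmem x hx t ht
    have h2 := (h1.contDiffAt (hWo.mem_nhds hx)).hasStrictFDerivAt (by simp)
    have h3 : HasFDerivWithinAt (fun x => H (x, t)) (DH (x, t)) W x := by
      have := (hH.differentiableOn (by simp) _ (hmem x hx t ht)).hasFDerivWithinAt
      exact HasFDerivWithinAt.comp (g := H) (f := fun x => (x, t)) x this
        (hasFDerivAt_prodMk_left x t).hasFDerivWithinAt fun x hx => hmem x hx t ht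
    have h4 := h3.hasFDerivAt (hWo.mem_nhds hx)
    rwa [h2.hasFDerivAt.unique h4] at h2
  have hDHid : ∀ x ∈ W, ∀ t ∈ Ioc (-r) 0, (∀ᶠ x' in 𝓝 x, H (x', t) = x') →
      DH (x, t) = ContinuousLinearMap.id ℝ _ := by
    intro x hx t ht h
    have h1 : HasFDerivAt (fun x => H (x, t)) (ContinuousLinearMap.id ℝ _) x :=
      (hasFDerivAt_id x).congr_of_eventuallyEq (by filter_upwards [h] with x' hx' using hx')
    exact (hDH x hx t ht).hasFDerivAt.unique h1
  have h0mem : (0 : ℝ) ∈ Ioc (-r) 0 := ⟨by linarith, le_rfl⟩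
  have hDH0 : ∀ x ∈ W, DH (x, 0) = ContinuousLinearMap.id ℝ _ := fun x hx =>
    hDHid x hx 0 h0mem (by filter_upwards [hWo.mem_nhds hx] with x' hx' using hH0 x' hx'.1 hx'.2)
  -- uniform estimates on a compact annulus
  set K : Set (V × U) := (closedBall 0 3 ∩ {v | 1 / 4 ≤ ‖v‖}) ×ˢ closedBall 0 (3 / 4 * r) with hK
  have hKc : IsCompact K :=
    ((isCompact_closedBall 0 3).inter_right (isClosed_le continuous_const continuous_norm)).prod
      (isCompact_closedBall _ _)
  have hKW : K ⊆ W := by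
    rintro ⟨v, z⟩ ⟨⟨-, h1⟩, h2⟩
    refine ⟨?_, ?_⟩
    · rintro (rfl : v = 0)
      rw [mem_ofPred_eq, norm_zero] at h1
      norm_num at h1
    · simp only [mem_closedBall, dist_zero_right] at h2
      show ‖z‖ < r
      linarith
  have hKY : K ×ˢ Icc (-(r / 2)) 0 ⊆ Y := by
    rintro ⟨x, t⟩ ⟨hx, ht⟩
    exact hmem x (hKW hx) t ⟨by linarith [ht.1], ht.2⟩
  obtain ⟨b₁, hb₁, hb₁r, he₁⟩ := exists_norm_sub_le_of_isCompact hKc (half_pos hr)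
    (show 0 < min (1 / 16) (r / 8) by positivity) (hH.continuousOn.mono hKY)
  obtain ⟨b₂, hb₂, hb₂r, he₂⟩ := exists_norm_sub_le_of_isCompact (F := DH) (G := (V × U) →L[ℝ] (V × U)) hKc
    (half_pos hr) (show (0 : ℝ) < 1 / 2 by norm_num) (hDHc.mono hKY)
  set b := min b₁ b₂ with hb
  have hb0 : 0 < b := lt_min hb₁ hb₂
  have hbr : b ≤ r / 2 := (min_le_left _ _).trans hb₁r
  have hbI : ∀ t ∈ Icc (-b) 0, t ∈ Ioc (-r) 0 := fun t ht => ⟨by linarith [ht.1], ht.2⟩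
  have hsmall : ∀ t ∈ Icc (-b) 0, ∀ x : V × U, 1 / 4 ≤ ‖x.1‖ → ‖x.1‖ ≤ 3 → ‖x.2‖ < r →
      ‖H (x, t) - x‖ ≤ min (1 / 16) (r / 8) ∧
      ‖DH (x, t) - ContinuousLinearMap.id ℝ _‖ ≤ 1 / 2 := by
    intro t ht x h1 h2 h3
    have hx0 : x.1 ≠ 0 := fun h => by rw [h, norm_zero] at h1; norm_num at h1
    rcases le_or_gt ‖x.2‖ (3 / 4 * r) with hz | hz
    · have hxK : x ∈ K := ⟨⟨by simpa using h2, h1⟩, by simpa using hz⟩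
      have e1 := he₁ x hxK t ⟨by linarith [ht.1, min_le_left b₁ b₂], ht.2⟩
      have e2 := he₂ x hxK t ⟨by linarith [ht.1, min_le_right b₁ b₂], ht.2⟩
      rw [hH0 x hx0 h3] at e1
      rw [hDH0 x ⟨hx0, h3⟩] at e2
      exact ⟨e1, e2⟩
    · have e1 : H (x, t) = x := hHid _ (hmem x ⟨hx0, h3⟩ t (hbI t ht)) (by
        show r / 2 ≤ ‖x.2‖; linarith)
      have e2 : DH (x, t) = ContinuousLinearMap.id ℝ _ := by
        refine hDHid x ⟨hx0, h3⟩ t (hbI t ht) ?_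
        have : IsOpen {x : V × U | 3 / 4 * r < ‖x.2‖} := isOpen_lt (by fun_prop) (by fun_prop)
        filter_upwards [hWo.mem_nhds (show x ∈ W from ⟨hx0, h3⟩), this.mem_nhds hz] with x' h1 h2
        have h2' : 3 / 4 * r < ‖x'.2‖ := h2
        exact hHid _ (hmem x' h1 t (hbI t ht)) (by show r / 2 ≤ ‖x'.2‖; linarith)
      rw [e1, e2, sub_self, norm_zero, sub_self]
      exact ⟨by positivity, (norm_zero (E := (V × U) →L[ℝ] (V × U))).trans_le
        (by norm_num : (0 : ℝ) ≤ 1 / 2)⟩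
  -- the cut-off time
  let σ : ℝ → ℝ := fun t => heightCutoff (2 * b) t * t
  have hσs : ContDiff ℝ ∞ σ := (heightCutoff_contDiff _).mul contDiff_id
  have hσ : ∀ t ∈ Ioc (-r) 0, σ t ∈ Icc (-b) 0 := by
    intro t ht
    rcases le_or_gt t (-b) with h | h
    · have : heightCutoff (2 * b) t = 0 := heightCutoff_eq_zero (by positivity) (by linarith)
      simp [σ, this, hb0.le]
    · have h1 := heightCutoff_nonneg (2 * b) t
      have h2 := heightCutoff_le_one (2 * b) t
      exact ⟨by show -b ≤ heightCutoff (2 * b) t * t; nlinarith [ht.2],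
        mul_nonpos_of_nonneg_of_nonpos h1 ht.2⟩
  have hann : ∀ y : (V × U) × ℝ, y ∈ annulusCollar V U r ↔
      (1 / 2 < ‖y.1.1‖ ∧ ‖y.1.1‖ < 2 ∧ ‖y.1.2‖ < r) ∧ y.2 ∈ Ioc (-r) 0 := by
    intro y
    constructor
    · exact fun h => ⟨⟨h.1.1, h.1.2, h.2.1.2.1⟩, h.2.1.2.2, h.2.2⟩
    · rintro ⟨⟨h1, h2, h3⟩, h4, h5⟩
      refine ⟨⟨h1, h2⟩, ⟨?_, h3, h4⟩, h5⟩
      intro h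
      rw [h, norm_zero] at h1
      norm_num at h1
  have hbij : ∀ t ∈ Ioc (-r) 0, _ := fun t ht => bijOn_annulus_of_small hr
    (h := fun x => H (x, σ t)) (h' := fun x => DH (x, σ t))
    (fun x h1 h2 => hHn _ (hmem x ⟨h1, h2⟩ _ (hbI _ (hσ t ht))))
    (fun x h1 h2 h3 => hHid _ (hmem x ⟨h1, h2⟩ _ (hbI _ (hσ t ht))) h3)
    (fun x h1 h2 h3 => (hsmall _ (hσ t ht) x h1 h2 h3).1)
    (fun x h1 h2 => hDH x ⟨h1, h2⟩ _ (hbI _ (hσ t ht)))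
    (fun x h1 h2 h3 => (hsmall _ (hσ t ht) x h1 h2 h3).2)
  set A := annulusCollar V U r with hA
  let P : (V × U) × ℝ → V × U := fun y => H (y.1, σ y.2)
  have hPs : ContDiffOn ℝ ∞ P A := by
    refine hH.comp (contDiffOn_fst.prodMk (hσs.comp_contDiffOn contDiffOn_snd)) fun y hy => ?_
    have := (hann y).1 hy
    exact hmem y.1 ⟨hy.2.1.1, hy.2.1.2.1⟩ _ (hbI _ (hσ _ this.2))
  have hPn : ∀ y ∈ A, ‖(P y).1‖ = ‖y.1.1‖ := fun y hy =>
    hHn _ (hmem y.1 ⟨hy.2.1.1, hy.2.1.2.1⟩ _ (hbI _ (hσ _ ((hann y).1 hy).2)))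
  have hPA : ∀ y ∈ A, (P y, y.2) ∈ A := fun y hy =>
    (hann _).2 ⟨(hbij y.2 ((hann y).1 hy).2).1.1 ((hann y).1 hy).1, ((hann y).1 hy).2⟩
  have hex : ∀ y ∈ A, ∃ x : V × U, (x, y.2) ∈ A ∧ P (x, y.2) = y.1 := by
    intro y hy
    have hy' := (hann y).1 hy
    obtain ⟨x, hx, hxy⟩ := (hbij y.2 hy'.2).1.2.2 hy'.1
    exact ⟨x, (hann _).2 ⟨hx, hy'.2⟩, hxy⟩
  choose! P' hP'A hPP' using hex
  have hP'P : ∀ y ∈ A, P' (P y, y.2) = y.1 := by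
    intro y hy
    have hy' := (hann y).1 hy
    have h1 := hPA y hy
    have h2 := (hann _).1 (hP'A (P y, y.2) h1)
    exact (hbij y.2 hy'.2).1.2.1 h2.1 hy'.1 (hPP' (P y, y.2) h1)
  have hP'c : ContinuousOn P' A := by
    intro y hy
    have hy' := (hann y).1 hy
    have hx := (hann _).1 (hP'A y hy)
    -- the inverse depends continuously on the height as well, by the Lipschitz estimate
    have hc : Filter.Tendsto (fun y' : (V × U) × ℝ => ‖y'.1 - y.1‖ + ‖P (P' y, y'.2) - y.1‖)
        (𝓝[A] y) (𝓝 0) := by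
      have h1 : Filter.Tendsto (fun y' : (V × U) × ℝ => ‖y'.1 - y.1‖) (𝓝[A] y) (𝓝 0) := by
        have : ContinuousAt (fun y' : (V × U) × ℝ => ‖y'.1 - y.1‖) y := by fun_prop
        have := this.tendsto.mono_left (nhdsWithin_le_nhds (s := A))
        simpa using this
      have h2 : Filter.Tendsto (fun y' : (V × U) × ℝ => (P' y, y'.2)) (𝓝[A] y)
          (𝓝[A] (P' y, y.2)) := by
        refine tendsto_nhdsWithin_iff.2 ⟨?_, ?_⟩
        · have : ContinuousAt (fun y' : (V × U) × ℝ => (P' y, y'.2)) y := by fun_prop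
          exact this.tendsto.mono_left nhdsWithin_le_nhds
        · filter_upwards [self_mem_nhdsWithin] with y' hy''
          exact (hann _).2 ⟨hx.1, ((hann y').1 hy'').2⟩
      have h3 := ((hPs.continuousOn _ (hP'A y hy)).tendsto.comp h2).sub_const y.1 |>.norm
      rw [hPP' y hy, sub_self, norm_zero] at h3
      simpa using h1.add h3
    have hclose : ∀ᶠ y' in 𝓝[A] y, ‖y'.1 - y.1‖ < 1 / 16 := by
      have : ContinuousAt (fun y' : (V × U) × ℝ => ‖y'.1 - y.1‖) y := by fun_prop
      have := this.tendsto.mono_left (nhdsWithin_le_nhds (s := A))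
      refine this.eventually_lt_const ?_
      simp
    rw [ContinuousWithinAt, tendsto_iff_norm_sub_tendsto_zero]
    refine squeeze_zero' (Filter.Eventually.of_forall fun _ => norm_nonneg _) ?_
      (by simpa using hc.const_mul 2)
    filter_upwards [hclose, self_mem_nhdsWithin] with y' h1 hyA
    have hy'' := (hann y').1 hyA
    have hx' := (hann _).1 (hP'A y' hyA)
    have s1 := (le_min_iff.1 (hsmall _ (hσ _ hy'.2) (P' y) (by linarith [hx.1.1])
      (by linarith [hx.1.2.1]) hx.1.2.2).1).1
    have s2 := (le_min_iff.1 (hsmall _ (hσ _ hy''.2) (P' y') (by linarith [hx'.1.1])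
      (by linarith [hx'.1.2.1]) hx'.1.2.2).1).1
    have p1 : H (P' y, σ y.2) = y.1 := hPP' y hy
    have p2 : H (P' y', σ y'.2) = y'.1 := hPP' y' hyA
    rw [p1] at s1
    rw [p2] at s2
    have hd : ‖P' y' - P' y‖ < 1 / 4 := by
      have e : P' y' - P' y = (y'.1 - y.1) + (y.1 - P' y) - (y'.1 - P' y') := by abel
      rw [e]
      calc _ ≤ ‖(y'.1 - y.1) + (y.1 - P' y)‖ + ‖y'.1 - P' y'‖ := norm_sub_le _ _
        _ ≤ ‖y'.1 - y.1‖ + ‖y.1 - P' y‖ + ‖y'.1 - P' y'‖ := by gcongr; exact norm_add_le _ _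
        _ < 1 / 4 := by linarith
    have hl := (hbij y'.2 hy''.2).2 (P' y') (P' y) hx'.1 hx.1 hd
    simp only [p2] at hl
    have e : P' y' - P' y = (y'.1 - y.1) - (P (P' y, y'.2) - y.1)
        - ((y'.1 - P' y') - (H (P' y, σ y'.2) - P' y)) := by
      show _ = (y'.1 - y.1) - (H (P' y, σ y'.2) - y.1) - _
      abel
    have : ‖P' y' - P' y‖ ≤ ‖y'.1 - y.1‖ + ‖P (P' y, y'.2) - y.1‖ + 1 / 2 * ‖P' y' - P' y‖ := by
      calc ‖P' y' - P' y‖ = _ := by rw [e]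
        _ ≤ ‖(y'.1 - y.1) - (P (P' y, y'.2) - y.1)‖
          + ‖(y'.1 - P' y') - (H (P' y, σ y'.2) - P' y)‖ := norm_sub_le _ _
        _ ≤ _ := add_le_add (norm_sub_le _ _) hl
    linarith
  have hP's : ContDiffOn ℝ ∞ P' A := by
    have hAo : IsOpen ({y : (V × U) × ℝ | 1 / 2 < ‖y.1.1‖ ∧ ‖y.1.1‖ < 2} ∩
        {y : (V × U) × ℝ | y.1.1 ≠ 0 ∧ ‖y.1.2‖ < r ∧ -r < y.2}) := by
      have h1 : IsOpen {y : (V × U) × ℝ | 1 / 2 < ‖y.1.1‖} := isOpen_lt (by fun_prop) (by fun_prop)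
      have h2 : IsOpen {y : (V × U) × ℝ | ‖y.1.1‖ < 2} := isOpen_lt (by fun_prop) (by fun_prop)
      exact (h1.inter h2).inter (isOpen_coneCollar_aux r)
    have hAu : UniqueDiffOn ℝ A := by
      have := uniqueDiffOn_inter_snd_nonpos hAo
      rwa [inter_assoc] at this
    have hf : ContDiffOn ℝ ∞ (fun y => (P y, y.2)) A := hPs.prodMk contDiffOn_snd
    have hg : ContDiffOn ℝ ∞ (fun y => (P' y, y.2)) A := by
      refine hf.of_rightInvOn hAu ?_ (hP'c.prodMk continuousOn_snd) hP'A ?_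
      · rintro ⟨x, t⟩ hy
        have hy' := (hann _).1 hy
        rw [injective_iff_map_eq_zero]
        rintro ⟨w, c⟩ hwc
        have hdP := (hPs.differentiableOn (by simp) _ hy).hasFDerivWithinAt
        have hd : HasFDerivWithinAt (fun y : (V × U) × ℝ => (P y, y.2))
            ((fderivWithin ℝ P A (x, t)).prod (ContinuousLinearMap.snd ℝ (V × U) ℝ)) A (x, t) :=
          hdP.prodMk hasFDerivWithinAt_snd
        rw [hd.fderivWithin (hAu _ hy)] at hwc
        simp only [ContinuousLinearMap.prod_apply, ContinuousLinearMap.coe_snd', Prod.mk_eq_zero]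
          at hwc
        obtain ⟨h1, rfl⟩ := hwc
        -- the derivative of `P` along the slices is close to the identity
        have hWW : {x : V × U | (1 / 2 < ‖x.1‖ ∧ ‖x.1‖ < 2) ∧ ‖x.2‖ < r} ∈ 𝓝 x := by
          have o1 : IsOpen {x : V × U | 1 / 2 < ‖x.1‖} := isOpen_lt (by fun_prop) (by fun_prop)
          have o2 : IsOpen {x : V × U | ‖x.1‖ < 2} := isOpen_lt (by fun_prop) (by fun_prop)
          have o3 : IsOpen {x : V × U | ‖x.2‖ < r} := isOpen_lt (by fun_prop) (by fun_prop)
          exact ((o1.inter o2).inter o3).mem_nhds ⟨⟨hy'.1.1, hy'.1.2.1⟩, hy'.1.2.2⟩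
        have hs : HasFDerivAt (fun x => P (x, t))
            ((fderivWithin ℝ P A (x, t)).comp (ContinuousLinearMap.inl ℝ (V × U) ℝ)) x := by
          refine HasFDerivWithinAt.hasFDerivAt ?_ hWW
          exact HasFDerivWithinAt.comp (g := P) (f := fun x => (x, t)) x hdP
            (hasFDerivAt_prodMk_left x t).hasFDerivWithinAt fun x' hx' => (hann _).2 ⟨⟨hx'.1.1, hx'.1.2, hx'.2⟩, hy'.2⟩
        have hs' := (hDH x ⟨hy.2.1.1, hy.2.1.2.1⟩ _ (hbI _ (hσ t hy'.2))).hasFDerivAt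
        have heq := hs.unique hs'
        have h2 : DH (x, σ t) w = 0 := by
          rw [← heq]
          simpa using h1
        have h3 := (DH (x, σ t) - ContinuousLinearMap.id ℝ _).le_of_opNorm_le
          (hsmall _ (hσ t hy'.2) x (by linarith [hy'.1.1]) (by linarith [hy'.1.2.1]) hy'.1.2.2).2 w
        simp only [sub_apply, h2, ContinuousLinearMap.id_apply, zero_sub, norm_neg] at h3
        have : ‖w‖ = 0 := le_antisymm (by linarith) (norm_nonneg _)
        simp [norm_eq_zero.1 this]
      · intro y hy
        simp [hPP' y hy]
    exact hg.fst
  refine ⟨P, P', hPs, hP's, fun y hy => ⟨hPA y hy, hP'A y hy, hPP' y hy, hP'P y hy, hPn y hy⟩,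
    ?_, ?_, b / 4, by positivity, ?_⟩
  · intro y hy h0
    have : σ y.2 = 0 := by simp [σ, h0]
    simp only [P, this]
    exact hH0 y.1 hy.2.1.1 hy.2.1.2.1
  · intro y hy h
    have hy' := (hann y).1 hy
    rcases h with h | h
    · exact hHid _ (hmem y.1 ⟨hy.2.1.1, hy.2.1.2.1⟩ _ (hbI _ (hσ _ hy'.2))) h
    · have : σ y.2 = 0 := by
        have : heightCutoff (2 * b) y.2 = 0 :=
          heightCutoff_eq_zero (by positivity) (by linarith)
        simp [σ, this]
      simp only [P, this]
      exact hH0 y.1 hy.2.1.1 hy.2.1.2.1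
  · intro y hy h1 h2
    have e1 : radialCutoff r y.1.2 = 1 := radialCutoff_eq_one hr (by linarith)
    have e2 : heightCutoff (2 * b) y.2 = 1 := heightCutoff_eq_one (by positivity) (by linarith)
    simp [P, H, σ, e1, e2]

end Collar

/-! ### Uniqueness of collars -/

section Collar

variable {V U : Type*} [NormedAddCommGroup V] [InnerProductSpace ℝ V]
  [NormedAddCommGroup U] [InnerProductSpace ℝ U]

/-- The collar `S × {‖z‖ < r} × (-r, 0]` of `S × {‖z‖ < r}`, where `S` is the unit sphere. -/
def sphereCollar (V U : Type*) [NormedAddCommGroup V] [NormedAddCommGroup U] (r : ℝ) :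
    Set ((V × U) × ℝ) :=
  {y | ‖y.1.1‖ = 1 ∧ ‖y.1.2‖ < r ∧ -r < y.2 ∧ y.2 ≤ 0}

/-- The radial projection of the conical collar to the collar over the unit sphere. -/
noncomputable def toSphere (y : (V × U) × ℝ) : (V × U) × ℝ := ((‖y.1.1‖⁻¹ • y.1.1, y.1.2), y.2)

/-- The extension of a map of the collar over the sphere that is homogeneous in `v`. -/
noncomputable def coneExtension (G : (V × U) × ℝ → (V × U) × ℝ) (y : (V × U) × ℝ) :
    (V × U) × ℝ :=
  ((‖y.1.1‖ • (G (toSphere y)).1.1, (G (toSphere y)).1.2), (G (toSphere y)).2)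

theorem toSphere_contDiffOn {s : Set ((V × U) × ℝ)} (hs : ∀ y ∈ s, y.1.1 ≠ 0) :
    ContDiffOn ℝ ∞ (toSphere : (V × U) × ℝ → _) s := by
  have h1 : ContDiffOn ℝ ∞ (fun y : (V × U) × ℝ => y.1.1) s := by fun_prop
  have h2 : ContDiffOn ℝ ∞ (fun y : (V × U) × ℝ => ‖y.1.1‖) s := h1.norm ℝ hs
  have h3 : ContDiffOn ℝ ∞ (fun y : (V × U) × ℝ => ‖y.1.1‖⁻¹) s :=
    h2.inv fun y hy => norm_ne_zero_iff.2 (hs y hy)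
  exact ((h3.smul h1).prodMk (by fun_prop)).prodMk (by fun_prop)

theorem coneExtension_contDiffOn {G : (V × U) × ℝ → (V × U) × ℝ} {s t : Set ((V × U) × ℝ)}
    (hG : ContDiffOn ℝ ∞ G t) (hs : ∀ y ∈ s, y.1.1 ≠ 0) (hst : MapsTo toSphere s t) :
    ContDiffOn ℝ ∞ (coneExtension G) s := by
  have h1 : ContDiffOn ℝ ∞ (fun y => G (toSphere y)) s := hG.comp (toSphere_contDiffOn hs) hst
  have h0 : ContDiffOn ℝ ∞ (fun y : (V × U) × ℝ => y.1.1) s := by fun_prop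
  have h2 : ContDiffOn ℝ ∞ (fun y : (V × U) × ℝ => ‖y.1.1‖) s := h0.norm ℝ hs
  exact ((h2.smul h1.fst.fst).prodMk h1.fst.snd).prodMk h1.snd

theorem toSphere_eq_self {y : (V × U) × ℝ} (hy : ‖y.1.1‖ = 1) : toSphere y = y := by
  simp [toSphere, hy]

theorem norm_toSphere {y : (V × U) × ℝ} (hy : y.1.1 ≠ 0) : ‖(toSphere y).1.1‖ = 1 := by
  simp [toSphere, norm_smul, hy]

theorem toSphere_toSphere {y : (V × U) × ℝ} (hy : y.1.1 ≠ 0) :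
    toSphere (toSphere y) = toSphere y := toSphere_eq_self (norm_toSphere hy)

theorem toSphere_mem {r : ℝ} {y : (V × U) × ℝ} (hy : y ∈ coneCollar V U r) :
    toSphere y ∈ sphereCollar V U r :=
  ⟨norm_toSphere hy.1.1, hy.1.2.1, hy.1.2.2, hy.2⟩

theorem sphereCollar_subset_coneCollar {r : ℝ} : sphereCollar V U r ⊆ coneCollar V U r := by
  rintro y ⟨h1, h2, h3, h4⟩
  refine ⟨⟨?_, h2, h3⟩, h4⟩
  intro h
  rw [h, norm_zero] at h1
  norm_num at h1

theorem sphereCollar_subset_annulusCollar {r : ℝ} :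
    sphereCollar V U r ⊆ annulusCollar V U r := by
  rintro y hy
  refine ⟨?_, sphereCollar_subset_coneCollar hy⟩
  have := hy.1
  exact ⟨by linarith, by linarith⟩

open scoped Topology in
/-- Uniqueness of collars, in the form of a straightening of the germ of a diffeomorphism: if `G` is
the identity on `{t = 0}`, then near `z = 0`, `t = 0` it agrees with a diffeomorphism `Φ` of the
collar that is the identity away from there. The height component of `G` is straightened first; what
remains is a family of maps of `S × {‖z‖ < r}`, depending on the height. -/
theorem exists_straightening [FiniteDimensional ℝ V] [FiniteDimensional ℝ U] [Nontrivial U]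
    {r₀ : ℝ} (hr₀ : 0 < r₀) {G G' : (V × U) × ℝ → (V × U) × ℝ} {D' : Set ((V × U) × ℝ)}
    (hG : ContDiffOn ℝ ∞ G (sphereCollar V U r₀))
    (hGm : ∀ y ∈ sphereCollar V U r₀, ‖(G y).1.1‖ = 1 ∧ (G y).2 ≤ 0)
    (hG0 : ∀ y ∈ sphereCollar V U r₀, y.2 = 0 → G y = y)
    (hG' : ContDiffOn ℝ ∞ G' D') (hGD : MapsTo G (sphereCollar V U r₀) D')
    (hG'G : ∀ y ∈ sphereCollar V U r₀, G' (G y) = y) :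
    ∃ r, 0 < r ∧ r ≤ r₀ ∧ ∃ Φ Φ' : (V × U) × ℝ → (V × U) × ℝ,
      ContDiffOn ℝ ∞ Φ (sphereCollar V U r) ∧ ContDiffOn ℝ ∞ Φ' (sphereCollar V U r) ∧
      (∀ y ∈ sphereCollar V U r, Φ y ∈ sphereCollar V U r ∧ Φ' y ∈ sphereCollar V U r ∧
        Φ (Φ' y) = y ∧ Φ' (Φ y) = y) ∧
      (∀ y ∈ sphereCollar V U r, y.2 = 0 → Φ y = y) ∧
      (∀ y ∈ sphereCollar V U r, r / 2 ≤ ‖y.1.2‖ ∨ y.2 ≤ -r / 2 → Φ y = y) ∧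
      ∃ ρ > 0, ∀ y ∈ sphereCollar V U r, ‖y.1.2‖ ≤ ρ → -ρ ≤ y.2 → Φ y = G y := by
  set Y := coneCollar V U r₀ with hY
  have hYu : UniqueDiffOn ℝ Y := uniqueDiffOn_inter_snd_nonpos (isOpen_coneCollar_aux r₀)
  have hY0 : ∀ y ∈ Y, y.1.1 ≠ 0 := fun y hy => hy.1.1
  set Ge := coneExtension G with hGe
  have hGes : ContDiffOn ℝ ∞ Ge Y := coneExtension_contDiffOn hG hY0 fun y hy => toSphere_mem hy
  set X : (V × U) × ℝ → V × U := fun y => (Ge y).1 with hX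
  set T : (V × U) × ℝ → ℝ := fun y => (Ge y).2 with hT
  have hXs : ContDiffOn ℝ ∞ X Y := hGes.fst
  have hTs : ContDiffOn ℝ ∞ T Y := hGes.snd
  have hGe0 : ∀ x : V × U, x.1 ≠ 0 → ‖x.2‖ < r₀ → Ge (x, 0) = (x, 0) := by
    intro x h1 h2
    have hm : ((x, 0) : (V × U) × ℝ) ∈ Y := ⟨⟨h1, h2, by simpa using hr₀⟩, (le_refl (0 : ℝ) :)⟩
    have := hG0 _ (toSphere_mem hm) rfl
    simp only [hGe, coneExtension, this]
    ext <;> simp [toSphere, smul_smul, h1]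
  have hXn : ∀ y ∈ Y, ‖(X y).1‖ = ‖y.1.1‖ := by
    intro y hy
    simp [hX, hGe, coneExtension, norm_smul, (hGm _ (toSphere_mem hy)).1]
  have hTneg : ∀ y ∈ Y, T y ≤ 0 := fun y hy => (hGm _ (toSphere_mem hy)).2
  have hT0 : ∀ x : V × U, x.1 ≠ 0 → ‖x.2‖ < r₀ → T (x, 0) = 0 := fun x h1 h2 => by
    simp [hT, hGe0 x h1 h2]
  -- the vertical derivative of the height
  let T' : (V × U) × ℝ → ℝ := fun y => fderivWithin ℝ T Y (toSphere y) (0, 1)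
  have hT' : ∀ y ∈ Y, HasDerivWithinAt (fun t => T (y.1, t)) (T' y) (Ioc (-r₀) 0) y.2 := by
    intro y hy
    have hy' := sphereCollar_subset_coneCollar (toSphere_mem hy)
    have hline : HasDerivWithinAt (fun t : ℝ => toSphere (y.1, t)) ((0 : V × U), (1 : ℝ))
        (Ioc (-r₀) 0) y.2 := by
      have h : HasDerivWithinAt (fun t : ℝ => ((‖y.1.1‖⁻¹ • y.1.1, y.1.2), t))
          ((0 : V × U), (1 : ℝ)) (Ioc (-r₀) 0) y.2 :=
        (hasDerivWithinAt_const _ _ _).prodMk (hasDerivWithinAt_id _ _)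
      exact h
    have hd := (hTs.differentiableOn (by simp) _ hy').hasFDerivWithinAt
    have := HasFDerivWithinAt.comp_hasDerivWithinAt (l := T) (f := fun t : ℝ => toSphere (y.1, t))
      y.2 hd hline
      (fun t ht => ⟨⟨hy'.1.1, hy'.1.2.1, ht.1⟩, ht.2⟩)
    refine this.congr (fun t ht => ?_) ?_
    · simp only [hT, hGe, coneExtension, Function.comp,
        toSphere_toSphere (show ((y.1, t) : (V × U) × ℝ).1.1 ≠ 0 from hy.1.1)]
    · simp only [hT, hGe, coneExtension, Function.comp,
        toSphere_toSphere (show ((y.1, y.2) : (V × U) × ℝ).1.1 ≠ 0 from hy.1.1)]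
  have hpos0 : ∀ x : V × U, ‖x.1‖ = 1 → ‖x.2‖ < r₀ → 0 < T' (x, 0) := by
    intro x h1 h2
    have hx0 : x.1 ≠ 0 := fun h => by rw [h, norm_zero] at h1; norm_num at h1
    have hy : ((x, 0) : (V × U) × ℝ) ∈ Y := ⟨⟨hx0, h2, by simpa using hr₀⟩, (le_refl (0 : ℝ) :)⟩
    have hts : toSphere ((x, 0) : (V × U) × ℝ) = (x, 0) := toSphere_eq_self h1
    refine lt_of_le_of_ne ?_ ?_
    · have hd := hT' _ hy
      have hd' : HasDerivWithinAt (fun t => T (x, t)) (T' (x, 0)) (Iio 0) 0 := by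
        refine hd.mono_of_mem_nhdsWithin ?_
        have : Ioo (-r₀) 0 ∈ 𝓝[<] (0 : ℝ) := Ioo_mem_nhdsLT (by linarith)
        filter_upwards [this] with t ht using ⟨ht.1, ht.2.le⟩
      rw [hasDerivWithinAt_iff_tendsto_slope' (by simp)] at hd'
      refine ge_of_tendsto hd' ?_
      have : Ioo (-r₀) 0 ∈ 𝓝[<] (0 : ℝ) := Ioo_mem_nhdsLT (by linarith)
      filter_upwards [this] with t ht
      rw [slope_def_field, hT0 x hx0 h2]
      have := hTneg (x, t) ⟨⟨hx0, h2, ht.1⟩, ht.2.le⟩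
      exact div_nonneg_of_nonpos (by linarith) (by linarith [ht.2])
    · intro hzero
      -- otherwise the derivative of `G` would have a kernel
      set L := fderivWithin ℝ Ge Y (x, 0) with hL
      have hLd : HasFDerivWithinAt Ge L Y (x, 0) :=
        (hGes.differentiableOn (by simp) _ hy).hasFDerivWithinAt
      have hLT : fderivWithin ℝ T Y (x, 0) = (ContinuousLinearMap.snd ℝ (V × U) ℝ).comp L :=
        hLd.snd.fderivWithin (hYu _ hy)
      have hL1 : (L (0, 1)).2 = 0 := by
        have : T' (x, 0) = (L (0, 1)).2 := by
          simp only [T', hts, hLT]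
          rfl
        rw [← this, ← hzero]
      have hL0 : ∀ w : V × U, L (w, 0) = (w, 0) := by
        intro w
        have hW : {x : V × U | x.1 ≠ 0 ∧ ‖x.2‖ < r₀} ∈ 𝓝 x := by
          have o1 : IsOpen {x : V × U | x.1 ≠ 0} := isOpen_ne_fun (by fun_prop) (by fun_prop)
          have o2 : IsOpen {x : V × U | ‖x.2‖ < r₀} := isOpen_lt (by fun_prop) (by fun_prop)
          exact (o1.inter o2).mem_nhds ⟨hx0, h2⟩
        have e1 : HasFDerivAt (fun x : V × U => Ge (x, 0))
            (L.comp (ContinuousLinearMap.inl ℝ (V × U) ℝ)) x := by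
          refine HasFDerivWithinAt.hasFDerivAt ?_ hW
          exact HasFDerivWithinAt.comp (g := Ge) (f := fun x => (x, (0 : ℝ))) x hLd
            (hasFDerivAt_prodMk_left x 0).hasFDerivWithinAt
            fun x' hx' => ⟨⟨hx'.1, hx'.2, by simpa using hr₀⟩, (le_refl (0 : ℝ) :)⟩
        have e2 : HasFDerivAt (fun x : V × U => Ge (x, 0))
            (ContinuousLinearMap.inl ℝ (V × U) ℝ) x := by
          refine (hasFDerivAt_prodMk_left x 0).congr_of_eventuallyEq ?_
          filter_upwards [hW] with x' hx' using hGe0 x' hx'.1 hx'.2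
        have := congrArg (fun A => A w) (e1.unique e2)
        simpa using this
      set De : Set ((V × U) × ℝ) := {y | y.1.1 ≠ 0 ∧ toSphere y ∈ D'} with hDe
      have hG'e : ContDiffOn ℝ ∞ (coneExtension G') De :=
        coneExtension_contDiffOn hG' (fun y hy => hy.1) fun y hy => hy.2
      have htG : ∀ y ∈ Y, toSphere (Ge y) = G (toSphere y) := by
        intro y hy
        have hn := (hGm _ (toSphere_mem hy)).1
        have := hY0 y hy
        simp only [hGe, coneExtension]
        generalize G (toSphere y) = g at hn ⊢
        ext <;> simp [toSphere, norm_smul, hn, smul_smul, this]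
      have hmaps : MapsTo Ge Y De := by
        intro y hy
        refine ⟨?_, ?_⟩
        · have h3 := hXn y hy
          intro h4
          rw [show (X y).1 = (Ge y).1.1 from rfl, h4, norm_zero] at h3
          exact hY0 y hy (norm_eq_zero.1 h3.symm)
        · rw [htG y hy]
          exact hGD (toSphere_mem hy)
      have hleft : ∀ y ∈ Y, coneExtension G' (Ge y) = y := by
        intro y hy
        have h3 := hXn y hy
        have h5 := hY0 y hy
        simp only [coneExtension, htG y hy, hG'G _ (toSphere_mem hy)]
        rw [show ‖(Ge y).1.1‖ = ‖y.1.1‖ from h3]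
        ext <;> simp [toSphere, smul_smul, h5]
      have hG'd := (hG'e.differentiableOn (by simp) _ (hmaps hy)).hasFDerivWithinAt
      have hcomp := HasFDerivWithinAt.comp (g := coneExtension G') (f := Ge) _ hG'd hLd hmaps
      have hid : HasFDerivWithinAt (coneExtension G' ∘ Ge)
          (ContinuousLinearMap.id ℝ ((V × U) × ℝ)) Y (x, 0) :=
        (hasFDerivWithinAt_id _ _).congr (fun y hy => hleft y hy) (hleft _ hy)
      have heq := (hYu _ hy).eq hcomp hid
      have hker : L (-(L (0, 1)).1, 1) = 0 := by
        have : ((-(L (0, 1)).1, 1) : (V × U) × ℝ) = (-(L (0, 1)).1, 0) + (0, 1) := by simp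
        rw [this, map_add, hL0]
        ext <;> simp [hL1]
      have := congrArg (fun A => A (-(L (0, 1)).1, (1 : ℝ))) heq
      simp only [ContinuousLinearMap.comp_apply, hker, map_zero] at this
      exact absurd (congrArg Prod.snd this) (by simp)
  -- uniform bounds near `t = 0`
  set K : Set (V × U) := sphere 0 1 ×ˢ closedBall 0 (r₀ / 2) with hK
  have hKc : IsCompact K := (isCompact_sphere _ _).prod (isCompact_closedBall _ _)
  have hKm : ∀ x ∈ K, ‖x.1‖ = 1 ∧ ‖x.2‖ < r₀ := by
    rintro ⟨v, z⟩ ⟨h1, h2⟩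
    simp only [mem_sphere_iff_norm, sub_zero, mem_closedBall, dist_zero_right] at h1 h2
    exact ⟨h1, show ‖z‖ < r₀ by linarith⟩
  let F : (V × U) × ℝ → ℝ := fun y => fderivWithin ℝ T Y y (0, 1)
  have hFT : ∀ y : (V × U) × ℝ, T' y = F (toSphere y) := fun _ => rfl
  have hFc : ContinuousOn F Y :=
    (hTs.continuousOn_fderivWithin hYu (by simp)).clm_apply continuousOn_const
  have hKY : K ×ˢ Icc (-(r₀ / 2)) 0 ⊆ Y := by
    rintro ⟨x, t⟩ ⟨hx, ht⟩
    obtain ⟨h1, h2⟩ := hKm x hx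
    exact sphereCollar_subset_coneCollar ⟨h1, h2, show -r₀ < t by linarith [ht.1], ht.2⟩
  have hF0 : ContinuousOn (fun x : V × U => F (x, 0)) K := by
    refine hFc.comp (by fun_prop) fun x hx => hKY ⟨hx, by simp; linarith, le_rfl⟩
  have hFpos : ∀ x ∈ K, 0 < F (x, 0) := fun x hx => by
    have := hpos0 x (hKm x hx).1 (hKm x hx).2
    rwa [hFT, toSphere_eq_self (hKm x hx).1] at this
  obtain ⟨c, hc, hcF⟩ := hKc.exists_forall_le' hF0 hFpos
  obtain ⟨C₀, hC₀⟩ := hKc.bddAbove_image hF0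
  obtain ⟨r, hr, hr', hrF⟩ := exists_norm_sub_le_of_isCompact hKc (half_pos hr₀) (half_pos hc)
    (hFc.mono hKY)
  have hrr : r ≤ r₀ := by linarith
  have hsubY : coneCollar V U r ⊆ Y := fun y hy =>
    ⟨⟨hy.1.1, hy.1.2.1.trans_le hrr, by linarith [hy.1.2.2]⟩, hy.2⟩
  set C := max 1 (C₀ + c) with hC
  have hbound : ∀ y ∈ coneCollar V U r, 0 < T' y ∧ T' y ≤ C := by
    intro y hy
    have hs := toSphere_mem hy
    have hxK : (toSphere y).1 ∈ K := ⟨by simpa using hs.1, by simpa using hs.2.1.le.trans hr'⟩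
    have h1 := hrF _ hxK y.2 ⟨hs.2.2.1.le, hs.2.2.2⟩
    have h2 := hcF _ hxK
    have h3 := hC₀ ⟨_, hxK, rfl⟩
    rw [Real.norm_eq_abs, abs_le] at h1
    have h4 : T' y = F ((toSphere y).1, y.2) := rfl
    have h5 := le_max_right 1 (C₀ + c)
    simp only at h3
    constructor <;> linarith [h1.1, h1.2]
  have hT'r : ∀ y ∈ coneCollar V U r,
      HasDerivWithinAt (fun t => T (y.1, t)) (T' y) (Ioc (-r) 0) y.2 := fun y hy =>
    (hT' y (hsubY hy)).mono fun t ht => ⟨by linarith [ht.1], ht.2⟩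
  have hle : ∀ y ∈ coneCollar V U r, C * y.2 ≤ T y := by
    intro y hy
    have hmem : ∀ t ∈ Ioc (-r) 0, (y.1, t) ∈ coneCollar V U r :=
      fun t ht => ⟨⟨hy.1.1, hy.1.2.1, ht.1⟩, ht.2⟩
    have hmono : MonotoneOn (fun t => C * t - T (y.1, t)) (Ioc (-r) 0) := by
      have hd : ∀ t ∈ Ioc (-r) 0, HasDerivWithinAt (fun t => C * t - T (y.1, t))
          (C * 1 - T' (y.1, t)) (Ioc (-r) 0) t := fun t ht =>
        ((hasDerivWithinAt_id t _).const_mul C).sub (hT'r _ (hmem t ht))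
      refine monotoneOn_of_hasDerivWithinAt_nonneg (convex_Ioc _ _)
        (f' := fun t => C * 1 - T' (y.1, t)) ?_ ?_ ?_
      · exact fun t ht => (hd t ht).continuousWithinAt
      · exact fun t ht => (hd t (interior_subset ht)).mono interior_subset
      · intro t ht
        have := (hbound _ (hmem t (interior_subset ht))).2
        show 0 ≤ C * 1 - T' (y.1, t)
        linarith
    have := hmono ⟨hy.1.2.2, hy.2⟩ ⟨by linarith, le_rfl⟩ hy.2
    simp only [hT0 y.1 hy.1.1 (hy.1.2.1.trans_le hrr)] at this
    have e : T (y.1, y.2) = T y := rfl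
    linarith
  obtain ⟨T₁, τ₁, hT₁, hτ₁, hinv, hT₁0, hT₁id, ρ₁, hρ₁, hT₁T⟩ := exists_height_straightening hr
    (hTs.mono hsubY) (fun x h1 h2 => hT0 x h1 (h2.trans_le hrr)) hT'r
    (fun y hy => (hbound y hy).1) (le_max_left _ _) hle
  have hmem0 : ∀ x : V × U, x.1 ≠ 0 → ‖x.2‖ < r → ((x, 0) : (V × U) × ℝ) ∈ coneCollar V U r :=
    fun x h1 h2 => ⟨⟨h1, h2, by simpa using hr⟩, (le_refl (0 : ℝ) :)⟩
  have hτ₁0 : ∀ x : V × U, x.1 ≠ 0 → ‖x.2‖ < r → τ₁ (x, 0) = 0 := by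
    intro x h1 h2
    have := (hinv _ (hmem0 x h1 h2)).2.2.2
    rwa [hT₁0 x h1 h2] at this
  obtain ⟨P, P', hP, hP', hPinv, hP0, hPid, ρ₂, hρ₂, hPX⟩ := exists_horizontal_straightening hr
    (X := fun y => X (y.1, τ₁ y))
    (hXs.comp (contDiffOn_fst.prodMk hτ₁) fun y hy => hsubY (hinv y hy).2.1)
    (fun x h1 h2 => by
      simp only [hτ₁0 x h1 h2]
      exact congrArg Prod.fst (hGe0 x h1 (h2.trans_le hrr)))
    (fun y hy => hXn _ (hsubY (hinv y hy).2.1))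
  have hTA : ∀ y ∈ annulusCollar V U r, (y.1, T₁ y) ∈ annulusCollar V U r := fun y hy =>
    ⟨hy.1, (hinv y hy.2).1⟩
  have hτA : ∀ y ∈ annulusCollar V U r, (y.1, τ₁ y) ∈ annulusCollar V U r := fun y hy =>
    ⟨hy.1, (hinv y hy.2).2.1⟩
  have hSA : sphereCollar V U r ⊆ annulusCollar V U r := sphereCollar_subset_annulusCollar
  have hAS : ∀ y ∈ annulusCollar V U r, ‖y.1.1‖ = 1 → y ∈ sphereCollar V U r := fun y hy h1 =>
    ⟨h1, hy.2.1.2.1, hy.2.1.2.2, hy.2.2⟩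
  have hP'n : ∀ y ∈ annulusCollar V U r, ‖(P' y).1‖ = ‖y.1.1‖ := fun y hy => by
    have h1 := (hPinv _ (hPinv y hy).2.1).2.2.2.2
    rw [(hPinv y hy).2.2.1] at h1
    exact h1.symm
  refine ⟨r, hr, hrr, fun y => (P (y.1, T₁ y), T₁ y), fun y => (P' y, τ₁ (P' y, y.2)),
    ?_, ?_, ?_, ?_, ?_, min ρ₁ (ρ₂ / C), lt_min hρ₁ (by positivity), ?_⟩
  · have h1 : ContDiffOn ℝ ∞ T₁ (sphereCollar V U r) :=
      hT₁.mono sphereCollar_subset_coneCollar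
    exact (hP.comp (contDiffOn_fst.prodMk h1) fun y hy => hTA y (hSA hy)).prodMk h1
  · have h1 : ContDiffOn ℝ ∞ P' (sphereCollar V U r) := hP'.mono hSA
    exact h1.prodMk (hτ₁.comp (h1.prodMk contDiffOn_snd) fun y hy => (hPinv y (hSA hy)).2.1.2)
  · intro y hy
    have hyA := hSA hy
    have a1 := hTA y hyA
    have a2 := (hPinv y hyA).2.1
    refine ⟨hAS _ (hPinv _ a1).1 ?_, hAS _ (hτA _ a2) ?_, ?_, ?_⟩
    · exact (hPinv _ a1).2.2.2.2.trans hy.1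
    · exact (hP'n y hyA).trans hy.1
    · show (P (P' y, T₁ (P' y, τ₁ (P' y, y.2))), T₁ (P' y, τ₁ (P' y, y.2))) = y
      rw [(hinv _ a2.2).2.2.1, (hPinv y hyA).2.2.1]
    · show (P' (P (y.1, T₁ y), T₁ y), τ₁ (P' (P (y.1, T₁ y), T₁ y), T₁ y)) = y
      rw [(hPinv _ a1).2.2.2.1, (hinv y hyA.2).2.2.2]
  · intro y hy h0
    have e1 : T₁ y = 0 := by
      have hy0 : y = (y.1, 0) := by rw [← h0]
      rw [hy0]
      exact hT₁0 y.1 (sphereCollar_subset_coneCollar hy).1.1 hy.2.1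
    have e2 := hP0 _ (hTA y (hSA hy)) e1
    show (P (y.1, T₁ y), T₁ y) = y
    rw [e2, e1, ← h0]
  · intro y hy h
    have e1 := hT₁id y (sphereCollar_subset_coneCollar hy) h
    show (P (y.1, T₁ y), T₁ y) = y
    rw [e1]
    rw [show (y.1, y.2) = y from rfl, hPid y (hSA hy) h]
  · intro y hy h1 h2
    have m1 := min_le_left ρ₁ (ρ₂ / C)
    have m2 := min_le_right ρ₁ (ρ₂ / C)
    have hCpos : 0 < C := lt_of_lt_of_le one_pos (le_max_left _ _)
    have hC1 : 1 ≤ C := le_max_left _ _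
    have hyc := sphereCollar_subset_coneCollar hy
    have e1 : T₁ y = T y := hT₁T y hyc (h1.trans m1) (by linarith)
    have hρC : C * (ρ₂ / C) = ρ₂ := by field_simp
    have hlow : -ρ₂ ≤ T y := by
      have := hle y hyc
      have : C * (-(ρ₂ / C)) ≤ C * y.2 := by gcongr; linarith
      linarith
    have e2 := hPX (y.1, T₁ y) (hTA y (hSA hy))
      (h1.trans (m2.trans (div_le_self hρ₂.le hC1))) (by rw [e1]; exact hlow)
    show (P (y.1, T₁ y), T₁ y) = G y
    rw [e2]
    simp only [(hinv y hyc).2.2.2]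
    rw [e1]
    simp only [hX, hT, hGe, coneExtension, toSphere_eq_self hy.1, hy.1, one_smul]

end Collar

/-! ### Formal properties of surgeries -/

section SurgeryCalculus

variable {V W : Type*} [NormedAddCommGroup V] [InnerProductSpace ℝ V]
  [NormedAddCommGroup W] [InnerProductSpace ℝ W]
  {E H X : Type*} [NormedAddCommGroup E] [NormedSpace ℝ E] [TopologicalSpace H]
  [TopologicalSpace X] [ChartedSpace H X]
  {E' H' Y : Type*} [NormedAddCommGroup E'] [NormedSpace ℝ E'] [TopologicalSpace H']
  [TopologicalSpace Y] [ChartedSpace H' Y]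
  {I : ModelWithCorners ℝ E H} {J : ModelWithCorners ℝ E' H'} {K : Set W}
  {φ : V × W → X} {a : X → Y} {b : V × W → Y}

/-- The change of polar coordinates `(θ u, v) ↦ (u, θ v)` by which the pieces of a surgery are
glued. -/
noncomputable def polarSwap (y : V × W) : V × W := (‖y.1‖⁻¹ • y.1, ‖y.1‖ • y.2)

theorem polarSwap_contDiffOn {s : Set (V × W)} (hs : ∀ y ∈ s, y.1 ≠ 0) :
    ContDiffOn ℝ ∞ (polarSwap : V × W → V × W) s := by
  have h1 : ContDiffOn ℝ ∞ (fun y : V × W => ‖y.1‖) s := contDiffOn_fst.norm ℝ hs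
  exact ((h1.inv fun y hy => norm_ne_zero_iff.2 (hs y hy)).smul contDiffOn_fst).prodMk
    (h1.smul contDiffOn_snd)

theorem polarSwap_smul {u : V} (hu : ‖u‖ = 1) {θ : ℝ} (hθ : 0 < θ) (v : W) :
    polarSwap (θ • u, v) = (u, θ • v) := by
  simp [polarSwap, norm_smul, hu, abs_of_pos hθ, smul_smul, hθ.ne']

theorem image_sphere_zero_compl_subset (hK0 : (0 : W) ∈ K)
    (hφ : InjOn φ (sphere 0 1 ×ˢ (ball 0 1 ∩ K))) {u : V} (hu : u ∈ sphere (0 : V) 1) {y : W}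
    (hy : y ∈ ball (0 : W) 1 ∩ K) (hy0 : y ≠ 0) :
    φ (u, y) ∈ (φ '' (sphere 0 1 ×ˢ {0}))ᶜ := by
  rintro ⟨⟨u', y'⟩, ⟨hu', hy'⟩, h⟩
  obtain rfl : y' = 0 := hy'
  have := hφ ⟨hu', mem_ball_self one_pos, hK0⟩ ⟨hu, hy⟩ h
  exact hy0 (congrArg Prod.snd this).symm

theorem isOpenSmoothEmbeddingOn_polar (hKs : ∀ θ : ℝ, 0 < θ → ∀ v ∈ K, θ • v ∈ K)
    (hK0 : (0 : W) ∈ K)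
    (hφ : IsOpenSmoothEmbeddingOn 𝓘(ℝ, V × W) I φ (sphere 0 1 ×ˢ (ball 0 1 ∩ K)))
    (ha : IsOpenSmoothEmbeddingOn I J a (φ '' (sphere 0 1 ×ˢ {0}))ᶜ) :
    IsOpenSmoothEmbeddingOn 𝓘(ℝ, V × W) J (fun y => a (φ (polarSwap y)))
      (ball 0 1 ×ˢ (sphere 0 1 ∩ K) ∩ {y | y.1 ≠ 0}) := by
  have hO : IsOpen {y : V × W | y.2 ≠ 0} := isOpen_ne_fun (by fun_prop) (by fun_prop)
  have h1 := ha.comp (hφ.inter_open hO) (by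
    rintro ⟨u, y⟩ ⟨⟨hu, hy⟩, hy0⟩
    exact image_sphere_zero_compl_subset hK0 hφ.injOn hu hy hy0)
  have hk : ContDiffOn ℝ ∞ (fun y : V × W => (‖y.2‖ • y.1, ‖y.2‖⁻¹ • y.2))
      (sphere 0 1 ×ˢ (ball 0 1 ∩ K) ∩ {y : V × W | y.2 ≠ 0}) := by
    have h2 : ContDiffOn ℝ ∞ (fun y : V × W => ‖y.2‖)
      (sphere 0 1 ×ˢ (ball 0 1 ∩ K) ∩ {y : V × W | y.2 ≠ 0}) :=
      contDiffOn_snd.norm ℝ fun y hy => hy.2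
    exact (h2.smul contDiffOn_fst).prodMk
      ((h2.inv fun y hy => norm_ne_zero_iff.2 hy.2).smul contDiffOn_snd)
  refine h1.comp_of_inverse (h := polarSwap) hO
    (polarSwap_contDiffOn fun y hy => hy.2).contMDiffOn
    (k := fun y => (‖y.2‖ • y.1, ‖y.2‖⁻¹ • y.2))
    (contMDiffOn_iff_contDiffOn.2 (hk.mono inter_subset_left)) ?_ ?_ ?_ ?_
  · rintro ⟨z, v⟩ ⟨⟨hz, hv⟩, hz0⟩
    simp only [mem_ball_zero_iff] at hz
    have hv1 : ‖v‖ = 1 := by simpa using hv.1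
    have hz0' : 0 < ‖z‖ := norm_pos_iff.2 hz0
    have hne : ‖z‖ • v ≠ 0 := by
      rw [← norm_pos_iff, norm_smul, norm_norm, hv1]; simpa using hz0'
    exact ⟨⟨⟨by simp [polarSwap, norm_smul, hz0'.ne'], by simp [polarSwap, norm_smul, hv1, hz],
      hKs _ hz0' _ hv.2⟩, hne⟩, hne⟩
  · rintro ⟨u, y⟩ ⟨⟨⟨hu, hy⟩, hy0⟩, -⟩
    have hu1 : ‖u‖ = 1 := by simpa using hu
    have hy1 : ‖y‖ < 1 := by simpa using hy.1
    have hy0' : 0 < ‖y‖ := norm_pos_iff.2 hy0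
    refine ⟨⟨by simp [norm_smul, hu1, hy1], by simp [norm_smul, hy0'.ne'],
      hKs _ (inv_pos.2 hy0') _ hy.2⟩, ?_⟩
    show ‖y‖ • u ≠ 0
    rw [← norm_pos_iff, norm_smul, norm_norm, hu1]; simpa using hy0'
  · rintro ⟨z, v⟩ ⟨⟨hz, hv⟩, hz0⟩
    have hv1 : ‖v‖ = 1 := by simpa using hv.1
    have hz0' : ‖z‖ ≠ 0 := norm_ne_zero_iff.2 hz0
    simp [polarSwap, norm_smul, hv1, smul_smul, hz0']
  · rintro ⟨u, y⟩ ⟨⟨⟨hu, hy⟩, hy0⟩, -⟩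
    have hu1 : ‖u‖ = 1 := by simpa using hu
    have hy0' : ‖y‖ ≠ 0 := norm_ne_zero_iff.2 hy0
    simp [polarSwap, norm_smul, hu1, smul_smul, hy0']

/-- A criterion for surgeries. Away from `{0} × S_K`, the new part is determined by the old one. -/
theorem IsSurgeryAlong.of_polar (hKs : ∀ θ : ℝ, 0 < θ → ∀ v ∈ K, θ • v ∈ K) (hK0 : (0 : W) ∈ K)
    (hφ : IsOpenSmoothEmbeddingOn 𝓘(ℝ, V × W) I φ (sphere 0 1 ×ˢ (ball 0 1 ∩ K)))
    (ha : IsOpenSmoothEmbeddingOn I J a (φ '' (sphere 0 1 ×ˢ {0}))ᶜ)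
    {U : Set (V × W)} (hU : IsOpen U) (hU0 : ∀ v ∈ sphere (0 : W) 1 ∩ K, ((0 : V), v) ∈ U)
    (hb : IsOpenSmoothEmbeddingOn 𝓘(ℝ, V × W) J b (ball 0 1 ×ˢ (sphere 0 1 ∩ K) ∩ U))
    (hab : ∀ z ∈ ball (0 : V) 1, z ≠ 0 → ∀ v ∈ sphere (0 : W) 1 ∩ K,
      b (z, v) = a (φ (polarSwap (z, v))))
    (hb0 : ∀ v ∈ sphere (0 : W) 1 ∩ K, b (0, v) ∉ a '' (φ '' (sphere 0 1 ×ˢ {0}))ᶜ)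
    (hcov : ∀ y, y ∈ a '' (φ '' (sphere 0 1 ×ˢ {0}))ᶜ ∨ ∃ v ∈ sphere (0 : W) 1 ∩ K, y = b (0, v)) :
    IsSurgeryAlong I J K φ a b := by
  have hpol := isOpenSmoothEmbeddingOn_polar hKs hK0 hφ ha
  have hmem : ∀ z ∈ ball (0 : V) 1, z ≠ 0 → ∀ v ∈ sphere (0 : W) 1 ∩ K,
      φ (polarSwap (z, v)) ∈ (φ '' (sphere 0 1 ×ˢ {0}))ᶜ := by
    intro z hz hz0 v hv
    have hz0' : 0 < ‖z‖ := norm_pos_iff.2 hz0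
    have hv1 : ‖v‖ = 1 := by simpa using hv.1
    have hz1 : ‖z‖ < 1 := by simpa using hz
    refine image_sphere_zero_compl_subset hK0 hφ.injOn ?_ ⟨?_, hKs _ hz0' _ hv.2⟩ ?_
    · simp [norm_smul, hz0'.ne']
    · simp [norm_smul, hv1, hz1]
    · rw [← norm_pos_iff, norm_smul, norm_norm, hv1]; simpa using hz0'
  have hglue0 : ∀ x ∈ (φ '' (sphere 0 1 ×ˢ {0}))ᶜ, ∀ v ∈ sphere (0 : W) 1 ∩ K, a x ≠ b (0, v) :=
    fun x hx v hv h => hb0 v hv (h ▸ mem_image_of_mem a hx)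
  refine ⟨hφ, ha, ?_, ?_, ?_⟩
  · refine IsOpenSmoothEmbeddingOn.of_union (U₁ := U) (U₂ := {y : V × W | y.1 ≠ 0}) hU
      (isOpen_ne_fun (by fun_prop) (by fun_prop)) ?_ hb (hpol.congr ?_) ?_
    · rintro ⟨z, v⟩ ⟨hz, hv⟩
      by_cases h : z = 0
      · exact Or.inl (h ▸ hU0 v hv)
      · exact Or.inr h
    · rintro ⟨z, v⟩ ⟨⟨hz, hv⟩, h⟩
      exact hab z hz h v hv
    · rintro ⟨z, v⟩ ⟨hz, hv⟩ ⟨z', v'⟩ ⟨hz', hv'⟩ h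
      by_cases h0 : z = 0 <;> by_cases h0' : z' = 0
      · subst h0 h0'
        exact hb.injOn ⟨⟨hz, hv⟩, hU0 v hv⟩ ⟨⟨hz', hv'⟩, hU0 v' hv'⟩ h
      · subst h0
        rw [hab z' hz' h0' v' hv'] at h
        exact absurd h.symm (hglue0 _ (hmem z' hz' h0' v' hv') v hv)
      · subst h0'
        rw [hab z hz h0 v hv] at h
        exact absurd h (hglue0 _ (hmem z hz h0 v hv) v' hv')
      · rw [hab z hz h0 v hv, hab z' hz' h0' v' hv'] at h
        exact hpol.injOn ⟨⟨hz, hv⟩, h0⟩ ⟨⟨hz', hv'⟩, h0'⟩ h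
  · refine eq_univ_of_forall fun y => ?_
    rcases hcov y with h | ⟨v, hv, rfl⟩
    · exact Or.inl h
    · exact Or.inr ⟨(0, v), ⟨mem_ball_self one_pos, hv⟩, rfl⟩
  · intro x hx z hz v hv
    constructor
    · intro h
      have hz0 : z ≠ 0 := by
        rintro rfl
        exact hglue0 x hx v hv h
      have hz0' : 0 < ‖z‖ := norm_pos_iff.2 hz0
      rw [hab z hz hz0 v hv] at h
      refine ⟨‖z‖⁻¹ • z, by simp [norm_smul, hz0'.ne'], ‖z‖, ⟨hz0', by simpa using hz⟩, ?_, ?_⟩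
      · rw [smul_smul, mul_inv_cancel₀ hz0'.ne', one_smul]
      · exact ha.injOn hx (hmem z hz hz0 v hv) h
    · rintro ⟨u, hu, θ, hθ, rfl, rfl⟩
      have hu1 : ‖u‖ = 1 := by simpa using hu
      have hz0 : θ • u ≠ 0 := by
        rw [← norm_pos_iff, norm_smul, hu1]; simpa using hθ.1.ne'
      rw [hab _ hz hz0 v hv, polarSwap_smul hu1 hθ.1]

namespace IsSurgeryAlong

theorem new_eq_old (h : IsSurgeryAlong I J K φ a b) (hKs : ∀ θ : ℝ, 0 < θ → ∀ v ∈ K, θ • v ∈ K)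
    (hK0 : (0 : W) ∈ K) {u : V} (hu : ‖u‖ = 1) {θ : ℝ} (hθ : θ ∈ Ioo (0 : ℝ) 1) {v : W}
    (hv : v ∈ sphere (0 : W) 1 ∩ K) : b (θ • u, v) = a (φ (u, θ • v)) := by
  have hv1 : ‖v‖ = 1 := by simpa using hv.1
  refine ((h.glue _ ?_ _ ?_ v hv).2 ⟨u, by simpa using hu, θ, hθ, rfl, rfl⟩).symm
  · refine image_sphere_zero_compl_subset hK0 h.embedding.injOn (by simpa using hu)
      ⟨?_, hKs _ hθ.1 _ hv.2⟩ ?_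
    · simpa [norm_smul, hv1, abs_of_pos hθ.1] using hθ.2
    · rw [← norm_pos_iff, norm_smul, hv1]; simpa using hθ.1.ne'
  · simpa [norm_smul, hu, abs_of_pos hθ.1] using hθ.2

theorem new_zero_notMem (h : IsSurgeryAlong I J K φ a b) {v : W} (hv : v ∈ sphere (0 : W) 1 ∩ K) :
    b (0, v) ∉ a '' (φ '' (sphere 0 1 ×ˢ {0}))ᶜ := by
  rintro ⟨x, hx, hxb⟩
  obtain ⟨u, hu, θ, hθ, h0, -⟩ := (h.glue x hx 0 (mem_ball_self one_pos) v hv).1 hxb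
  have hu1 : ‖u‖ = 1 := by simpa using hu
  have : ‖θ • u‖ = 0 := by rw [← h0, norm_zero]
  rw [norm_smul, hu1] at this
  simp at this
  exact hθ.1.ne' this

theorem mem_old_or_new_zero (h : IsSurgeryAlong I J K φ a b)
    (hKs : ∀ θ : ℝ, 0 < θ → ∀ v ∈ K, θ • v ∈ K) (hK0 : (0 : W) ∈ K) (y : Y) :
    y ∈ a '' (φ '' (sphere 0 1 ×ˢ {0}))ᶜ ∨ ∃ v ∈ sphere (0 : W) 1 ∩ K, y = b (0, v) := by
  have hy : y ∈ a '' (φ '' (sphere 0 1 ×ˢ {0}))ᶜ ∪ b '' (ball 0 1 ×ˢ (sphere 0 1 ∩ K)) :=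
    h.cover ▸ mem_univ y
  rcases hy with hy | ⟨⟨z, v⟩, ⟨hz, hv⟩, rfl⟩
  · exact Or.inl hy
  · by_cases hz0 : z = 0
    · subst hz0
      exact Or.inr ⟨v, hv, rfl⟩
    · left
      have hz0' : 0 < ‖z‖ := norm_pos_iff.2 hz0
      have hu : ‖‖z‖⁻¹ • z‖ = 1 := by simp [norm_smul, hz0'.ne']
      have hz1 : ‖z‖ < 1 := by simpa using hz
      have hv1 : ‖v‖ = 1 := by simpa using hv.1
      have := h.new_eq_old hKs hK0 hu ⟨hz0', hz1⟩ hv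
      rw [smul_smul, mul_inv_cancel₀ hz0'.ne', one_smul] at this
      rw [this]
      refine ⟨_, image_sphere_zero_compl_subset hK0 h.embedding.injOn (by simpa using hu)
        ⟨?_, hKs _ hz0' _ hv.2⟩ ?_, rfl⟩
      · simpa [norm_smul, hv1] using hz1
      · rw [← norm_pos_iff, norm_smul, norm_norm, hv1]; simpa using hz0'

/-- The result of a surgery only depends on the germ of the embedding along `S × {0}`. -/
theorem exists_of_eq_near (h : IsSurgeryAlong I J K φ a b)
    (hKs : ∀ θ : ℝ, 0 < θ → ∀ v ∈ K, θ • v ∈ K) (hK0 : (0 : W) ∈ K) {φ' : V × W → X}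
    (hφ' : IsOpenSmoothEmbeddingOn 𝓘(ℝ, V × W) I φ' (sphere 0 1 ×ˢ (ball 0 1 ∩ K)))
    {ε : ℝ} (hε : 0 < ε)
    (heq : ∀ u ∈ sphere (0 : V) 1, ∀ y ∈ ball (0 : W) 1 ∩ K, ‖y‖ < ε → φ' (u, y) = φ (u, y)) :
    ∃ b', IsSurgeryAlong I J K φ' a b' := by
  classical
  have him : φ' '' (sphere 0 1 ×ˢ {0}) = φ '' (sphere 0 1 ×ˢ {0}) := by
    refine image_congr ?_
    rintro ⟨u, y⟩ ⟨hu, hy⟩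
    obtain rfl : y = 0 := hy
    exact heq u hu 0 ⟨mem_ball_self one_pos, hK0⟩ (by simpa using hε)
  have hbb : ∀ z ∈ ball (0 : V) 1, z ≠ 0 → ‖z‖ < ε → ∀ v ∈ sphere (0 : W) 1 ∩ K,
      b (z, v) = a (φ' (polarSwap (z, v))) := by
    intro z hz hz0 hzε v hv
    have hz0' : 0 < ‖z‖ := norm_pos_iff.2 hz0
    have hu : ‖‖z‖⁻¹ • z‖ = 1 := by simp [norm_smul, hz0'.ne']
    have hz1 : ‖z‖ < 1 := by simpa using hz
    have hv1 : ‖v‖ = 1 := by simpa using hv.1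
    have h1 := h.new_eq_old hKs hK0 hu ⟨hz0', hz1⟩ hv
    rw [smul_smul, mul_inv_cancel₀ hz0'.ne', one_smul] at h1
    rw [h1]
    refine congrArg a (heq _ (by simpa using hu) _ ⟨?_, hKs _ hz0' _ hv.2⟩ ?_).symm
    · simpa [norm_smul, hv1] using hz1
    · simpa [norm_smul, hv1] using hzε
  refine ⟨fun y => if ‖y.1‖ < ε then b y else a (φ' (polarSwap y)), ?_⟩
  have hU : IsOpen {y : V × W | ‖y.1‖ < ε} := isOpen_lt (by fun_prop) (by fun_prop)
  refine IsSurgeryAlong.of_polar hKs hK0 hφ' (him ▸ h.old_part) hU (fun v _ => by simpa using hε)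
    ((h.new_part.inter_open hU).congr fun y hy => if_pos hy.2) ?_ ?_ ?_
  · intro z hz hz0 v hv
    by_cases hzε : ‖z‖ < ε
    · simp only [hzε, if_true]
      exact hbb z hz hz0 hzε v hv
    · simp only [hzε, if_false]
  · intro v hv
    simpa [hε, him] using h.new_zero_notMem hv
  · intro y
    simpa [hε, him] using h.mem_old_or_new_zero hKs hK0 y

/-- Surgery is invariant under diffeomorphisms. -/
theorem comp_diffeo (h : IsSurgeryAlong I J K φ a b) {Φ Φ' : X → X}
    (hΦ : IsOpenSmoothEmbeddingOn I I Φ univ) (hΦ' : IsOpenSmoothEmbeddingOn I I Φ' univ)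
    (hl : ∀ x, Φ' (Φ x) = x) (hr : ∀ x, Φ (Φ' x) = x) :
    IsSurgeryAlong I J K (Φ' ∘ φ) (a ∘ Φ) b := by
  have hc : ((Φ' ∘ φ) '' (sphere 0 1 ×ˢ {0}))ᶜ = Φ ⁻¹' (φ '' (sphere 0 1 ×ˢ {0}))ᶜ := by
    rw [← preimage_compl.symm, compl_inj_iff, image_comp]
    ext x
    constructor
    · rintro ⟨y, hy, rfl⟩
      rwa [mem_preimage, hr]
    · exact fun hx => ⟨Φ x, hx, hl x⟩
  have himg : (a ∘ Φ) '' ((Φ' ∘ φ) '' (sphere 0 1 ×ˢ {0}))ᶜ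
      = a '' (φ '' (sphere 0 1 ×ˢ {0}))ᶜ := by
    rw [hc, image_comp, image_preimage_eq _ fun x => ⟨_, hr x⟩]
  refine ⟨hΦ'.comp h.embedding (mapsTo_univ _ _), ?_, h.new_part, ?_, ?_⟩
  · rw [hc]
    refine ⟨?_, ?_⟩
    · rw [← hc, himg]
      exact h.old_part.1
    · refine ⟨h.old_part.2.1.comp (hΦ.2.1.mono (subset_univ _)) subset_rfl, ?_⟩
      obtain ⟨-, -, g, hg, hga⟩ := h.old_part
      refine ⟨Φ' ∘ g, ?_, fun x hx => by simp [hga _ hx, hl]⟩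
      rw [← hc, himg]
      exact hΦ'.2.1.comp hg (mapsTo_univ _ _)
  · rw [himg]
    exact h.cover
  · intro x hx z hz v hv
    rw [hc] at hx
    rw [Function.comp_apply, h.glue _ hx z hz v hv]
    refine exists_congr fun u => and_congr_right fun _ => exists_congr fun θ =>
      and_congr_right fun _ => and_congr_right fun _ => ?_
    constructor
    · intro hx
      rw [Function.comp_apply, ← hx, hl]
    · rintro rfl
      rw [Function.comp_apply, hr]

/-- A surgery can be reversed by a surgery along the new part. -/
theorem symm (h : IsSurgeryAlong I J univ φ a b)
    (hcl : IsClosed (φ '' (sphere (0 : V) 1 ×ˢ {(0 : W)}))) {a' : Y → X}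
    (ha' : ∀ x ∈ (φ '' (sphere 0 1 ×ˢ {0}))ᶜ, a' (a x) = x) :
    IsSurgeryAlong J I univ (b ∘ Prod.swap) a' (φ ∘ Prod.swap) := by
  have hKs : ∀ θ : ℝ, 0 < θ → ∀ v ∈ (univ : Set W), θ • v ∈ (univ : Set W) :=
    fun _ _ _ _ => mem_univ _
  have hc : ((b ∘ Prod.swap) '' (sphere (0 : W) 1 ×ˢ {(0 : V)}))ᶜ
      = a '' (φ '' (sphere 0 1 ×ˢ {0}))ᶜ := by
    ext y
    constructor
    · intro hy
      rcases h.mem_old_or_new_zero hKs (mem_univ _) y with h1 | ⟨v, hv, rfl⟩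
      · exact h1
      · exact absurd ⟨(v, 0), ⟨hv.1, rfl⟩, rfl⟩ hy
    · rintro hy ⟨⟨v, z⟩, ⟨hv, hz⟩, rfl⟩
      obtain rfl : z = 0 := hz
      exact h.new_zero_notMem ⟨hv, mem_univ _⟩ hy
  have hsw : ∀ s : Set (W × V),
      ContMDiffOn 𝓘(ℝ, W × V) 𝓘(ℝ, V × W) ∞ (Prod.swap : W × V → V × W) s :=
    fun s => (contDiff_snd.prodMk contDiff_fst).contDiffOn.contMDiffOn
  have hsw' : ∀ s : Set (V × W),
      ContMDiffOn 𝓘(ℝ, V × W) 𝓘(ℝ, W × V) ∞ (Prod.swap : V × W → W × V) s :=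
    fun s => (contDiff_snd.prodMk contDiff_fst).contDiffOn.contMDiffOn
  refine ⟨?_, ?_, ?_, ?_, ?_⟩
  · refine h.new_part.comp_of_inverse (h := Prod.swap) (k := Prod.swap) isOpen_univ (hsw _)
      (hsw' _) ?_ ?_ (fun _ _ => rfl) (fun _ _ => rfl)
    · rintro ⟨v, z⟩ ⟨hv, hz⟩
      exact ⟨⟨hz.1, hv, mem_univ _⟩, mem_univ _⟩
    · rintro ⟨z, v⟩ ⟨⟨hz, hv⟩, -⟩
      exact ⟨hv.1, hz, mem_univ _⟩
  · rw [hc]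
    have himg : a' '' (a '' (φ '' (sphere 0 1 ×ˢ {0}))ᶜ) = (φ '' (sphere 0 1 ×ˢ {0}))ᶜ := by
      rw [image_image]
      exact (image_congr ha').trans (image_id' _)
    refine ⟨by rw [himg]; exact hcl.isOpen_compl, h.old_part.contMDiffOn_leftInv ha', a, ?_, ?_⟩
    · rw [himg]
      exact h.old_part.2.1
    · rintro _ ⟨x, hx, rfl⟩
      rw [ha' x hx]
  · refine h.embedding.comp_of_inverse (h := Prod.swap) (k := Prod.swap) isOpen_univ (hsw _)
      (hsw' _) ?_ ?_ (fun _ _ => rfl) (fun _ _ => rfl)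
    · rintro ⟨v, z⟩ ⟨hv, hz⟩
      exact ⟨⟨hz.1, hv, mem_univ _⟩, mem_univ _⟩
    · rintro ⟨z, v⟩ ⟨⟨hz, hv⟩, -⟩
      exact ⟨hv.1, hz, mem_univ _⟩
  · refine eq_univ_of_forall fun x => ?_
    rw [hc, image_image]
    by_cases hx : x ∈ φ '' (sphere 0 1 ×ˢ {0})
    · obtain ⟨⟨u, y⟩, ⟨hu, hy⟩, rfl⟩ := hx
      obtain rfl : y = 0 := hy
      exact Or.inr ⟨(0, u), ⟨mem_ball_self one_pos, hu, mem_univ _⟩, rfl⟩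
    · exact Or.inl ⟨x, hx, ha' x hx⟩
  · intro y hy z hz v hv
    rw [hc] at hy
    obtain ⟨x, hx, rfl⟩ := hy
    rw [ha' x hx]
    constructor
    · rintro rfl
      have hz0 : z ≠ 0 := by
        rintro rfl
        exact hx ⟨(v, 0), ⟨hv.1, rfl⟩, rfl⟩
      have hz0' : 0 < ‖z‖ := norm_pos_iff.2 hz0
      have hu : ‖‖z‖⁻¹ • z‖ = 1 := by simp [norm_smul, hz0'.ne']
      have hzz : ‖z‖ • ‖z‖⁻¹ • z = z := by rw [smul_smul, mul_inv_cancel₀ hz0'.ne', one_smul]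
      refine ⟨‖z‖⁻¹ • z, by simpa using hu, ‖z‖, ⟨hz0', by simpa using hz⟩, hzz.symm, ?_⟩
      have := h.new_eq_old hKs (mem_univ _) (u := v) (θ := ‖z‖) (v := ‖z‖⁻¹ • z)
        (by simpa using hv.1) ⟨hz0', by simpa using hz⟩ ⟨by simpa using hu, mem_univ _⟩
      rw [hzz] at this
      exact this.symm
    · rintro ⟨u, hu, θ, hθ, rfl, hx'⟩
      have h1 := h.new_eq_old hKs (mem_univ _) (u := v) (by simpa using hv.1) hθ ⟨hu, mem_univ _⟩
      have h2 : a x = a (φ (v, θ • u)) := hx'.trans h1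
      refine h.old_part.injOn hx ?_ h2
      have hu1 : ‖u‖ = 1 := by simpa using hu
      refine image_sphere_zero_compl_subset (mem_univ _) h.embedding.injOn hv.1
        ⟨?_, mem_univ _⟩ ?_
      · simpa [norm_smul, hu1, abs_of_pos hθ.1] using hθ.2
      · rw [← norm_pos_iff, norm_smul, hu1]; simpa using hθ.1.ne'

end IsSurgeryAlong

/-- Surgery along `φ`, in linear isometric coordinates. -/
theorem IsSurgeryAlong.comp_isometry {V' : Type*} [NormedAddCommGroup V'] [InnerProductSpace ℝ V']
    (h : IsSurgeryAlong I J univ φ a b) (L : V' ≃ₗᵢ[ℝ] V) :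
    IsSurgeryAlong I J univ (fun y : V' × W => φ (L y.1, y.2)) a (fun y => b (L y.1, y.2)) := by
  have hL : ∀ s : Set (V' × W), ContMDiffOn 𝓘(ℝ, V' × W) 𝓘(ℝ, V × W) ∞
      (fun y : V' × W => (L y.1, y.2)) s := fun s =>
    ((L.contDiff.comp contDiff_fst).prodMk contDiff_snd).contDiffOn.contMDiffOn
  have hL' : ∀ s : Set (V × W), ContMDiffOn 𝓘(ℝ, V × W) 𝓘(ℝ, V' × W) ∞
      (fun y : V × W => (L.symm y.1, y.2)) s := fun s =>
    ((L.symm.contDiff.comp contDiff_fst).prodMk contDiff_snd).contDiffOn.contMDiffOn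
  have himg : (fun y : V' × W => φ (L y.1, y.2)) '' (sphere 0 1 ×ˢ {0})
      = φ '' (sphere 0 1 ×ˢ {0}) := by
    ext x
    constructor
    · rintro ⟨⟨u, y⟩, ⟨hu, hy⟩, rfl⟩
      exact ⟨(L u, y), ⟨by simpa using hu, hy⟩, rfl⟩
    · rintro ⟨⟨u, y⟩, ⟨hu, hy⟩, rfl⟩
      exact ⟨(L.symm u, y), ⟨by simpa using hu, hy⟩, by simp⟩
  refine ⟨?_, himg ▸ h.old_part, ?_, ?_, ?_⟩
  · refine h.embedding.comp_of_inverse (h := fun y : V' × W => (L y.1, y.2))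
      (k := fun y => (L.symm y.1, y.2)) isOpen_univ (hL _) (hL' _) ?_ ?_ ?_ ?_
    · rintro ⟨u, y⟩ ⟨hu, hy⟩
      exact ⟨⟨by simpa using hu, hy⟩, mem_univ _⟩
    · rintro ⟨u, y⟩ ⟨⟨hu, hy⟩, -⟩
      exact ⟨by simpa using hu, hy⟩
    · simp
    · simp
  · refine h.new_part.comp_of_inverse (h := fun y : V' × W => (L y.1, y.2))
      (k := fun y => (L.symm y.1, y.2)) isOpen_univ (hL _) (hL' _) ?_ ?_ ?_ ?_
    · rintro ⟨u, y⟩ ⟨hu, hy⟩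
      exact ⟨⟨by simpa using hu, hy⟩, mem_univ _⟩
    · rintro ⟨u, y⟩ ⟨⟨hu, hy⟩, -⟩
      exact ⟨by simpa using hu, hy⟩
    · simp
    · simp
  · rw [himg, ← h.cover]
    congr 1
    ext x
    constructor
    · rintro ⟨⟨u, y⟩, ⟨hu, hy⟩, rfl⟩
      exact ⟨(L u, y), ⟨by simpa using hu, hy⟩, rfl⟩
    · rintro ⟨⟨u, y⟩, ⟨hu, hy⟩, rfl⟩
      exact ⟨(L.symm u, y), ⟨by simpa using hu, hy⟩, by simp⟩
  · intro x hx z hz v hv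
    rw [himg] at hx
    rw [h.glue x hx (L z) (by simpa using hz) v hv]
    constructor
    · rintro ⟨u, hu, θ, hθ, h1, rfl⟩
      refine ⟨L.symm u, by simpa using hu, θ, hθ, ?_, by simp⟩
      rw [← map_smul, ← h1, L.symm_apply_apply]
    · rintro ⟨u, hu, θ, hθ, rfl, rfl⟩
      exact ⟨L u, by simpa using hu, θ, hθ, by simp, rfl⟩

end SurgeryCalculus

/-! ### The coordinates of `ℝ^d × ℝ` -/

section EucSucc

@[fun_prop]
theorem contDiff_eucSucc_fst (d : ℕ) : ContDiff ℝ ∞ (WithLp.fst : EucSucc d → Euc d) :=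
  contDiff_fst.comp WithLp.contDiff_ofLp

@[fun_prop]
theorem contDiff_eucSucc_snd (d : ℕ) : ContDiff ℝ ∞ (WithLp.snd : EucSucc d → ℝ) :=
  contDiff_snd.comp WithLp.contDiff_ofLp

@[fun_prop]
theorem contDiff_eucSucc_toLp (d : ℕ) : ContDiff ℝ ∞ (WithLp.toLp 2 : Euc d × ℝ → EucSucc d) :=
  WithLp.contDiff_toLp

@[fun_prop]
theorem ContDiffOn.norm_of_ne {E F : Type*} [NormedAddCommGroup E] [NormedSpace ℝ E]
    [NormedAddCommGroup F] [InnerProductSpace ℝ F] {s : Set E} {f : E → F}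
    (hf : ContDiffOn ℝ ∞ f s) (h0 : ∀ x ∈ s, f x ≠ 0) : ContDiffOn ℝ ∞ (fun x => ‖f x‖) s :=
  hf.norm ℝ h0

@[fun_prop]
theorem ContDiffOn.norm_pow_two {E F : Type*} [NormedAddCommGroup E] [NormedSpace ℝ E]
    [NormedAddCommGroup F] [InnerProductSpace ℝ F] {s : Set E} {f : E → F}
    (hf : ContDiffOn ℝ ∞ f s) : ContDiffOn ℝ ∞ (fun x => ‖f x‖ ^ 2) s :=
  hf.norm_sq ℝ

theorem norm_sq_eucSucc {d : ℕ} (y : EucSucc d) : ‖y‖ ^ 2 = ‖y.fst‖ ^ 2 + y.snd ^ 2 := by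
  rw [WithLp.prod_norm_sq_eq_of_L2, Real.norm_eq_abs, sq_abs]

theorem mem_ball_eucSucc {d : ℕ} {y : EucSucc d} :
    y ∈ ball (0 : EucSucc d) 1 ↔ ‖y.fst‖ ^ 2 + y.snd ^ 2 < 1 := by
  rw [mem_ball_zero_iff, ← norm_sq_eucSucc, sq_lt_one_iff₀ (norm_nonneg _)]

theorem mem_sphere_eucSucc {d : ℕ} {y : EucSucc d} :
    y ∈ sphere (0 : EucSucc d) 1 ↔ ‖y.fst‖ ^ 2 + y.snd ^ 2 = 1 := by
  rw [mem_sphere_zero_iff_norm, ← norm_sq_eucSucc, pow_eq_one_iff_of_nonneg (norm_nonneg y) two_ne_zero]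

theorem toLp_fst_snd {d : ℕ} (y : EucSucc d) : WithLp.toLp 2 (y.fst, y.snd) = y := rfl

theorem smul_mem_lowerHalf {d : ℕ} (θ : ℝ) (hθ : 0 < θ) (v : EucSucc d) (hv : v ∈ lowerHalf d) :
    θ • v ∈ lowerHalf d := by
  show (θ • v).snd ≤ 0
  rw [WithLp.smul_snd, smul_eq_mul]
  exact mul_nonpos_of_nonneg_of_nonpos hθ.le hv

theorem zero_mem_lowerHalf {d : ℕ} : (0 : EucSucc d) ∈ lowerHalf d := (le_refl (0 : ℝ) :)

end EucSucc

/-! ### A collar of the boundary part of a handle -/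

section HandleCollar

variable {p q : ℕ} {E H X : Type*} [NormedAddCommGroup E] [NormedSpace ℝ E] [TopologicalSpace H]
  [TopologicalSpace X] [ChartedSpace H X]
  {E' H' Y : Type*} [NormedAddCommGroup E'] [NormedSpace ℝ E'] [TopologicalSpace H']
  [TopologicalSpace Y] [ChartedSpace H' Y]
  {I : ModelWithCorners ℝ E H} {J : ModelWithCorners ℝ E' H'}
  {b : Euc p × EucSucc q → X}

/-- The collar `(v, (z, t)) ↦ (√(1 + t²) z, (v, t) / √(1 + t²))` of `B^p × S^(q-1)` in the handle
`B^p × S_-^q`. -/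
noncomputable def handleCollar (w : Euc q × EucSucc p) : Euc p × EucSucc q :=
  (√(1 + w.2.snd ^ 2) • w.2.fst,
    (√(1 + w.2.snd ^ 2))⁻¹ • WithLp.toLp 2 (w.1, w.2.snd))

/-- An inverse of `handleCollar`. -/
noncomputable def handleCollarInv (y : Euc p × EucSucc q) : Euc q × EucSucc p :=
  (‖y.2.fst‖⁻¹ • y.2.fst, WithLp.toLp 2 (‖y.2.fst‖ • y.1, ‖y.2.fst‖⁻¹ * y.2.snd))

theorem handleCollar_handleCollarInv {Z : Euc p} {x : EucSucc q}
    (hx : x ∈ sphere (0 : EucSucc q) 1) (hx0 : x.fst ≠ 0) :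
    handleCollar (handleCollarInv (Z, x)) = (Z, x) := by
  have hn0 : 0 < ‖x.fst‖ := norm_pos_iff.2 hx0
  rw [mem_sphere_eucSucc] at hx
  have e : √(1 + (‖x.fst‖⁻¹ * x.snd) ^ 2) = ‖x.fst‖⁻¹ := by
    rw [Real.sqrt_eq_iff_mul_self_eq (by positivity) (by positivity)]
    field_simp
    linarith
  simp only [handleCollar, handleCollarInv, WithLp.toLp_fst, WithLp.toLp_snd]
  rw [e, inv_inv, smul_smul, inv_mul_cancel₀ hn0.ne', one_smul]
  congr 1
  rw [← WithLp.toLp_smul, Prod.smul_mk, smul_smul, mul_inv_cancel₀ hn0.ne', one_smul,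
    smul_eq_mul, ← mul_assoc, mul_inv_cancel₀ hn0.ne', one_mul]
  rfl

/-- A neighbourhood of `S^(q-1) × {0}` on which `handleCollar` is an embedding. -/
def handleCollarDomain (q p : ℕ) : Set (Euc q × EucSucc p) :=
  {w | ‖w.1‖ = 1 ∧ (1 + w.2.snd ^ 2) * ‖w.2.fst‖ ^ 2 < 1 ∧ w.2.snd ≤ 0}

theorem prod_ball_inter_lowerHalf_subset :
    sphere (0 : Euc q) 1 ×ˢ (ball (0 : EucSucc p) 1 ∩ lowerHalf p) ⊆ handleCollarDomain q p := by
  rintro ⟨v, w⟩ ⟨hv, hw, hw'⟩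
  rw [mem_ball_eucSucc] at hw
  refine ⟨mem_sphere_zero_iff_norm.1 hv, ?_, hw'⟩
  show (1 + w.snd ^ 2) * ‖w.fst‖ ^ 2 < 1
  nlinarith [sq_nonneg w.snd, sq_nonneg ‖w.fst‖]

theorem handleCollar_mem_target {w : Euc q × EucSucc p} (hw : w ∈ handleCollarDomain q p) :
    handleCollar w ∈ ball (0 : Euc p) 1 ×ˢ (sphere (0 : EucSucc q) 1 ∩ lowerHalf q) ∩
      {y | y.2.fst ≠ 0} := by
  obtain ⟨v, w⟩ := w
  obtain ⟨hv1, hw, hw'⟩ := hw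
  have hv1 : ‖v‖ = 1 := hv1
  have hw' : w.snd ≤ 0 := hw'
  have hw : (1 + w.snd ^ 2) * ‖w.fst‖ ^ 2 < 1 := hw
  set t := w.snd
  set z := w.fst
  have hs : 0 < 1 + t ^ 2 := by positivity
  have hn : √(1 + t ^ 2) ^ 2 = 1 + t ^ 2 := Real.sq_sqrt hs.le
  have hn0 : 0 < √(1 + t ^ 2) := Real.sqrt_pos.2 hs
  set n := √(1 + t ^ 2)
  have e1 : (handleCollar (v, w)).1 = n • z := rfl
  have e2 : (handleCollar (v, w)).2.fst = n⁻¹ • v := rfl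
  have e3 : (handleCollar (v, w)).2.snd = n⁻¹ * t := rfl
  have hnv : ‖n⁻¹ • v‖ ^ 2 = (n ^ 2)⁻¹ := by
    rw [norm_smul, hv1, mul_one, Real.norm_eq_abs, sq_abs, inv_pow]
  have hnz : ‖n • z‖ ^ 2 = n ^ 2 * ‖z‖ ^ 2 := by
    rw [norm_smul, mul_pow, Real.norm_eq_abs, sq_abs]
  refine ⟨⟨?_, ?_, ?_⟩, ?_⟩
  · rwa [e1, mem_ball_zero_iff, ← sq_lt_one_iff₀ (norm_nonneg _), hnz, hn]
  · rw [mem_sphere_eucSucc, e2, e3, hnv, mul_pow, inv_pow, hn]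
    field_simp
  · show (handleCollar (v, w)).2.snd ≤ 0
    rw [e3]
    exact mul_nonpos_of_nonneg_of_nonpos (by positivity) hw'
  · show (handleCollar (v, w)).2.fst ≠ 0
    rw [e2, ← norm_pos_iff, norm_smul, hv1]
    simpa using hn0.ne'

theorem isOpenSmoothEmbeddingOn_handleCollar
    (hb : IsOpenSmoothEmbeddingOn 𝓘(ℝ, Euc p × EucSucc q) I b
      (ball 0 1 ×ˢ (sphere 0 1 ∩ lowerHalf q))) :
    IsOpenSmoothEmbeddingOn 𝓘(ℝ, Euc q × EucSucc p) I (b ∘ handleCollar)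
      (handleCollarDomain q p) := by
  have o1 : IsOpen {y : Euc p × EucSucc q | y.2.fst ≠ 0} :=
    isOpen_ne_fun (by fun_prop) (by fun_prop)
  refine hb.comp_of_inverse (k := handleCollarInv) o1 ?_ ?_ ?_ ?_ ?_ ?_
  · refine ContDiffOn.contMDiffOn ?_
    unfold handleCollar
    fun_prop (disch := intros; positivity)
  · refine ContDiffOn.contMDiffOn ?_
    unfold handleCollarInv
    have h : ∀ y ∈ ball 0 1 ×ˢ (sphere 0 1 ∩ lowerHalf q) ∩
      {y : Euc p × EucSucc q | y.2.fst ≠ 0}, y.2.fst ≠ 0 := fun y hy => hy.2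
    fun_prop (disch := first | assumption | simp)
  · exact fun w hw => handleCollar_mem_target hw
  · rintro ⟨Z, x⟩ ⟨⟨hZ, hx, hx'⟩, hx0⟩
    have hx0 : x.fst ≠ 0 := hx0
    have hZ : ‖Z‖ < 1 := mem_ball_zero_iff.1 hZ
    have hx' : x.snd ≤ 0 := hx'
    rw [mem_sphere_eucSucc] at hx
    have hx : ‖x.fst‖ ^ 2 + x.snd ^ 2 = 1 := hx
    have hn0 : 0 < ‖x.fst‖ := norm_pos_iff.2 hx0
    refine ⟨?_, ?_, ?_⟩
    · simp [handleCollarInv, norm_smul, hn0.ne']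
    · simp only [handleCollarInv, norm_smul, norm_norm, mul_pow, inv_pow, WithLp.toLp_fst,
        WithLp.toLp_snd]
      have : (1 + (‖x.fst‖ ^ 2)⁻¹ * x.snd ^ 2) * (‖x.fst‖ ^ 2 * ‖Z‖ ^ 2) = ‖Z‖ ^ 2 := by
        field_simp
        rw [hx, one_mul]
      rw [this]
      exact (sq_lt_one_iff₀ (norm_nonneg _)).2 hZ
    · exact mul_nonpos_of_nonneg_of_nonpos (inv_nonneg.2 hn0.le) hx'
  · rintro ⟨v, w⟩ ⟨hv1, hw, hw'⟩
    have hv1 : ‖v‖ = 1 := hv1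
    have hs : 0 < 1 + w.snd ^ 2 := by positivity
    have hn0 : 0 < √(1 + w.snd ^ 2) := Real.sqrt_pos.2 hs
    have e2 : ‖(handleCollar (v, w)).2.fst‖ = (√(1 + w.snd ^ 2))⁻¹ := by
      show ‖(√(1 + w.snd ^ 2))⁻¹ • v‖ = _
      rw [norm_smul, hv1, mul_one, Real.norm_of_nonneg (by positivity)]
    simp only [handleCollarInv, e2]
    simp only [handleCollar, WithLp.smul_fst, WithLp.smul_snd, smul_smul, inv_inv]
    rw [mul_inv_cancel₀ hn0.ne', inv_mul_cancel₀ hn0.ne', smul_eq_mul, ← mul_assoc,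
      mul_inv_cancel₀ hn0.ne', one_smul, one_smul, one_mul]
    rfl
  · rintro ⟨Z, x⟩ ⟨⟨hZ, hx, hx'⟩, hx0⟩
    exact handleCollar_handleCollarInv hx hx0

theorem handleCollar_zero (v : Euc q) (z : Euc p) :
    handleCollar (v, WithLp.toLp 2 (z, 0)) = (z, WithLp.toLp 2 (v, 0)) := by
  simp [handleCollar]

theorem isOpenSmoothEmbeddingOn_handleCollar_ball
    (hb : IsOpenSmoothEmbeddingOn 𝓘(ℝ, Euc p × EucSucc q) I b
      (ball 0 1 ×ˢ (sphere 0 1 ∩ lowerHalf q))) :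
    IsOpenSmoothEmbeddingOn 𝓘(ℝ, Euc q × EucSucc p) I (b ∘ handleCollar)
      (sphere 0 1 ×ˢ (ball 0 1 ∩ lowerHalf p)) := by
  have := (isOpenSmoothEmbeddingOn_handleCollar hb).inter_open
    (U := {w | w.2 ∈ ball 0 1}) (isOpen_ball.preimage continuous_snd)
  convert this using 1
  ext ⟨v, w⟩
  constructor
  · exact fun h => ⟨prod_ball_inter_lowerHalf_subset h, h.2.1⟩
  · exact fun h => ⟨mem_sphere_zero_iff_norm.2 h.1.1, h.2, h.1.2.2⟩

end HandleCollar

/-! ### Independence of the collar used for the dual handle -/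

section ExtendById

variable {E H X : Type*} [NormedAddCommGroup E] [NormedSpace ℝ E] [TopologicalSpace H]
  [TopologicalSpace X] [ChartedSpace H X]
  {E' H' Y : Type*} [NormedAddCommGroup E'] [NormedSpace ℝ E'] [TopologicalSpace H']
  [TopologicalSpace Y] [ChartedSpace H' Y]
  {I : ModelWithCorners ℝ E H} {J : ModelWithCorners ℝ E' H'}

open Classical in
/-- The self-map of `Y` that is `θ` in the coordinates `c : s → Y`, with inverse `g`, and the
identity elsewhere. -/
noncomputable def extendById (c : X → Y) (g : Y → X) (s : Set X) (θ : X → X) (y : Y) : Y :=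
  if y ∈ c '' s then c (θ (g y)) else y

variable {c : X → Y} {g : Y → X} {s K : Set X} {θ : X → X}

theorem extendById_apply (hg : ∀ x ∈ s, g (c x) = x) {x : X} (hx : x ∈ s) :
    extendById c g s θ (c x) = c (θ x) := by
  rw [extendById, if_pos (mem_image_of_mem c hx), hg x hx]

theorem extendById_of_notMem {y : Y} (hy : y ∉ c '' s) : extendById c g s θ y = y := if_neg hy

theorem contMDiffOn_extendById (hc : IsOpenSmoothEmbeddingOn I J c s)
    (hg : ∀ x ∈ s, g (c x) = x) (hK : IsClosed (c '' K)) (hKs : K ⊆ s)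
    (hθ : ContMDiffOn I I ∞ θ s) (hm : MapsTo θ s s) (hid : ∀ x ∈ s, x ∉ K → θ x = x) :
    ContMDiffOn J J ∞ (extendById c g s θ) univ := by
  have h1 : ContMDiffOn J J ∞ (extendById c g s θ) (c '' s) := by
    have hgs : MapsTo g (c '' s) s := by
      rintro _ ⟨x, hx, rfl⟩
      rwa [hg x hx]
    refine (hc.2.1.comp (hθ.comp (hc.contMDiffOn_leftInv hg) hgs) (hm.comp hgs)).congr ?_
    exact fun y hy => if_pos hy
  have h2 : ContMDiffOn J J ∞ (extendById c g s θ) (c '' K)ᶜ := by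
    refine contMDiffOn_id.congr fun y hy => ?_
    by_cases h : y ∈ c '' s
    · obtain ⟨x, hx, rfl⟩ := h
      rw [extendById_apply hg hx, hid x hx fun h => hy ⟨x, h, rfl⟩, id]
    · exact extendById_of_notMem h
  have : (univ : Set Y) = c '' s ∪ (c '' K)ᶜ :=
    (eq_univ_of_forall fun y => by
      by_cases h : y ∈ c '' K
      · exact Or.inl (image_mono hKs h)
      · exact Or.inr h).symm
  rw [this]
  exact h1.union_of_isOpen h2 hc.1 hK.isOpen_compl

end ExtendById

section HandleCollar

variable {p q : ℕ} {E H X : Type*} [NormedAddCommGroup E] [NormedSpace ℝ E] [TopologicalSpace H]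
  [TopologicalSpace X] [ChartedSpace H X]
  {E' H' Y : Type*} [NormedAddCommGroup E'] [NormedSpace ℝ E'] [TopologicalSpace H']
  [TopologicalSpace Y] [ChartedSpace H' Y]
  {I : ModelWithCorners ℝ E H} {J : ModelWithCorners ℝ E' H'}
  {b : Euc p × EucSucc q → X}

/-- The linear change of coordinates `((v, z), t) ↦ (v, (z, t))`. -/
noncomputable def collarAssoc (y : (Euc q × Euc p) × ℝ) : Euc q × EucSucc p :=
  (y.1.1, WithLp.toLp 2 (y.1.2, y.2))

/-- The inverse of `collarAssoc`. -/
def collarAssocInv (w : Euc q × EucSucc p) : (Euc q × Euc p) × ℝ := ((w.1, w.2.fst), w.2.snd)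

theorem contDiff_collarAssoc :
    ContDiff ℝ ∞ (collarAssoc : (Euc q × Euc p) × ℝ → Euc q × EucSucc p) := by
  unfold collarAssoc
  fun_prop

theorem contDiff_collarAssocInv :
    ContDiff ℝ ∞ (collarAssocInv : Euc q × EucSucc p → (Euc q × Euc p) × ℝ) := by
  unfold collarAssocInv
  fun_prop

theorem collarAssoc_mem {r : ℝ} (hr : r ≤ 1 / 2) {y : (Euc q × Euc p) × ℝ}
    (hy : y ∈ sphereCollar (Euc q) (Euc p) r) :
    collarAssoc y ∈ sphere (0 : Euc q) 1 ×ˢ (ball (0 : EucSucc p) 1 ∩ lowerHalf p) := by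
  obtain ⟨h1, h2, h3, h4⟩ := hy
  refine ⟨mem_sphere_zero_iff_norm.2 h1, ?_, h4⟩
  rw [mem_ball_eucSucc]
  show ‖y.1.2‖ ^ 2 + y.2 ^ 2 < 1
  nlinarith [norm_nonneg y.1.2]

theorem isOpenSmoothEmbeddingOn_comp_collarAssoc {C : Euc q × EucSucc p → X}
    (hC : IsOpenSmoothEmbeddingOn 𝓘(ℝ, Euc q × EucSucc p) I C
      (sphere 0 1 ×ˢ (ball 0 1 ∩ lowerHalf p))) {r : ℝ} (hr : r ≤ 1 / 2) :
    IsOpenSmoothEmbeddingOn 𝓘(ℝ, (Euc q × Euc p) × ℝ) I (C ∘ collarAssoc)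
      (sphereCollar (Euc q) (Euc p) r) := by
  have o1 : IsOpen {w : Euc q × EucSucc p | ‖w.2.fst‖ < r} :=
    isOpen_lt (by fun_prop) (by fun_prop)
  have o2 : IsOpen {w : Euc q × EucSucc p | -r < w.2.snd} :=
    isOpen_lt (by fun_prop) (by fun_prop)
  refine hC.comp_of_inverse (k := collarAssocInv) (o1.inter o2)
    contDiff_collarAssoc.contDiffOn.contMDiffOn contDiff_collarAssocInv.contDiffOn.contMDiffOn
    ?_ ?_ (fun _ _ => rfl) (fun _ _ => rfl)
  · exact fun y hy => ⟨collarAssoc_mem hr hy, hy.2.1, hy.2.2.1⟩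
  · rintro ⟨v, w⟩ ⟨⟨hv, hw, hw'⟩, h1, h2⟩
    exact ⟨mem_sphere_zero_iff_norm.1 hv, h1, h2, hw'⟩

theorem isCompact_inner_sphereCollar (r : ℝ) :
    IsCompact {y : (Euc q × Euc p) × ℝ | ‖y.1.1‖ = 1 ∧ ‖y.1.2‖ ≤ r ∧ -r ≤ y.2 ∧ y.2 ≤ 0} := by
  have := ((isCompact_sphere (0 : Euc q) 1).prod (isCompact_closedBall (0 : Euc p) r)).prod
    (isCompact_Icc (a := -r) (b := 0))
  refine this.of_isClosed_subset ?_ ?_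
  · have c1 : IsClosed {y : (Euc q × Euc p) × ℝ | ‖y.1.1‖ = 1} :=
      isClosed_eq (by fun_prop) (by fun_prop)
    have c2 : IsClosed {y : (Euc q × Euc p) × ℝ | ‖y.1.2‖ ≤ r} :=
      isClosed_le (by fun_prop) (by fun_prop)
    have c3 : IsClosed {y : (Euc q × Euc p) × ℝ | -r ≤ y.2} :=
      isClosed_le (by fun_prop) (by fun_prop)
    have c4 : IsClosed {y : (Euc q × Euc p) × ℝ | y.2 ≤ 0} :=
      isClosed_le (by fun_prop) (by fun_prop)
    exact c1.inter (c2.inter (c3.inter c4))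
  · rintro y ⟨h1, h2, h3, h4⟩
    exact ⟨⟨by simpa using h1, by simpa using h2⟩, h3, h4⟩

/-- The extension of the attaching map of the dual handle to a collar may be chosen arbitrarily: the
result of the attachment is also the result of an attachment by means of the standard collar of
`B^p × S^(q-1)` in the first handle. -/
theorem exists_isSurgeryAlong_handleCollar [T2Space X] [NeZero p]
    (hb : IsOpenSmoothEmbeddingOn 𝓘(ℝ, Euc p × EucSucc q) I b
      (ball 0 1 ×ˢ (sphere 0 1 ∩ lowerHalf q)))
    {F : Euc q × EucSucc p → X} {a : X → Y} {b₂ : Euc q × EucSucc p → Y}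
    (h : IsSurgeryAlong I J (lowerHalf p) F a b₂)
    (hF : ∀ v ∈ sphere (0 : Euc q) 1, ∀ z ∈ ball (0 : Euc p) 1,
      F (v, WithLp.toLp 2 (z, 0)) = b (z, WithLp.toLp 2 (v, 0))) :
    ∃ (a' : X → Y) (b' : Euc q × EucSucc p → Y),
      IsSurgeryAlong I J (lowerHalf p) (b ∘ handleCollar) a' b' := by
  have hC := isOpenSmoothEmbeddingOn_handleCollar_ball hb
  have hFe := h.embedding
  set C := b ∘ handleCollar with hCdef
  set D : Set (Euc q × EucSucc p) := sphere 0 1 ×ˢ (ball 0 1 ∩ lowerHalf p) with hD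
  have hFC : ∀ v ∈ sphere (0 : Euc q) 1, ∀ z ∈ ball (0 : Euc p) 1,
      F (v, WithLp.toLp 2 (z, 0)) = C (v, WithLp.toLp 2 (z, 0)) := fun v hv z hz => by
    rw [hF v hv z hz, hCdef, Function.comp_apply, handleCollar_zero]
  obtain ⟨g, hg, hgC⟩ := hC.2.2
  obtain ⟨gF, hgF, hgFF⟩ := hFe.2.2
  have hgm : ∀ x ∈ C '' D, g x ∈ D ∧ C (g x) = x := by
    rintro _ ⟨w, hw, rfl⟩
    rw [hgC w hw]
    exact ⟨hw, rfl⟩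
  -- the coordinate change is defined near the sphere
  obtain ⟨r₀, hr₀, hr₀', hr₀m⟩ : ∃ r₀ > 0, r₀ ≤ 1 / 2 ∧
      ∀ y ∈ sphereCollar (Euc q) (Euc p) r₀, F (collarAssoc y) ∈ C '' D := by
    obtain ⟨u, hu, hue⟩ := continuousOn_iff'.1 hFe.2.1.continuousOn _ hC.1
    have hk : IsCompact ((sphere (0 : Euc q) 1 ×ˢ {(0 : Euc p)}) ×ˢ {(0 : ℝ)}) :=
      ((isCompact_sphere _ _).prod isCompact_singleton).prod isCompact_singleton
    obtain ⟨δ, hδ, hδu⟩ := hk.exists_thickening_subset_open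
      (hu.preimage (contDiff_collarAssoc (p := p) (q := q)).continuous) (by
        rintro ⟨⟨v, z⟩, t⟩ ⟨⟨hv, hz⟩, ht⟩
        obtain rfl : z = 0 := hz
        obtain rfl : t = 0 := ht
        have hmem : ((v, WithLp.toLp 2 (0, 0)) : Euc q × EucSucc p) ∈ D :=
          ⟨hv, by rw [mem_ball_eucSucc]; simp, (le_refl (0 : ℝ) :)⟩
        have : ((v, WithLp.toLp 2 (0, 0)) : Euc q × EucSucc p) ∈ F ⁻¹' (C '' D) ∩ D :=
          ⟨⟨_, hmem, (hFC v hv 0 (mem_ball_self one_pos)).symm⟩, hmem⟩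
        rw [hue] at this
        exact this.1)
    refine ⟨min δ (1 / 2), lt_min hδ (by norm_num), min_le_right _ _, fun y hy => ?_⟩
    have hyD := collarAssoc_mem (min_le_right _ _) hy
    obtain ⟨h1, h2, h3, h4⟩ := hy
    have hyu : y ∈ collarAssoc ⁻¹' u := by
      refine hδu (mem_thickening_iff.2 ⟨((y.1.1, 0), 0), ⟨⟨by simpa using h1, rfl⟩, rfl⟩, ?_⟩)
      rw [Prod.dist_eq, Prod.dist_eq, dist_self, dist_zero_right, dist_zero_right,
        Real.norm_eq_abs]
      have := min_le_left δ (1 / 2)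
      exact max_lt (max_lt hδ (h2.trans_le this)) (abs_lt.2 ⟨by linarith, by linarith⟩)
    have : collarAssoc y ∈ F ⁻¹' (C '' D) ∩ D := by
      rw [hue]
      exact ⟨hyu, hyD⟩
    exact this.1
  have hιD : MapsTo collarAssoc (sphereCollar (Euc q) (Euc p) r₀) D :=
    fun y hy => collarAssoc_mem hr₀' hy
  have hιs : ContMDiff 𝓘(ℝ, (Euc q × Euc p) × ℝ) 𝓘(ℝ, Euc q × EucSucc p) ∞ collarAssoc :=
    contDiff_collarAssoc.contMDiff
  have hι's : ContMDiff 𝓘(ℝ, Euc q × EucSucc p) 𝓘(ℝ, (Euc q × Euc p) × ℝ) ∞ collarAssocInv :=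
    contDiff_collarAssocInv.contMDiff
  obtain ⟨r, hr, hrr, Φ, Φ', hΦ, hΦ', hinv, -, hid, ρ, hρ, hΦG⟩ := exists_straightening hr₀
    (G := fun y => collarAssocInv (g (F (collarAssoc y))))
    (G' := fun y => collarAssocInv (gF (C (collarAssoc y))))
    (D' := {y | collarAssoc y ∈ D ∧ C (collarAssoc y) ∈ F '' D})
    (by
      rw [← contMDiffOn_iff_contDiffOn]
      exact hι's.comp_contMDiffOn (hg.comp (hFe.2.1.comp hιs.contMDiffOn hιD) hr₀m))
    (fun y hy => by
      have := (hgm _ (hr₀m y hy)).1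
      exact ⟨mem_sphere_zero_iff_norm.1 this.1, this.2.2⟩)
    (fun y hy h0 => by
      obtain ⟨⟨v, z⟩, t⟩ := y
      obtain rfl : t = 0 := h0
      have hm := hιD hy
      have e : F (collarAssoc ((v, z), 0)) = C (collarAssoc ((v, z), 0)) :=
        hFC v hm.1 z (by
          have := hm.2.1
          rw [mem_ball_eucSucc] at this
          simpa [collarAssoc] using this)
      rw [e, hgC _ hm]
      rfl)
    (by
      rw [← contMDiffOn_iff_contDiffOn]
      exact hι's.comp_contMDiffOn (hgF.comp (hC.2.1.comp hιs.contMDiffOn fun y hy => hy.1)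
        fun y hy => hy.2))
    (fun y hy => by
      obtain ⟨h1, h2⟩ := hgm _ (hr₀m y hy)
      refine ⟨h1, ?_⟩
      show C (g (F (collarAssoc y))) ∈ F '' D
      rw [h2]
      exact ⟨_, hιD hy, rfl⟩)
    (fun y hy => by
      show collarAssocInv (gF (C (g (F (collarAssoc y))))) = y
      rw [(hgm _ (hr₀m y hy)).2, hgFF _ (hιD hy)]
      rfl)
  have hr12 : r ≤ 1 / 2 := hrr.trans hr₀'
  set s := sphereCollar (Euc q) (Euc p) r with hs
  have hsub : s ⊆ sphereCollar (Euc q) (Euc p) r₀ := fun y hy =>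
    ⟨hy.1, hy.2.1.trans_le hrr, by linarith [hy.2.2.1], hy.2.2.2⟩
  have hc := isOpenSmoothEmbeddingOn_comp_collarAssoc hC hr12
  have hgc : ∀ y ∈ s, (collarAssocInv ∘ g) ((C ∘ collarAssoc) y) = y := fun y hy => by
    simp only [Function.comp, hgC _ (hιD (hsub hy))]
    rfl
  set Kc : Set ((Euc q × Euc p) × ℝ) :=
    {y | ‖y.1.1‖ = 1 ∧ ‖y.1.2‖ ≤ r / 2 ∧ -(r / 2) ≤ y.2 ∧ y.2 ≤ 0} with hKc
  have hKs : Kc ⊆ s := fun y hy => ⟨hy.1, by linarith [hy.2.1], by linarith [hy.2.2.1], hy.2.2.2⟩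
  have hKcl : IsClosed ((C ∘ collarAssoc) '' Kc) :=
    ((isCompact_inner_sphereCollar _).image_of_continuousOn
      (hc.2.1.continuousOn.mono hKs)).isClosed
  have hid' : ∀ y ∈ s, y ∉ Kc → Φ y = y := by
    intro y hy hyK
    refine hid y hy ?_
    by_contra! hcon
    exact hyK ⟨hy.1, hcon.1.le, by linarith [hcon.2], hy.2.2.2⟩
  have hid'' : ∀ y ∈ s, y ∉ Kc → Φ' y = y := fun y hy hyK => by
    have := (hinv y hy).2.2.2
    rwa [hid' y hy hyK] at this
  set Ψ := extendById (C ∘ collarAssoc) (collarAssocInv ∘ g) s Φ with hΨ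
  set Ψ' := extendById (C ∘ collarAssoc) (collarAssocInv ∘ g) s Φ' with hΨ'
  have hΨs : ContMDiffOn I I ∞ Ψ univ := contMDiffOn_extendById hc hgc hKcl hKs
    hΦ.contMDiffOn (fun y hy => (hinv y hy).1) hid'
  have hΨ's : ContMDiffOn I I ∞ Ψ' univ := contMDiffOn_extendById hc hgc hKcl hKs
    hΦ'.contMDiffOn (fun y hy => (hinv y hy).2.1) hid''
  have hl : ∀ x, Ψ' (Ψ x) = x := by
    intro x
    by_cases hx : x ∈ (C ∘ collarAssoc) '' s
    · obtain ⟨y, hy, rfl⟩ := hx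
      rw [hΨ, extendById_apply hgc hy, hΨ', extendById_apply hgc (hinv y hy).1, (hinv y hy).2.2.2]
    · rw [hΨ, extendById_of_notMem hx, hΨ', extendById_of_notMem hx]
  have hrinv : ∀ x, Ψ (Ψ' x) = x := by
    intro x
    by_cases hx : x ∈ (C ∘ collarAssoc) '' s
    · obtain ⟨y, hy, rfl⟩ := hx
      rw [hΨ', extendById_apply hgc hy, hΨ, extendById_apply hgc (hinv y hy).2.1,
        (hinv y hy).2.2.1]
    · rw [hΨ', extendById_of_notMem hx, hΨ, extendById_of_notMem hx]
  have himΨ : Ψ '' univ = univ := eq_univ_of_forall fun x => ⟨_, mem_univ _, hrinv x⟩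
  have himΨ' : Ψ' '' univ = univ := eq_univ_of_forall fun x => ⟨_, mem_univ _, hl x⟩
  have hΨe : IsOpenSmoothEmbeddingOn I I Ψ univ :=
    ⟨by rw [himΨ]; exact isOpen_univ, hΨs, Ψ', by rwa [himΨ], fun x _ => hl x⟩
  have hΨ'e : IsOpenSmoothEmbeddingOn I I Ψ' univ :=
    ⟨by rw [himΨ']; exact isOpen_univ, hΨ's, Ψ, by rwa [himΨ'], fun x _ => hrinv x⟩
  obtain ⟨b', hb'⟩ := (h.comp_diffeo hΨe hΨ'e hl hrinv).exists_of_eq_near smul_mem_lowerHalf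
    zero_mem_lowerHalf hC (lt_min hr hρ) (fun v hv w hw hwε => by
      have h1 : ‖w.fst‖ ≤ ‖w‖ := WithLp.norm_fst_le _ w
      have h2 : |w.snd| ≤ ‖w‖ := WithLp.norm_snd_le _ w
      have m1 := min_le_left r ρ
      have m2 := min_le_right r ρ
      rw [abs_le] at h2
      have hy : collarAssocInv (v, w) ∈ s :=
        ⟨mem_sphere_zero_iff_norm.1 hv, show ‖w.fst‖ < r by linarith, show -r < w.snd by linarith [h2.1], hw.2⟩
      have e1 : F (v, w) = Ψ (C (v, w)) := by
        have e2 : C (v, w) = (C ∘ collarAssoc) (collarAssocInv (v, w)) := rfl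
        rw [e2, hΨ, extendById_apply hgc hy, hΦG _ hy (show ‖w.fst‖ ≤ ρ by linarith)
          (show -ρ ≤ w.snd by linarith [h2.1])]
        exact ((hgm _ (hr₀m _ (hsub hy))).2).symm
      rw [Function.comp_apply, e1, hl])
  exact ⟨_, b', hb'⟩

end HandleCollar

/-! ### Sliding an arc into its endpoint -/

section Slide

/-- The distance of `(√B * t, 1 + 2 * t)` from the origin. -/
noncomputable def slideRoot (B t : ℝ) : ℝ := √(B * t ^ 2 + (1 + 2 * t) ^ 2)

/-- The height function of the slide, near the arc. For `B = 0` it vanishes exactly for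
`-1 / 2 ≤ t`. (For `t = 0` the value `0` of the quotient is the correct one.) -/
noncomputable def slideInner (B t : ℝ) : ℝ := (slideRoot B t - (1 + 2 * t)) / (64 * t)

/-- The cutoff function of the slide. -/
noncomputable def slideCutoff (B t : ℝ) : ℝ := Real.smoothTransition (4 * (B + t ^ 2) - 2)

/-- The height function of the slide. The map `(y, t) ↦ (y, slide (‖y‖ ^ 2) t)` is a diffeomorphism
from the complement of the arc `{0} × [-1/2, 0]` in the half-ball to the complement of the
origin. -/
noncomputable def slide (B t : ℝ) : ℝ :=
  (1 - slideCutoff B t) * slideInner B t + slideCutoff B t * t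

variable {B t : ℝ}

theorem slideRoot_sq (hB : 0 ≤ B) (t : ℝ) :
    slideRoot B t ^ 2 = B * t ^ 2 + (1 + 2 * t) ^ 2 := Real.sq_sqrt (by positivity)

theorem slideRoot_nonneg : 0 ≤ slideRoot B t := Real.sqrt_nonneg _

theorem abs_le_slideRoot (hB : 0 ≤ B) (t : ℝ) : |1 + 2 * t| ≤ slideRoot B t :=
  Real.abs_le_sqrt (by nlinarith [mul_nonneg hB (sq_nonneg t)])

theorem slideRoot_zero_right : slideRoot B 0 = 1 := by simp [slideRoot]

theorem slideInner_eq (hB : 0 ≤ B) (h : 0 < slideRoot B t + (1 + 2 * t)) :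
    slideInner B t = B * t / (64 * (slideRoot B t + (1 + 2 * t))) := by
  have h1 := slideRoot_sq hB t
  rcases eq_or_ne t 0 with rfl | ht
  · simp [slideInner]
  · rw [slideInner, div_eq_div_iff (by positivity) (by positivity)]
    linear_combination 64 * h1

theorem slideInner_nonpos (hB : 0 ≤ B) (ht : t ≤ 0) : slideInner B t ≤ 0 :=
  div_nonpos_of_nonneg_of_nonpos
    (by linarith [(le_abs_self _).trans (abs_le_slideRoot hB t)]) (by linarith)

theorem le_slideInner (hB : 0 ≤ B) (ht : t ≤ 0) (h1 : B + t ^ 2 < 1) : t ≤ slideInner B t := by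
  rcases ht.eq_or_lt with rfl | ht
  · simp [slideInner]
  have h2 := slideRoot_sq hB t
  have h0 := slideRoot_nonneg (B := B) (t := t)
  rw [slideInner, le_div_iff_of_neg (by linarith)]
  by_cases h : -1 / 4 ≤ t
  · have h3 := (le_abs_self _).trans (abs_le_slideRoot hB t)
    nlinarith [sq_nonneg t]
  · have h4 : slideRoot B t ≤ 2 := by
      refine Real.sqrt_le_iff.2 ⟨by norm_num, ?_⟩
      nlinarith [sq_nonneg t]
    nlinarith

theorem slideCutoff_nonneg : 0 ≤ slideCutoff B t := Real.smoothTransition.nonneg _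
theorem slideCutoff_le_one : slideCutoff B t ≤ 1 := Real.smoothTransition.le_one _

theorem slide_eq_inner (h : B + t ^ 2 ≤ 1 / 2) : slide B t = slideInner B t := by
  simp [slide, slideCutoff, Real.smoothTransition.zero_of_nonpos
    (show 4 * (B + t ^ 2) - 2 ≤ 0 by linarith)]

theorem slide_eq_self (h : 3 / 4 ≤ B + t ^ 2) : slide B t = t := by
  simp [slide, slideCutoff, Real.smoothTransition.one_of_one_le
    (show 1 ≤ 4 * (B + t ^ 2) - 2 by linarith)]

theorem slide_nonpos (hB : 0 ≤ B) (ht : t ≤ 0) : slide B t ≤ 0 := by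
  have h1 := slideInner_nonpos hB ht
  have h2 := slideCutoff_nonneg (B := B) (t := t)
  have h3 := slideCutoff_le_one (B := B) (t := t)
  unfold slide
  nlinarith

theorem le_slide (hB : 0 ≤ B) (ht : t ≤ 0) (h : B + t ^ 2 < 1) : t ≤ slide B t := by
  have h1 := le_slideInner hB ht h
  have h3 := slideCutoff_le_one (B := B) (t := t)
  unfold slide
  nlinarith

theorem slide_zero_right : slide B 0 = 0 := by simp [slide, slideInner]

theorem slideRoot_pos (hB : 0 ≤ B) (h : 0 < B ∨ t < -1 / 2) : 0 < slideRoot B t := by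
  refine Real.sqrt_pos.2 ?_
  rcases h with h | h
  · rcases eq_or_ne t 0 with rfl | ht
    · norm_num
    · positivity
  · have : 1 + 2 * t ≠ 0 := by linarith
    positivity

theorem slide_zero_left_neg (ht : t < -1 / 2) : slide 0 t < 0 := by
  have h1 : slideInner 0 t < 0 := by
    have := (neg_le_abs _).trans (abs_le_slideRoot le_rfl t)
    exact div_neg_of_pos_of_neg (by linarith) (by linarith)
  have h2 := slideCutoff_nonneg (B := 0) (t := t)
  have h3 := slideCutoff_le_one (B := 0) (t := t)
  unfold slide
  rcases h2.eq_or_lt with h2 | h2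
  · rw [← h2]; linarith
  · have := mul_pos_of_neg_of_neg (neg_neg_of_pos h2) (show t < 0 by linarith)
    nlinarith

theorem slide_zero_left_eq_zero (ht : -1 / 2 ≤ t) (ht0 : t ≤ 0) : slide 0 t = 0 := by
  rw [slide_eq_inner (by nlinarith)]
  simp [slideInner, slideRoot, Real.sqrt_sq (show 0 ≤ 1 + 2 * t by linarith)]

theorem hasDerivAt_slideRoot (h : slideRoot B t ≠ 0) :
    HasDerivAt (slideRoot B) ((B * t + 2 * (1 + 2 * t)) / slideRoot B t) t := by
  have h0 : B * t ^ 2 + (1 + 2 * t) ^ 2 ≠ 0 := by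
    intro h0
    exact h (by rw [slideRoot, h0, Real.sqrt_zero])
  have h1 : HasDerivAt (fun t : ℝ => B * t ^ 2 + (1 + 2 * t) ^ 2)
      (B * (2 * t) + 2 * (1 + 2 * t) * 2) t := by
    have e1 := (hasDerivAt_pow 2 t).const_mul B
    have e2 := (((hasDerivAt_id t).const_mul 2).const_add 1).pow 2
    refine (e1.add e2).congr_deriv ?_
    simp
  refine (h1.sqrt h0).congr_deriv ?_
  unfold slideRoot at h ⊢
  field_simp

theorem exists_hasDerivAt_slideInner (hB : 0 ≤ B) (ht : t ≤ 0) (h : 0 < B ∨ t < -1 / 2) :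
    ∃ d > 0, HasDerivAt (slideInner B) d t := by
  have hR := slideRoot_pos hB h
  have hRs := slideRoot_sq hB t
  have hd := hasDerivAt_slideRoot hR.ne'
  rcases ht.eq_or_lt with rfl | ht
  · have hB' : 0 < B := h.resolve_right (by norm_num)
    refine ⟨B / 128, by positivity, ?_⟩
    have h1 : HasDerivAt (fun t => B * t / (64 * (slideRoot B t + (1 + 2 * t)))) (B / 128) 0 := by
      have e1 : HasDerivAt (fun t : ℝ => B * t) (B * 1) 0 := (hasDerivAt_id 0).const_mul B
      have e2 := (hd.add (((hasDerivAt_id (0 : ℝ)).const_mul 2).const_add 1)).const_mul 64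
      refine (e1.div e2 ?_).congr_deriv ?_
      · simp [slideRoot_zero_right]
      · simp [slideRoot_zero_right]
        ring
    refine h1.congr_of_eventuallyEq ?_
    have hc : ContinuousAt (fun t : ℝ => slideRoot B t + (1 + 2 * t)) 0 := by
      unfold slideRoot; fun_prop
    filter_upwards [hc.eventually (lt_mem_nhds (show (0 : ℝ) < slideRoot B 0 + (1 + 2 * 0) by
      rw [slideRoot_zero_right]; norm_num))] with t ht using slideInner_eq hB ht
  · refine ⟨(1 - (1 + 2 * t) / slideRoot B t) / (64 * t ^ 2), ?_, ?_⟩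
    · have h2 : 1 + 2 * t < slideRoot B t := by
        rcases h with h | h
        · refine lt_of_pow_lt_pow_left₀ 2 hR.le ?_
          have : 0 < B * t ^ 2 := by have := ht.ne; positivity
          linarith
        · linarith
      have h3 : (1 + 2 * t) / slideRoot B t < 1 := (div_lt_one hR).2 h2
      have := ht.ne
      have : 0 < 1 - (1 + 2 * t) / slideRoot B t := by linarith
      positivity
    · have e1 := hd.sub (((hasDerivAt_id t).const_mul 2).const_add 1)
      have e2 := (hasDerivAt_id t).const_mul 64
      refine (e1.div e2 (by simpa using ht.ne)).congr_deriv ?_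
      have ht0 := ht.ne
      simp only [id, Pi.sub_apply, mul_one]
      field_simp
      linear_combination (-1) * hRs

theorem exists_hasDerivAt_slide (hB : 0 ≤ B) (ht : t ≤ 0) (h : 0 < B ∨ t < -1 / 2)
    (h1 : B + t ^ 2 < 1) : ∃ d > 0, HasDerivAt (slide B) d t := by
  obtain ⟨d, hd, hdd⟩ := exists_hasDerivAt_slideInner hB ht h
  have hμ : HasDerivAt (slideCutoff B)
      (deriv Real.smoothTransition (4 * (B + t ^ 2) - 2) * (8 * t)) t := by
    have e1 : HasDerivAt Real.smoothTransition
        (deriv Real.smoothTransition (4 * (B + t ^ 2) - 2)) (4 * (B + t ^ 2) - 2) :=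
      ((Real.smoothTransition.contDiffAt (n := 1)).differentiableAt (by simp)).hasDerivAt
    have e2 : HasDerivAt (fun t : ℝ => 4 * (B + t ^ 2) - 2) (8 * t) t := by
      refine ((((hasDerivAt_pow 2 t).const_add B).const_mul 4).sub_const 2).congr_deriv ?_
      simp; ring
    exact e1.comp t e2
  have hn : 0 ≤ deriv Real.smoothTransition (4 * (B + t ^ 2) - 2) :=
    Real.smoothTransition.monotone.deriv_nonneg
  set D := deriv Real.smoothTransition (4 * (B + t ^ 2) - 2)
  have h0 := slideCutoff_nonneg (B := B) (t := t)
  have h2 := slideCutoff_le_one (B := B) (t := t)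
  have h3 := le_slideInner hB ht h1
  refine ⟨((1 - slideCutoff B t) * d + slideCutoff B t) +
    (D * (8 * (-t))) * (slideInner B t - t), ?_, ?_⟩
  · have h5 : 0 ≤ D * (8 * (-t)) * (slideInner B t - t) :=
      mul_nonneg (mul_nonneg hn (by linarith)) (by linarith)
    have h6 : 0 < (1 - slideCutoff B t) * d + slideCutoff B t := by
      rcases h0.eq_or_lt with h0 | h0
      · rw [← h0]; simpa using hd
      · have := mul_nonneg (sub_nonneg.2 h2) hd.le
        linarith
    linarith
  · refine (((hμ.const_sub 1).mul hdd).add (hμ.mul (hasDerivAt_id t))).congr_deriv ?_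
    simp
    ring

theorem exists_slide_eq {τ : ℝ} (hB : 0 ≤ B) (hτ : τ ≤ 0) (h1 : B + τ ^ 2 < 1)
    (h : 0 < B ∨ τ < 0) :
    ∃ t ≤ 0, B + t ^ 2 < 1 ∧ (0 < B ∨ t < -1 / 2) ∧ slide B t = τ := by
  by_cases h2 : 3 / 4 ≤ B + τ ^ 2
  · refine ⟨τ, hτ, h1, ?_, slide_eq_self h2⟩
    rcases hB.eq_or_lt with rfl | hB
    · right; nlinarith
    · exact Or.inl hB
  push Not at h2
  set t₀ := -√(3 / 4 - B) with ht₀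
  have hB2 : 0 < 3 / 4 - B := by nlinarith [sq_nonneg τ]
  have ht₀' : t₀ < 0 := neg_neg_of_pos (Real.sqrt_pos.2 hB2)
  have ht₀s : B + t₀ ^ 2 = 3 / 4 := by
    rw [ht₀, neg_sq, Real.sq_sqrt hB2.le]; ring
  have hle : t₀ ≤ τ := by nlinarith
  have hs₀ : slide B t₀ = t₀ := slide_eq_self ht₀s.ge
  have hsq : ∀ t, t₀ ≤ t → t ≤ 0 → B + t ^ 2 < 1 := fun t h h' => by nlinarith
  rcases hB.eq_or_lt with rfl | hB'
  · have hτ' : τ < 0 := h.resolve_left (lt_irrefl _)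
    have hh : t₀ ≤ -1 / 2 := by nlinarith
    have hc : ContinuousOn (slide 0) (Icc t₀ (-1 / 2)) := by
      have : ∀ t ∈ Icc t₀ (-1 / 2 : ℝ), 64 * t ≠ 0 := fun t ht => by linarith [ht.2]
      have hm := Real.smoothTransition.continuous
      unfold slide slideInner slideRoot slideCutoff
      fun_prop (disch := assumption)
    have := intermediate_value_Icc hh hc
    rw [hs₀, slide_zero_left_eq_zero le_rfl (by norm_num)] at this
    obtain ⟨t, ht, hts⟩ := this ⟨hle, hτ⟩
    refine ⟨t, by linarith [ht.2], hsq t ht.1 (by linarith [ht.2]), Or.inr ?_, hts⟩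
    refine lt_of_le_of_ne ht.2 ?_
    rintro rfl
    rw [slide_zero_left_eq_zero le_rfl (by norm_num)] at hts
    exact hτ'.ne hts.symm
  · have hc : ContinuousOn (slide B) (Icc t₀ 0) := by
      intro t ht
      obtain ⟨d, -, hd⟩ := exists_hasDerivAt_slide hB ht.2 (Or.inl hB') (hsq t ht.1 ht.2)
      exact hd.continuousAt.continuousWithinAt
    have := intermediate_value_Icc ht₀'.le hc
    rw [hs₀, slide_zero_right] at this
    obtain ⟨t, ht, hts⟩ := this ⟨hle, hτ⟩
    exact ⟨t, ht.2, hsq t ht.1 ht.2, Or.inl hB', hts⟩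

variable {U : Type*} [NormedAddCommGroup U] [InnerProductSpace ℝ U]

theorem contDiffAt_slideRoot {y : U × ℝ} (h : 0 < slideRoot (‖y.1‖ ^ 2) y.2) :
    ContDiffAt ℝ ∞ (fun y : U × ℝ => slideRoot (‖y.1‖ ^ 2) y.2) y := by
  have h0 : ‖y.1‖ ^ 2 * y.2 ^ 2 + (1 + 2 * y.2) ^ 2 ≠ 0 := (Real.sqrt_pos.1 h).ne'
  have h1 : ContDiffAt ℝ ∞ (fun y : U × ℝ => ‖y.1‖ ^ 2) y := (contDiff_fst.norm_sq ℝ).contDiffAt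
  have h2 : ContDiffAt ℝ ∞ (fun y : U × ℝ => y.2) y := contDiffAt_snd
  exact ((h1.mul (h2.pow 2)).add ((contDiffAt_const.add (contDiffAt_const.mul h2)).pow 2)).sqrt h0

theorem contDiffAt_slideInner {y : U × ℝ} (h : y.1 ≠ 0 ∨ y.2 < -1 / 2) :
    ContDiffAt ℝ ∞ (fun y : U × ℝ => slideInner (‖y.1‖ ^ 2) y.2) y := by
  have hR : 0 < slideRoot (‖y.1‖ ^ 2) y.2 := slideRoot_pos (sq_nonneg _)
    (h.imp (fun h => by have := norm_pos_iff.2 h; positivity) id)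
  have hRd := contDiffAt_slideRoot hR
  have h2 : ContDiffAt ℝ ∞ (fun y : U × ℝ => y.2) y := contDiffAt_snd
  have h1 : ContDiffAt ℝ ∞ (fun y : U × ℝ => ‖y.1‖ ^ 2) y := (contDiff_fst.norm_sq ℝ).contDiffAt
  have h3 : ContDiffAt ℝ ∞ (fun y : U × ℝ => 1 + 2 * y.2) y :=
    contDiffAt_const.add (contDiffAt_const.mul h2)
  by_cases ht : y.2 = 0
  · have hpos : 0 < slideRoot (‖y.1‖ ^ 2) y.2 + (1 + 2 * y.2) := by
      rw [ht, slideRoot_zero_right]; norm_num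
    have : ContDiffAt ℝ ∞ (fun y : U × ℝ => ‖y.1‖ ^ 2 * y.2 /
        (64 * (slideRoot (‖y.1‖ ^ 2) y.2 + (1 + 2 * y.2)))) y :=
      (h1.mul h2).div (contDiffAt_const.mul (hRd.add h3)) (by positivity)
    refine this.congr_of_eventuallyEq ?_
    filter_upwards [(hRd.add h3).continuousAt.eventually (lt_mem_nhds hpos)] with y' hy'
      using slideInner_eq (sq_nonneg _) hy'
  · exact (hRd.sub h3).div (contDiffAt_const.mul h2) (by simpa using ht)

theorem contDiffAt_slide {y : U × ℝ} (h : y.1 ≠ 0 ∨ y.2 < -1 / 2) :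
    ContDiffAt ℝ ∞ (fun y : U × ℝ => slide (‖y.1‖ ^ 2) y.2) y := by
  have h1 : ContDiffAt ℝ ∞ (fun y : U × ℝ => ‖y.1‖ ^ 2) y := (contDiff_fst.norm_sq ℝ).contDiffAt
  have h2 : ContDiffAt ℝ ∞ (fun y : U × ℝ => y.2) y := contDiffAt_snd
  have hμ : ContDiffAt ℝ ∞ (fun y : U × ℝ => slideCutoff (‖y.1‖ ^ 2) y.2) y :=
    Real.smoothTransition.contDiff.contDiffAt.comp y
      ((contDiffAt_const.mul (h1.add (h2.pow 2))).sub contDiffAt_const)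
  exact ((contDiffAt_const.sub hμ).mul (contDiffAt_slideInner h)).add (hμ.mul h2)

/-- The slide is a diffeomorphism from the complement of the arc to the complement of the origin. -/
theorem exists_slide_inverse [FiniteDimensional ℝ U] :
    ∃ τ : U × ℝ → ℝ,
      ContDiffOn ℝ ∞ τ {y | ‖y.1‖ ^ 2 + y.2 ^ 2 < 1 ∧ y.2 ≤ 0 ∧ (y.1 ≠ 0 ∨ y.2 < 0)} ∧
      (∀ y, ‖y.1‖ ^ 2 + y.2 ^ 2 < 1 → y.2 ≤ 0 → (y.1 ≠ 0 ∨ y.2 < 0) →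
        ‖y.1‖ ^ 2 + τ y ^ 2 < 1 ∧ τ y ≤ 0 ∧ (y.1 ≠ 0 ∨ τ y < -1 / 2) ∧
          slide (‖y.1‖ ^ 2) (τ y) = y.2) ∧
      (∀ y : U × ℝ, ‖y.1‖ ^ 2 + y.2 ^ 2 < 1 → y.2 ≤ 0 → (y.1 ≠ 0 ∨ y.2 < -1 / 2) →
        τ (y.1, slide (‖y.1‖ ^ 2) y.2) = y.2) := by
  have hiff : ∀ {y : U} {P : Prop}, (y ≠ 0 ∨ P) ↔ (0 < ‖y‖ ^ 2 ∨ P) := fun {y P} => by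
    rw [sq_pos_iff, norm_ne_zero_iff]
  have hex : ∀ y : U × ℝ, ∃ t, ‖y.1‖ ^ 2 + y.2 ^ 2 < 1 → y.2 ≤ 0 → (y.1 ≠ 0 ∨ y.2 < 0) →
      ‖y.1‖ ^ 2 + t ^ 2 < 1 ∧ t ≤ 0 ∧ (y.1 ≠ 0 ∨ t < -1 / 2) ∧ slide (‖y.1‖ ^ 2) t = y.2 := by
    intro y
    by_cases h : ‖y.1‖ ^ 2 + y.2 ^ 2 < 1 ∧ y.2 ≤ 0 ∧ (y.1 ≠ 0 ∨ y.2 < 0)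
    · obtain ⟨t, h1, h2, h3, h4⟩ := exists_slide_eq (sq_nonneg ‖y.1‖) h.2.1 h.1 (hiff.1 h.2.2)
      exact ⟨t, fun _ _ _ => ⟨h2, h1, hiff.2 h3, h4⟩⟩
    · exact ⟨0, fun h1 h2 h3 => absurd ⟨h1, h2, h3⟩ h⟩
  choose τ hτ using hex
  set O : Set (U × ℝ) := {y | ‖y.1‖ ^ 2 + y.2 ^ 2 < 1} ∩ {y | y.1 ≠ 0 ∨ y.2 < -1 / 2} with hO
  have o1 : IsOpen {y : U × ℝ | ‖y.1‖ ^ 2 + y.2 ^ 2 < 1} := isOpen_lt (by fun_prop) (by fun_prop)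
  have o2 : IsOpen {y : U × ℝ | y.1 ≠ 0} := isOpen_ne_fun (by fun_prop) (by fun_prop)
  have o3 : IsOpen {y : U × ℝ | y.2 < -1 / 2} := isOpen_lt (by fun_prop) (by fun_prop)
  have hOo : IsOpen O := o1.inter (o2.union o3)
  have hder : ∀ y ∈ O ∩ {y | y.2 ≤ 0}, ∃ d > 0, HasDerivAt (slide (‖y.1‖ ^ 2)) d y.2 :=
    fun y hy => exists_hasDerivAt_slide (sq_nonneg _) hy.2 (hiff.1 hy.1.2) hy.1.1
  have hmono : ∀ x : U, StrictMonoOn (fun t => slide (‖x‖ ^ 2) t)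
      {t | (x, t) ∈ O ∩ {y | y.2 ≤ 0}} := by
    intro x
    have hcv : Convex ℝ {t | (x, t) ∈ O ∩ {y | y.2 ≤ 0}} := by
      rw [convex_iff_ordConnected]
      refine ⟨fun a ha c hc t ht => ?_⟩
      have a1 : ‖x‖ ^ 2 + a ^ 2 < 1 := ha.1.1
      have c2 : c ≤ 0 := hc.2
      have c3 : x ≠ 0 ∨ c < -1 / 2 := hc.1.2
      refine ⟨⟨?_, ?_⟩, ?_⟩
      · show ‖x‖ ^ 2 + t ^ 2 < 1
        nlinarith [ht.1, ht.2]
      · exact c3.imp id fun h => ht.2.trans_lt h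
      · exact ht.2.trans c2
    refine strictMonoOn_of_deriv_pos hcv ?_ ?_
    · intro t ht
      obtain ⟨d, -, hd⟩ := hder _ ht
      exact hd.continuousAt.continuousWithinAt
    · intro t ht
      have hm : t ∈ {t | (x, t) ∈ O ∩ {y | y.2 ≤ 0}} := interior_subset ht
      obtain ⟨d, hd0, hd⟩ := hder _ hm
      rw [hd.deriv]
      exact hd0
  refine ⟨τ, ?_, hτ, ?_⟩
  · refine contDiffOn_of_fibrewise_inverse hOo (T := fun y => slide (‖y.1‖ ^ 2) y.2)
      (T' := fun y => deriv (slide (‖y.1‖ ^ 2)) y.2) ?_ hmono ?_ ?_ ?_ ?_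
    · exact fun y hy => (contDiffAt_slide hy.1.2).contDiffWithinAt
    · intro y hy
      obtain ⟨d, hd0, hd⟩ := hder _ hy
      rw [hd.deriv]
      exact hd.hasDerivWithinAt
    · intro y hy
      obtain ⟨d, hd0, hd⟩ := hder _ hy
      rw [hd.deriv]
      exact hd0.ne'
    · intro y hy
      obtain ⟨h1, h2, h3, h4⟩ := hτ y hy.1 hy.2.1 hy.2.2
      exact ⟨⟨h1, h3⟩, h2⟩
    · intro y hy
      exact (hτ y hy.1 hy.2.1 hy.2.2).2.2.2
  · intro y h1 h2 h3
    have hB := sq_nonneg ‖y.1‖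
    have m1 := le_slide hB h2 h1
    have m2 := slide_nonpos hB h2
    obtain ⟨h1', h2', h3', h4'⟩ := hτ (y.1, slide (‖y.1‖ ^ 2) y.2) (by simp only; nlinarith) m2 (by
      rcases h3 with h3 | h3
      · exact Or.inl h3
      · by_cases h0 : y.1 = 0
        · right
          simp only [h0, norm_zero, ne_eq, OfNat.ofNat_ne_zero, not_false_eq_true, zero_pow]
          exact slide_zero_left_neg h3
        · exact Or.inl h0)
    have a1 : τ (y.1, slide (‖y.1‖ ^ 2) y.2) ∈ {t | (y.1, t) ∈ O ∩ {y | y.2 ≤ 0}} :=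
      ⟨⟨h1', h3'⟩, h2'⟩
    have a2 : y.2 ∈ {t | (y.1, t) ∈ O ∩ {y | y.2 ≤ 0}} := ⟨⟨h1, h3⟩, h2⟩
    exact (hmono y.1).injOn a1 a2 h4'

end Slide

/-! ### Sliding arcs in a manifold -/

section ArcSlide

variable {p q : ℕ} {E H X : Type*} [NormedAddCommGroup E] [NormedSpace ℝ E] [TopologicalSpace H]
  [TopologicalSpace X] [ChartedSpace H X] {I : ModelWithCorners ℝ E H}

/-- The arcs `{u} × {0} × [-1/2, 0]` in `S^(p-1) × B_-^(q+1)`. -/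
def arcSet (p q : ℕ) : Set (Euc p × EucSucc q) :=
  {w | ‖w.1‖ = 1 ∧ w.2.fst = 0 ∧ -1 / 2 ≤ w.2.snd ∧ w.2.snd ≤ 0}

/-- The slide, fibrewise over `S^(p-1)`. -/
noncomputable def slideMap (w : Euc p × EucSucc q) : Euc p × EucSucc q :=
  (w.1, WithLp.toLp 2 (w.2.fst, slide (‖w.2.fst‖ ^ 2) w.2.snd))

theorem isCompact_arcSet : IsCompact (arcSet p q) := by
  have h1 : Continuous fun y : Euc p × ℝ => ((y.1, WithLp.toLp 2 (0, y.2)) : Euc p × EucSucc q) := by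
    fun_prop
  have := ((isCompact_sphere (0 : Euc p) 1).prod (isCompact_Icc (a := (-1 / 2 : ℝ)) (b := 0))).image
    h1
  convert this using 1
  ext ⟨u, w⟩
  constructor
  · rintro ⟨h1, h2, h3, h4⟩
    refine ⟨(u, w.snd), ⟨mem_sphere_zero_iff_norm.2 h1, h3, h4⟩, ?_⟩
    have h2 : w.fst = 0 := h2
    simp only
    rw [← h2]
    rfl
  · rintro ⟨⟨u', t⟩, ⟨h1, h2⟩, h⟩
    obtain ⟨rfl, rfl⟩ := Prod.mk.inj h
    exact ⟨mem_sphere_zero_iff_norm.1 h1, rfl, h2.1, h2.2⟩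

theorem mem_prod_ball_lowerHalf {w : Euc p × EucSucc q} :
    w ∈ sphere (0 : Euc p) 1 ×ˢ (ball (0 : EucSucc q) 1 ∩ lowerHalf q) ↔
      ‖w.1‖ = 1 ∧ ‖w.2.fst‖ ^ 2 + w.2.snd ^ 2 < 1 ∧ w.2.snd ≤ 0 := by
  rw [mem_prod, mem_sphere_zero_iff_norm, mem_inter_iff, mem_ball_eucSucc]
  rfl

theorem arcSet_subset :
    arcSet p q ⊆ sphere (0 : Euc p) 1 ×ˢ (ball (0 : EucSucc q) 1 ∩ lowerHalf q) := by
  rintro w ⟨h1, h2, h3, h4⟩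
  rw [mem_prod_ball_lowerHalf, h2]
  refine ⟨h1, ?_, h4⟩
  rw [norm_zero]
  nlinarith

theorem notMem_arcSet {w : Euc p × EucSucc q}
    (hw : w ∈ sphere (0 : Euc p) 1 ×ˢ (ball (0 : EucSucc q) 1 ∩ lowerHalf q)) :
    w ∉ arcSet p q ↔ w.2.fst ≠ 0 ∨ w.2.snd < -1 / 2 := by
  rw [mem_prod_ball_lowerHalf] at hw
  constructor
  · intro h
    by_contra! hcon
    exact h ⟨hw.1, hcon.1, hcon.2, hw.2.2⟩
  · rintro h ⟨-, h2, h3, -⟩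
    exact h.elim (fun h => h h2) fun h => by linarith

theorem slideMap_mem {w : Euc p × EucSucc q}
    (hw : w ∈ sphere (0 : Euc p) 1 ×ˢ (ball (0 : EucSucc q) 1 ∩ lowerHalf q)) :
    slideMap w ∈ sphere (0 : Euc p) 1 ×ˢ (ball (0 : EucSucc q) 1 ∩ lowerHalf q) := by
  rw [mem_prod_ball_lowerHalf] at hw ⊢
  obtain ⟨h1, h2, h3⟩ := hw
  have m1 := le_slide (sq_nonneg ‖w.2.fst‖) h3 h2
  have m2 := slide_nonpos (sq_nonneg ‖w.2.fst‖) h3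
  refine ⟨h1, ?_, m2⟩
  show ‖w.2.fst‖ ^ 2 + slide (‖w.2.fst‖ ^ 2) w.2.snd ^ 2 < 1
  nlinarith

theorem slideMap_ne {w : Euc p × EucSucc q} (hw : w.2.fst ≠ 0 ∨ w.2.snd < -1 / 2) :
    (slideMap w).2.fst ≠ 0 ∨ (slideMap w).2.snd < 0 := by
  by_cases h0 : w.2.fst = 0
  · right
    show slide (‖w.2.fst‖ ^ 2) w.2.snd < 0
    rw [h0, norm_zero, zero_pow two_ne_zero]
    exact slide_zero_left_neg (hw.resolve_left fun h => h h0)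
  · exact Or.inl h0

theorem exists_slideMap_inverse : ∃ k : Euc p × EucSucc q → Euc p × EucSucc q,
    ContDiffOn ℝ ∞ k (sphere (0 : Euc p) 1 ×ˢ (ball (0 : EucSucc q) 1 ∩ lowerHalf q) ∩
      {w | w.2.fst ≠ 0 ∨ w.2.snd < 0}) ∧
    (∀ w ∈ sphere (0 : Euc p) 1 ×ˢ (ball (0 : EucSucc q) 1 ∩ lowerHalf q),
      (w.2.fst ≠ 0 ∨ w.2.snd < 0) →
        k w ∈ sphere (0 : Euc p) 1 ×ˢ (ball (0 : EucSucc q) 1 ∩ lowerHalf q) ∧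
        ((k w).2.fst ≠ 0 ∨ (k w).2.snd < -1 / 2) ∧ slideMap (k w) = w) ∧
    (∀ w ∈ sphere (0 : Euc p) 1 ×ˢ (ball (0 : EucSucc q) 1 ∩ lowerHalf q),
      (w.2.fst ≠ 0 ∨ w.2.snd < -1 / 2) → k (slideMap w) = w) := by
  obtain ⟨τ, hτs, hτ, hτl⟩ := exists_slide_inverse (U := Euc q)
  refine ⟨fun w => (w.1, WithLp.toLp 2 (w.2.fst, τ (w.2.fst, w.2.snd))), ?_, ?_, ?_⟩
  · have h1 : ContDiffOn ℝ ∞ (fun w : Euc p × EucSucc q => τ (w.2.fst, w.2.snd))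
        (sphere (0 : Euc p) 1 ×ˢ (ball (0 : EucSucc q) 1 ∩ lowerHalf q) ∩
        {w | w.2.fst ≠ 0 ∨ w.2.snd < 0}) := by
      refine hτs.comp (by fun_prop) fun w hw => ?_
      obtain ⟨-, h2, h3⟩ := mem_prod_ball_lowerHalf.1 hw.1
      exact ⟨h2, h3, hw.2⟩
    have h2 : ContDiffOn ℝ ∞ (fun w : Euc p × EucSucc q => w.2.fst)
        (sphere (0 : Euc p) 1 ×ˢ (ball (0 : EucSucc q) 1 ∩ lowerHalf q) ∩
        {w | w.2.fst ≠ 0 ∨ w.2.snd < 0}) := by fun_prop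
    exact contDiffOn_fst.prodMk ((contDiff_eucSucc_toLp q).comp_contDiffOn (h2.prodMk h1))
  · intro w hw hw0
    obtain ⟨h1, h2, h3⟩ := mem_prod_ball_lowerHalf.1 hw
    obtain ⟨a1, a2, a3, a4⟩ := hτ (w.2.fst, w.2.snd) h2 h3 hw0
    refine ⟨mem_prod_ball_lowerHalf.2 ⟨h1, a1, a2⟩, a3, ?_⟩
    simp only [slideMap, WithLp.toLp_fst, WithLp.toLp_snd, a4]
    rfl
  · intro w hw hw0
    obtain ⟨h1, h2, h3⟩ := mem_prod_ball_lowerHalf.1 hw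
    have := hτl (w.2.fst, w.2.snd) h2 h3 hw0
    simp only [slideMap, WithLp.toLp_fst, WithLp.toLp_snd, this]
    rfl

variable {F : Euc p × EucSucc q → X} {g : X → Euc p × EucSucc q}

/-- The slide in the coordinates `F`, extended by the identity. -/
noncomputable def arcSlide (F : Euc p × EucSucc q → X) (g : X → Euc p × EucSucc q) : X → X :=
  extendById F g (sphere (0 : Euc p) 1 ×ˢ (ball (0 : EucSucc q) 1 ∩ lowerHalf q)) slideMap

theorem arcSlide_apply
    (hg : ∀ w ∈ sphere (0 : Euc p) 1 ×ˢ (ball (0 : EucSucc q) 1 ∩ lowerHalf q), g (F w) = w)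
    {w : Euc p × EucSucc q}
    (hw : w ∈ sphere (0 : Euc p) 1 ×ˢ (ball (0 : EucSucc q) 1 ∩ lowerHalf q)) :
    arcSlide F g (F w) = F (slideMap w) := extendById_apply hg hw

theorem fst_ne_or_snd_neg {w : Euc p × EucSucc q}
    (hF : InjOn F (sphere 0 1 ×ˢ (ball 0 1 ∩ lowerHalf q)))
    (hw : w ∈ sphere (0 : Euc p) 1 ×ˢ (ball (0 : EucSucc q) 1 ∩ lowerHalf q)) :
    F w ∈ (F '' (sphere 0 1 ×ˢ {0}))ᶜ ↔ w.2.fst ≠ 0 ∨ w.2.snd < 0 := by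
  have hw' := mem_prod_ball_lowerHalf.1 hw
  constructor
  · intro h
    by_contra! hcon
    refine h ⟨w, ⟨hw.1, ?_⟩, rfl⟩
    have h2 : w.2.snd = 0 := le_antisymm hw'.2.2 hcon.2
    show w.2 = 0
    rw [← toLp_fst_snd w.2, hcon.1, h2]
    rfl
  · rintro h ⟨⟨u, y⟩, ⟨hu, hy⟩, hF'⟩
    obtain rfl : y = 0 := hy
    have := hF ⟨hu, mem_ball_self one_pos, zero_mem_lowerHalf⟩ hw hF'
    rw [← this] at h
    simp at h

/-- The slide is a diffeomorphism from the complement of the arcs onto the complement of the sphere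
`S^(p-1) × {0}`. -/
theorem isOpenSmoothEmbeddingOn_arcSlide [T2Space X]
    (hF : IsOpenSmoothEmbeddingOn 𝓘(ℝ, Euc p × EucSucc q) I F
      (sphere 0 1 ×ˢ (ball 0 1 ∩ lowerHalf q)))
    (hg : ∀ w ∈ sphere (0 : Euc p) 1 ×ˢ (ball (0 : EucSucc q) 1 ∩ lowerHalf q), g (F w) = w) :
    IsOpenSmoothEmbeddingOn I I (arcSlide F g) (F '' arcSet p q)ᶜ ∧
      arcSlide F g '' (F '' arcSet p q)ᶜ = (F '' (sphere 0 1 ×ˢ {0}))ᶜ := by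
  obtain ⟨k, hks, hk, hkl⟩ := exists_slideMap_inverse (p := p) (q := q)
  set D : Set (Euc p × EucSucc q) := sphere 0 1 ×ˢ (ball 0 1 ∩ lowerHalf q) with hD
  set O : Set (Euc p × EucSucc q) := {w | w.2.fst ≠ 0 ∨ w.2.snd < -1 / 2} with hO
  set O' : Set (Euc p × EucSucc q) := {w | w.2.fst ≠ 0 ∨ w.2.snd < 0} with hO'
  have o1 : IsOpen {w : Euc p × EucSucc q | w.2.fst ≠ 0} :=
    isOpen_ne_fun (by fun_prop) (by fun_prop)
  have o2 : IsOpen {w : Euc p × EucSucc q | w.2.snd < -1 / 2} :=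
    isOpen_lt (by fun_prop) (by fun_prop)
  have o2' : IsOpen {w : Euc p × EucSucc q | w.2.snd < 0} :=
    isOpen_lt (by fun_prop) (by fun_prop)
  have hOo : IsOpen O := o1.union o2
  have hOo' : IsOpen O' := o1.union o2'
  have hinj := hF.injOn
  have harc : ∀ w ∈ D, (F w ∈ (F '' arcSet p q)ᶜ ↔ w ∈ O) := by
    intro w hw
    rw [mem_compl_iff, hinj.mem_image_iff arcSet_subset hw]
    exact notMem_arcSet hw
  -- in the coordinates `F`
  have hs : IsOpenSmoothEmbeddingOn 𝓘(ℝ, Euc p × EucSucc q) I (F ∘ slideMap) (D ∩ O) := by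
    refine hF.comp_of_inverse (k := k) hOo' ?_ hks.contMDiffOn ?_ ?_ ?_ ?_
    · refine ContDiffOn.contMDiffOn ?_
      have : ContDiffOn ℝ ∞ (fun w : Euc p × EucSucc q => slide (‖w.2.fst‖ ^ 2) w.2.snd)
          (D ∩ O) := by
        intro w hw
        have h1 : ContDiffAt ℝ ∞ (fun w : Euc p × EucSucc q => (w.2.fst, w.2.snd)) w := by fun_prop
        exact (ContDiffAt.comp w (contDiffAt_slide (y := (w.2.fst, w.2.snd)) hw.2)
          h1).contDiffWithinAt
      unfold slideMap
      fun_prop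
    · exact fun w hw => ⟨slideMap_mem hw.1, slideMap_ne hw.2⟩
    · exact fun w hw => ⟨(hk w hw.1 hw.2).1, (hk w hw.1 hw.2).2.1⟩
    · exact fun w hw => hkl w hw.1 hw.2
    · exact fun w hw => (hk w hw.1 hw.2).2.2
  have h1 : IsOpenSmoothEmbeddingOn I I (arcSlide F g) ((F '' arcSet p q)ᶜ ∩ F '' D) := by
    have := (hF.inter_open hOo).transition hs (f' := g) fun w hw => hg w hw.1
    have himg : (F '' arcSet p q)ᶜ ∩ F '' D = F '' (D ∩ O) := by
      ext x
      constructor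
      · rintro ⟨hx, w, hw, rfl⟩
        exact ⟨w, ⟨hw, (harc w hw).1 hx⟩, rfl⟩
      · rintro ⟨w, ⟨hw, hwO⟩, rfl⟩
        exact ⟨(harc w hw).2 hwO, w, hw, rfl⟩
    rw [himg]
    refine this.congr ?_
    rintro _ ⟨w, hw, rfl⟩
    rw [arcSlide_apply hg hw.1]
    simp [hg w hw.1]
  -- away from a compact set outside of which the slide is the identity
  set K : Set (Euc p × EucSucc q) := {w | ‖w.1‖ = 1 ∧ ‖w.2.fst‖ ^ 2 + w.2.snd ^ 2 ≤ 3 / 4 ∧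
    w.2.snd ≤ 0} with hK
  have hKD : K ⊆ D := fun w hw => mem_prod_ball_lowerHalf.2
    ⟨hw.1, hw.2.1.trans_lt (by norm_num), hw.2.2⟩
  have hKc : IsCompact K := by
    refine ((isCompact_sphere (0 : Euc p) 1).prod
      (isCompact_closedBall (0 : EucSucc q) 1)).of_isClosed_subset ?_ ?_
    · have c1 : IsClosed {w : Euc p × EucSucc q | ‖w.1‖ = 1} :=
        isClosed_eq (by fun_prop) (by fun_prop)
      have c2 : IsClosed {w : Euc p × EucSucc q | ‖w.2.fst‖ ^ 2 + w.2.snd ^ 2 ≤ 3 / 4} :=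
        isClosed_le (by fun_prop) (by fun_prop)
      have c3 : IsClosed {w : Euc p × EucSucc q | w.2.snd ≤ 0} :=
        isClosed_le (by fun_prop) (by fun_prop)
      exact c1.inter (c2.inter c3)
    · exact fun w hw => ⟨(hKD hw).1, ball_subset_closedBall (hKD hw).2.1⟩
  have hKcl : IsClosed (F '' K) :=
    (hKc.image_of_continuousOn (hF.2.1.continuousOn.mono hKD)).isClosed
  have harccl : IsClosed (F '' arcSet p q) :=
    (isCompact_arcSet.image_of_continuousOn (hF.2.1.continuousOn.mono arcSet_subset)).isClosed
  have h2 : IsOpenSmoothEmbeddingOn I I (arcSlide F g) ((F '' arcSet p q)ᶜ ∩ (F '' K)ᶜ) := by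
    refine (IsOpenSmoothEmbeddingOn.isOpenSmoothEmbeddingOn_id
      (harccl.isOpen_compl.inter hKcl.isOpen_compl)).congr ?_
    rintro x ⟨-, hx⟩
    by_cases hxD : x ∈ F '' D
    · obtain ⟨w, hw, rfl⟩ := hxD
      obtain ⟨a1, a2, a3⟩ := mem_prod_ball_lowerHalf.1 hw
      have hsl : slideMap w = w := by
        unfold slideMap
        rw [slide_eq_self]
        · rfl
        · by_contra! hcon
          exact hx ⟨w, ⟨a1, hcon.le, a3⟩, rfl⟩
      rw [arcSlide_apply hg hw, hsl]
    · exact extendById_of_notMem hxD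
  have hmem : ∀ x, x ∉ F '' D → arcSlide F g x = x := fun x hx => extendById_of_notMem hx
  refine ⟨IsOpenSmoothEmbeddingOn.of_union hF.1 hKcl.isOpen_compl ?_ h1 h2 ?_, ?_⟩
  · intro x _
    by_cases h : x ∈ F '' K
    · exact Or.inl (image_mono hKD h)
    · exact Or.inr h
  · intro x hx y hy hxy
    by_cases hxD : x ∈ F '' D <;> by_cases hyD : y ∈ F '' D
    · exact h1.injOn ⟨hx, hxD⟩ ⟨hy, hyD⟩ hxy
    · obtain ⟨w, hw, rfl⟩ := hxD
      rw [arcSlide_apply hg hw, hmem y hyD] at hxy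
      exact absurd ⟨_, slideMap_mem hw, hxy⟩ hyD
    · obtain ⟨w, hw, rfl⟩ := hyD
      rw [arcSlide_apply hg hw, hmem x hxD] at hxy
      exact absurd ⟨_, slideMap_mem hw, hxy.symm⟩ hxD
    · rwa [hmem x hxD, hmem y hyD] at hxy
  · ext y
    constructor
    · rintro ⟨x, hx, rfl⟩
      by_cases hxD : x ∈ F '' D
      · obtain ⟨w, hw, rfl⟩ := hxD
        rw [arcSlide_apply hg hw, fst_ne_or_snd_neg hinj (slideMap_mem hw)]
        exact slideMap_ne ((harc w hw).1 hx)
      · rw [hmem x hxD]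
        rintro ⟨⟨u, y⟩, ⟨hu, hy⟩, rfl⟩
        obtain rfl : y = 0 := hy
        exact hxD ⟨_, ⟨hu, mem_ball_self one_pos, zero_mem_lowerHalf⟩, rfl⟩
    · intro hy
      by_cases hyD : y ∈ F '' D
      · obtain ⟨w, hw, rfl⟩ := hyD
        obtain ⟨b1, b2, b3⟩ := hk w hw ((fst_ne_or_snd_neg hinj hw).1 hy)
        exact ⟨F (k w), (harc _ b1).2 b2, by rw [arcSlide_apply hg b1, b3]⟩
      · exact ⟨y, fun h => hyD (image_mono arcSet_subset h), hmem y hyD⟩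

end ArcSlide

/-! ### Stereographic coordinates and interior points -/

section Stereo

variable {q : ℕ}

/-- The inverse of the stereographic projection from the pole `(0, ε)`, where `ε = ±1`. -/
noncomputable def stereo (ε : ℝ) (σ : Euc q) : EucSucc q :=
  WithLp.toLp 2 ((2 / (‖σ‖ ^ 2 + 1)) • σ, ε * (‖σ‖ ^ 2 - 1) / (‖σ‖ ^ 2 + 1))

/-- The stereographic projection from the pole `(0, ε)`, where `ε = ±1`. -/
noncomputable def stereoProj (ε : ℝ) (w : EucSucc q) : Euc q := (1 - ε * w.snd)⁻¹ • w.fst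

theorem stereo_contDiff (ε : ℝ) : ContDiff ℝ ∞ (stereo ε : Euc q → EucSucc q) := by
  have h : ContDiff ℝ ∞ (fun σ : Euc q => ‖σ‖ ^ 2) := contDiff_id.norm_sq ℝ
  have h1 : ∀ σ : Euc q, ‖σ‖ ^ 2 + 1 ≠ 0 := fun σ => by positivity
  exact (contDiff_eucSucc_toLp q).comp
    (((contDiff_const.div (h.add contDiff_const) h1).smul contDiff_id).prodMk
      ((contDiff_const.mul (h.sub contDiff_const)).div (h.add contDiff_const) h1))

theorem stereoProj_contDiffOn {ε : ℝ} {s : Set (EucSucc q)} (hs : ∀ w ∈ s, ε * w.snd ≠ 1) :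
    ContDiffOn ℝ ∞ (stereoProj ε : EucSucc q → Euc q) s := by
  have : ∀ w ∈ s, 1 - ε * w.snd ≠ 0 := fun w hw => sub_ne_zero.2 (hs w hw).symm
  unfold stereoProj
  fun_prop (disch := assumption)

theorem one_sub_stereo_snd {ε : ℝ} (hε : ε ^ 2 = 1) (σ : Euc q) :
    1 - ε * (stereo ε σ).snd = 2 / (‖σ‖ ^ 2 + 1) := by
  have h1 : ‖σ‖ ^ 2 + 1 ≠ 0 := by positivity
  simp only [stereo, WithLp.toLp_snd]
  field_simp
  linear_combination (1 - ‖σ‖ ^ 2) * hε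

theorem stereo_mem_sphere {ε : ℝ} (hε : ε ^ 2 = 1) (σ : Euc q) :
    stereo ε σ ∈ sphere (0 : EucSucc q) 1 := by
  have h1 : 0 < ‖σ‖ ^ 2 + 1 := by positivity
  rw [mem_sphere_eucSucc]
  simp only [stereo, WithLp.toLp_snd, WithLp.toLp_fst, norm_smul, mul_pow, div_pow, hε,
    Real.norm_eq_abs, sq_abs]
  field_simp
  ring

theorem stereoProj_stereo {ε : ℝ} (hε : ε ^ 2 = 1) (σ : Euc q) :
    stereoProj ε (stereo ε σ) = σ := by
  have h1 : 0 < ‖σ‖ ^ 2 + 1 := by positivity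
  rw [stereoProj, one_sub_stereo_snd hε]
  simp only [stereo, WithLp.toLp_fst, smul_smul]
  rw [inv_mul_cancel₀ (by positivity), one_smul]

theorem norm_stereoProj {ε : ℝ} (hε : ε ^ 2 = 1) {w : EucSucc q}
    (hw : w ∈ sphere (0 : EucSucc q) 1) (h : ε * w.snd ≠ 1) :
    ‖stereoProj ε w‖ ^ 2 = (1 + ε * w.snd) / (1 - ε * w.snd) := by
  have h1 : 1 - ε * w.snd ≠ 0 := sub_ne_zero.2 h.symm
  rw [mem_sphere_eucSucc] at hw
  rw [stereoProj, norm_smul, mul_pow, Real.norm_eq_abs, sq_abs]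
  field_simp
  linear_combination hw + w.snd ^ 2 * hε

theorem stereo_stereoProj {ε : ℝ} (hε : ε ^ 2 = 1) {w : EucSucc q}
    (hw : w ∈ sphere (0 : EucSucc q) 1) (h : ε * w.snd ≠ 1) :
    stereo ε (stereoProj ε w) = w := by
  have h1 : 1 - ε * w.snd ≠ 0 := sub_ne_zero.2 h.symm
  have h2 : (1 + ε * w.snd) / (1 - ε * w.snd) + 1 = 2 / (1 - ε * w.snd) := by
    field_simp
    ring
  have h3 : (1 + ε * w.snd) / (1 - ε * w.snd) - 1 = 2 * (ε * w.snd) / (1 - ε * w.snd) := by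
    field_simp
    ring
  rw [stereo, norm_stereoProj hε hw h, h2, h3]
  have h4 : (2 / (2 / (1 - ε * w.snd))) = 1 - ε * w.snd := by field_simp
  have h5 : ε * (2 * (ε * w.snd) / (1 - ε * w.snd)) / (2 / (1 - ε * w.snd)) = w.snd := by
    field_simp
    linear_combination w.snd * hε
  rw [h4, h5, stereoProj, smul_smul, mul_inv_cancel₀ h1, one_smul]
  rfl

variable {V E H X : Type*} [NormedAddCommGroup V] [InnerProductSpace ℝ V]
  [NormedAddCommGroup E] [NormedSpace ℝ E] [TopologicalSpace H]
  [TopologicalSpace X] [ChartedSpace H X] {I : ModelWithCorners ℝ E H}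

/-- The image of an embedding of a product of a ball and an open part of a sphere consists of
interior points. -/
theorem IsOpenSmoothEmbeddingOn.isInteriorPoint_of_sphere {b : V × EucSucc q → X}
    {D : Set (V × EucSucc q)} (hb : IsOpenSmoothEmbeddingOn 𝓘(ℝ, V × EucSucc q) I b D)
    {O : Set (EucSucc q)} (hO : IsOpen O)
    (hD : D ∩ {x | x.2 ∈ O} = ball 0 1 ×ˢ (sphere 0 1 ∩ O)) {ε : ℝ} (hε : ε ^ 2 = 1)
    (hεO : ∀ w ∈ sphere (0 : EucSucc q) 1 ∩ O, ε * w.snd ≠ 1) {x : V × EucSucc q}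
    (hx : x ∈ ball (0 : V) 1 ×ˢ (sphere (0 : EucSucc q) 1 ∩ O)) : I.IsInteriorPoint (b x) := by
  have hOo : IsOpen {x : V × EucSucc q | x.2 ∈ O} := hO.preimage continuous_snd
  have h : ContDiff ℝ ∞ (fun y : V × Euc q => (y.1, stereo ε y.2)) :=
    contDiff_fst.prodMk ((stereo_contDiff ε).comp contDiff_snd)
  have hk : ContDiffOn ℝ ∞ (fun x : V × EucSucc q => (x.1, stereoProj ε x.2))
      (D ∩ {x | x.2 ∈ O}) := by
    rw [hD]
    exact contDiffOn_fst.prodMk ((stereoProj_contDiffOn hεO).comp contDiffOn_snd fun x hx => hx.2)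
  have hs : IsOpen {y : V × Euc q | y.1 ∈ ball (0 : V) 1 ∧ stereo ε y.2 ∈ O} :=
    (isOpen_ball.preimage continuous_fst).inter
      (hO.preimage ((stereo_contDiff ε).continuous.comp continuous_snd))
  have he := hb.comp_of_inverse (h := fun y : V × Euc q => (y.1, stereo ε y.2))
    (k := fun x => (x.1, stereoProj ε x.2))
    (s := {y : V × Euc q | y.1 ∈ ball (0 : V) 1 ∧ stereo ε y.2 ∈ O}) hOo
    h.contDiffOn.contMDiffOn hk.contMDiffOn
    (by
      rw [hD]
      exact fun y hy => ⟨hy.1, stereo_mem_sphere hε _, hy.2⟩)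
    (by
      rw [hD]
      rintro x ⟨hx, hx'⟩
      refine ⟨hx, ?_⟩
      show stereo ε (stereoProj ε x.2) ∈ O
      rw [stereo_stereoProj hε hx'.1 (hεO _ hx')]
      exact hx'.2)
    (fun y _ => by simp only [stereoProj_stereo hε])
    (by
      rw [hD]
      rintro x ⟨hx, hx'⟩
      simp only [stereo_stereoProj hε hx'.1 (hεO _ hx')])
  have hxs : stereo ε (stereoProj ε x.2) = x.2 := stereo_stereoProj hε hx.2.1 (hεO _ hx.2)
  have := (he.isInteriorPoint_iff hs (x := (x.1, stereoProj ε x.2))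
    ⟨hx.1, by rw [hxs]; exact hx.2.2⟩).2 BoundarylessManifold.isInteriorPoint
  simpa only [Function.comp, hxs] using this

/-- The image of an embedding of the product of a ball and a sphere consists of interior points. -/
theorem IsOpenSmoothEmbeddingOn.isInteriorPoint_of_ball_prod_sphere {b : V × EucSucc q → X}
    (hb : IsOpenSmoothEmbeddingOn 𝓘(ℝ, V × EucSucc q) I b (ball 0 1 ×ˢ sphere 0 1))
    {x : V × EucSucc q} (hx : x ∈ ball (0 : V) 1 ×ˢ sphere (0 : EucSucc q) 1) :
    I.IsInteriorPoint (b x) := by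
  by_cases h : x.2.snd < 1
  · refine hb.isInteriorPoint_of_sphere (O := {w | w.snd < 1}) (ε := 1)
      (isOpen_lt (by fun_prop) (by fun_prop)) ?_ (by norm_num) ?_ ⟨hx.1, hx.2, h⟩
    · ext; simp [and_assoc]
    · exact fun w hw => by rw [one_mul]; exact hw.2.ne
  · refine hb.isInteriorPoint_of_sphere (O := {w | -1 < w.snd}) (ε := -1)
      (isOpen_lt (by fun_prop) (by fun_prop)) ?_ (by norm_num) ?_ ⟨hx.1, hx.2, ?_⟩
    · ext; simp [and_assoc]
    · intro w hw h
      have : -1 < w.snd := hw.2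
      linarith
    · show -1 < x.2.snd
      linarith

end Stereo

/-! ### Coordinates for the dual surgery -/

section DualCoordinates

variable {p q : ℕ} {E H X : Type*} [NormedAddCommGroup E] [NormedSpace ℝ E] [TopologicalSpace H]
  [TopologicalSpace X] [ChartedSpace H X]
  {E' H' Y : Type*} [NormedAddCommGroup E'] [NormedSpace ℝ E'] [TopologicalSpace H']
  [TopologicalSpace Y] [ChartedSpace H' Y]
  {E'' H'' Z : Type*} [NormedAddCommGroup E''] [NormedSpace ℝ E''] [TopologicalSpace H'']
  [TopologicalSpace Z] [ChartedSpace H'' Z]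
  {I : ModelWithCorners ℝ E H} {J : ModelWithCorners ℝ E' H'} {J' : ModelWithCorners ℝ E'' H''}
  {F : Euc p × EucSucc q → X} {a₁ : X → Y} {b₁ : Euc p × EucSucc q → Y}
  {a₂ : Y → Z} {b₂ : Euc q × EucSucc p → Z}

/-- The slope of the slide: near the arc, `slide B t = B * slideSlope B t`. It extends smoothly to
`B = 0` for `-1 / 2 < t`, where it tends to `-∞` as `t` tends to `-1 / 2`. -/
noncomputable def slideSlope (B t : ℝ) : ℝ := t / (64 * (slideRoot B t + (1 + 2 * t)))

/-- A neighbourhood of the half-open arcs `{u} × {0} × (-1/2, 0]`. -/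
def arcNeighbourhood (p q : ℕ) : Set (Euc p × EucSucc q) :=
  {w | ‖w.1‖ = 1 ∧ ‖w.2.fst‖ ^ 2 < 1 / 4 ∧ -1 / 2 < w.2.snd ∧ w.2.snd ≤ 0}

/-- The coordinate change `(u, (y, t)) ↦ (u, (y, slideSlope (‖y‖ ^ 2) t))`. -/
noncomputable def slopeMap (w : Euc p × EucSucc q) : Euc p × EucSucc q :=
  (w.1, WithLp.toLp 2 (w.2.fst, slideSlope (‖w.2.fst‖ ^ 2) w.2.snd))

/-- The inverse of `slopeMap`. -/
noncomputable def slopeMapInv (w : Euc p × EucSucc q) : Euc p × EucSucc q :=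
  (w.1, WithLp.toLp 2 (w.2.fst,
    128 * w.2.snd / (1 - 256 * w.2.snd - 4096 * ‖w.2.fst‖ ^ 2 * w.2.snd ^ 2)))

theorem slideRoot_add_pos {B t : ℝ} (ht : -1 / 2 < t) :
    0 < slideRoot B t + (1 + 2 * t) := by
  have := slideRoot_nonneg (B := B) (t := t)
  linarith

theorem slide_eq_mul_slope {B t : ℝ} (hB : 0 ≤ B) (hB' : B < 1 / 4) (ht : -1 / 2 < t)
    (ht0 : t ≤ 0) : slide B t = B * slideSlope B t := by
  rw [slide_eq_inner (by nlinarith), slideInner_eq hB (slideRoot_add_pos ht), slideSlope,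
    mul_div_assoc]

theorem mul_slideSlope_sq_lt {B t : ℝ} (hB : 0 ≤ B) (ht : -1 / 2 < t) :
    4096 * B * slideSlope B t ^ 2 < 1 := by
  have h1 := slideRoot_add_pos (B := B) ht
  have h2 := slideRoot_sq hB t
  have e : 4096 * B * slideSlope B t ^ 2 = B * t ^ 2 / (slideRoot B t + (1 + 2 * t)) ^ 2 := by
    rw [slideSlope]
    generalize slideRoot B t + (1 + 2 * t) = S at h1
    field_simp
    ring
  rw [e, div_lt_one (by positivity)]
  nlinarith [slideRoot_nonneg (B := B) (t := t)]

theorem slideSlope_nonpos {B t : ℝ} (ht : -1 / 2 < t) (ht0 : t ≤ 0) :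
    slideSlope B t ≤ 0 :=
  div_nonpos_of_nonpos_of_nonneg ht0 (by have := slideRoot_add_pos (B := B) ht; positivity)

theorem slideSlope_inverse {B t : ℝ} (hB : 0 ≤ B) (ht : -1 / 2 < t) :
    128 * slideSlope B t / (1 - 256 * slideSlope B t - 4096 * B * slideSlope B t ^ 2) = t := by
  have h1 := slideRoot_add_pos (B := B) ht
  have h2 := slideRoot_sq hB t
  have e : 1 - 256 * slideSlope B t - 4096 * B * slideSlope B t ^ 2
      = 2 / (slideRoot B t + (1 + 2 * t)) := by
    obtain ⟨S, hS⟩ : ∃ S, S = slideRoot B t + (1 + 2 * t) := ⟨_, rfl⟩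
    have hR : slideRoot B t = S - (1 + 2 * t) := by rw [hS]; ring
    rw [slideSlope, ← hS]
    rw [← hS] at h1
    rw [hR] at h2
    field_simp
    linear_combination 4096 * h2
  rw [e, slideSlope]
  generalize slideRoot B t + (1 + 2 * t) = S at h1
  field_simp
  ring

theorem slideSlope_of_inverse {B τ : ℝ} (hB : 0 ≤ B) (hτ : τ ≤ 0) (h : 4096 * B * τ ^ 2 < 1) :
    -1 / 2 < 128 * τ / (1 - 256 * τ - 4096 * B * τ ^ 2) ∧
    128 * τ / (1 - 256 * τ - 4096 * B * τ ^ 2) ≤ 0 ∧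
    slideSlope B (128 * τ / (1 - 256 * τ - 4096 * B * τ ^ 2)) = τ := by
  have hD : 0 < 1 - 256 * τ - 4096 * B * τ ^ 2 := by linarith
  set D := 1 - 256 * τ - 4096 * B * τ ^ 2 with hDdef
  refine ⟨?_, div_nonpos_of_nonpos_of_nonneg (by linarith) hD.le, ?_⟩
  · rw [lt_div_iff₀ hD]
    linarith
  · have e1 : slideRoot B (128 * τ / D) = (1 + 4096 * B * τ ^ 2) / D := by
      have hn : 0 ≤ (1 + 4096 * B * τ ^ 2) / D := by positivity
      rw [slideRoot, Real.sqrt_eq_iff_mul_self_eq (by positivity) hn]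
      field_simp
      rw [hDdef]
      ring
    have e2 : (1 + 4096 * B * τ ^ 2) / D + (1 + 2 * (128 * τ / D)) = 2 / D := by
      field_simp
      rw [hDdef]
      ring
    rw [slideSlope, e1, e2]
    field_simp
    ring

theorem slopeMap_mem {w : Euc p × EucSucc q} (hw : w ∈ arcNeighbourhood p q) :
    slopeMap w ∈ handleCollarDomain p q := by
  obtain ⟨h1, h2, h3, h4⟩ := hw
  have a1 := mul_slideSlope_sq_lt (sq_nonneg ‖w.2.fst‖) h3
  refine ⟨h1, ?_, slideSlope_nonpos h3 h4⟩
  show (1 + slideSlope (‖w.2.fst‖ ^ 2) w.2.snd ^ 2) * ‖w.2.fst‖ ^ 2 < 1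
  linarith

theorem isOpenSmoothEmbeddingOn_slope
    (hb : IsOpenSmoothEmbeddingOn 𝓘(ℝ, Euc p × EucSucc q) I F (handleCollarDomain p q)) :
    IsOpenSmoothEmbeddingOn 𝓘(ℝ, Euc p × EucSucc q) I (F ∘ slopeMap) (arcNeighbourhood p q) := by
  have o1 : IsOpen {w : Euc p × EucSucc q | ‖w.2.fst‖ ^ 2 < 1 / 4} :=
    isOpen_lt (by fun_prop) (by fun_prop)
  have o2 : IsOpen {w : Euc p × EucSucc q | 4096 * ‖w.2.fst‖ ^ 2 * w.2.snd ^ 2 < 1} :=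
    isOpen_lt (by fun_prop) (by fun_prop)
  refine hb.comp_of_inverse (k := slopeMapInv) (o1.inter o2) ?_ ?_ ?_ ?_ ?_ ?_
  · refine ContDiffOn.contMDiffOn ?_
    have h1 : ContDiffOn ℝ ∞ (fun w : Euc p × EucSucc q => slideRoot (‖w.2.fst‖ ^ 2) w.2.snd)
        (arcNeighbourhood p q) := by
      intro w hw
      have h1 : ContDiffAt ℝ ∞ (fun w : Euc p × EucSucc q => (w.2.fst, w.2.snd)) w := by fun_prop
      have h2 : 0 < slideRoot (‖w.2.fst‖ ^ 2) w.2.snd := by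
        have := (le_abs_self _).trans (abs_le_slideRoot (sq_nonneg ‖w.2.fst‖) w.2.snd)
        linarith [hw.2.2.1]
      exact (ContDiffAt.comp w (contDiffAt_slideRoot (y := (w.2.fst, w.2.snd)) h2)
        h1).contDiffWithinAt
    have h2 : ContDiffOn ℝ ∞ (fun w : Euc p × EucSucc q => w.2.snd) (arcNeighbourhood p q) := by
      fun_prop
    have h3 : ContDiffOn ℝ ∞ (fun w : Euc p × EucSucc q => w.2.fst) (arcNeighbourhood p q) := by
      fun_prop
    have h4 : ContDiffOn ℝ ∞ (fun w : Euc p × EucSucc q => slideSlope (‖w.2.fst‖ ^ 2) w.2.snd)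
        (arcNeighbourhood p q) := by
      refine h2.div (contDiffOn_const.mul
        (h1.add (contDiffOn_const.add (contDiffOn_const.mul h2)))) fun w hw => ?_
      have := slideRoot_add_pos (B := ‖w.2.fst‖ ^ 2) hw.2.2.1
      positivity
    exact contDiffOn_fst.prodMk ((contDiff_eucSucc_toLp q).comp_contDiffOn (h3.prodMk h4))
  · refine ContDiffOn.contMDiffOn ?_
    have h0 : ∀ w ∈ handleCollarDomain p q ∩ ({w | ‖w.2.fst‖ ^ 2 < 1 / 4} ∩
        {w | 4096 * ‖w.2.fst‖ ^ 2 * w.2.snd ^ 2 < 1}),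
        1 - 256 * w.2.snd - 4096 * ‖w.2.fst‖ ^ 2 * w.2.snd ^ 2 ≠ 0 := by
      rintro w ⟨⟨-, -, h1⟩, -, h2⟩
      have h2 : 4096 * ‖w.2.fst‖ ^ 2 * w.2.snd ^ 2 < 1 := h2
      have : 0 < 1 - 256 * w.2.snd - 4096 * ‖w.2.fst‖ ^ 2 * w.2.snd ^ 2 := by linarith
      exact this.ne'
    unfold slopeMapInv
    fun_prop (disch := assumption)
  · exact fun w hw => ⟨slopeMap_mem hw, hw.2.1,
      mul_slideSlope_sq_lt (sq_nonneg ‖w.2.fst‖) hw.2.2.1⟩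
  · rintro w ⟨⟨h1, -, h2⟩, h3, h4⟩
    obtain ⟨a1, a2, -⟩ := slideSlope_of_inverse (sq_nonneg ‖w.2.fst‖) h2 h4
    exact ⟨h1, h3, a1, a2⟩
  · intro w hw
    have := slideSlope_inverse (sq_nonneg ‖w.2.fst‖) hw.2.2.1
    simp only [slopeMap, slopeMapInv, WithLp.toLp_fst, WithLp.toLp_snd, this]
    rfl
  · rintro w ⟨⟨h1, -, h2⟩, h3, h4⟩
    obtain ⟨-, -, a3⟩ := slideSlope_of_inverse (sq_nonneg ‖w.2.fst‖) h2 h4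
    simp only [slopeMap, slopeMapInv, WithLp.toLp_fst, WithLp.toLp_snd, a3]
    rfl

/-- The second handle in the coordinates of the complement of the first surgery. The point
`(u, (y, τ))` of the collar lies in the first handle, and the gluing relation of the first
attachment turns the height `τ` into `‖y‖² τ`. -/
theorem old_old_eq_new (h₁ : IsSurgeryAlong I J (lowerHalf q) F a₁ b₁)
    (h₂ : IsSurgeryAlong J J' (lowerHalf p) (b₁ ∘ handleCollar) a₂ b₂)
    {u : Euc p} (hu : ‖u‖ = 1) {y : Euc q} (hy : y ≠ 0) {τ : ℝ} (hτ : τ ≤ 0)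
    (hyτ : (1 + τ ^ 2) * ‖y‖ ^ 2 < 1) :
    a₂ (a₁ (F (u, WithLp.toLp 2 (y, ‖y‖ ^ 2 * τ)))) =
      b₂ (handleCollar (u, WithLp.toLp 2 (y, τ))) := by
  have hy0 : 0 < ‖y‖ := norm_pos_iff.2 hy
  have hv1 : ‖‖y‖⁻¹ • y‖ = 1 := by simp [norm_smul, hy0.ne']
  have hvy : ‖y‖ • ‖y‖⁻¹ • y = y := by rw [smul_smul, mul_inv_cancel₀ hy0.ne', one_smul]
  have hms : √(1 + τ ^ 2) ^ 2 = 1 + τ ^ 2 := Real.sq_sqrt (by positivity)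
  have hm0 : 0 < √(1 + τ ^ 2) := Real.sqrt_pos.2 (by positivity)
  have hNs : √(1 + (‖y‖ * τ) ^ 2) ^ 2 = 1 + (‖y‖ * τ) ^ 2 := Real.sq_sqrt (by positivity)
  have hN0 : 0 < √(1 + (‖y‖ * τ) ^ 2) := Real.sqrt_pos.2 (by positivity)
  set v := ‖y‖⁻¹ • y with hv
  set m := √(1 + τ ^ 2)
  set N := √(1 + (‖y‖ * τ) ^ 2) with hN
  have e1 : handleCollar (u, WithLp.toLp 2 (y, τ))
      = ((‖y‖ * m) • v, m⁻¹ • (WithLp.toLp 2 (u, τ) : EucSucc p)) := by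
    rw [mul_comm, mul_smul, hvy]
    rfl
  have e2 : handleCollar (v, (‖y‖ * m) • m⁻¹ • (WithLp.toLp 2 (u, τ) : EucSucc p))
      = ((‖y‖ * N) • u, N⁻¹ • (WithLp.toLp 2 (v, ‖y‖ * τ) : EucSucc q)) := by
    rw [smul_smul, mul_assoc, mul_inv_cancel₀ hm0.ne', mul_one, mul_comm ‖y‖ N, mul_smul]
    rfl
  have e3 : (WithLp.toLp 2 (y, ‖y‖ ^ 2 * τ) : EucSucc q)
      = (‖y‖ * N) • N⁻¹ • WithLp.toLp 2 (v, ‖y‖ * τ) := by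
    rw [smul_smul, mul_assoc, mul_inv_cancel₀ hN0.ne', mul_one, ← WithLp.toLp_smul,
      Prod.smul_mk, hvy, smul_eq_mul, sq, mul_assoc]
  have hw' : m⁻¹ • (WithLp.toLp 2 (u, τ) : EucSucc p) ∈ sphere 0 1 ∩ lowerHalf p := by
    refine ⟨?_, smul_mem_lowerHalf _ (by positivity) _ hτ⟩
    rw [mem_sphere_eucSucc, WithLp.smul_fst, WithLp.smul_snd, WithLp.toLp_fst, WithLp.toLp_snd,
      norm_smul, hu, mul_one, Real.norm_eq_abs, sq_abs, smul_eq_mul, mul_pow, inv_pow, hms]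
    field_simp
  have hw : N⁻¹ • (WithLp.toLp 2 (v, ‖y‖ * τ) : EucSucc q) ∈ sphere 0 1 ∩ lowerHalf q := by
    refine ⟨?_, smul_mem_lowerHalf _ (by positivity) _
      (mul_nonpos_of_nonneg_of_nonpos hy0.le hτ)⟩
    rw [mem_sphere_eucSucc, WithLp.smul_fst, WithLp.smul_snd, WithLp.toLp_fst, WithLp.toLp_snd,
      norm_smul, hv1, mul_one, Real.norm_eq_abs, sq_abs, smul_eq_mul, mul_pow, inv_pow, hNs]
    field_simp
  have hθ : ‖y‖ * m ∈ Ioo (0 : ℝ) 1 := by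
    refine ⟨by positivity, ?_⟩
    rw [← sq_lt_one_iff₀ (by positivity), mul_pow, hms]
    linarith
  have hρ : ‖y‖ * N ∈ Ioo (0 : ℝ) 1 := by
    refine ⟨by positivity, ?_⟩
    rw [← sq_lt_one_iff₀ (by positivity), mul_pow, hNs]
    have : ‖y‖ ^ 2 < 1 := by nlinarith [mul_nonneg (sq_nonneg τ) (sq_nonneg ‖y‖)]
    nlinarith [mul_nonneg (sq_nonneg τ) (sq_nonneg ‖y‖)]
  rw [e1, h₂.new_eq_old smul_mem_lowerHalf zero_mem_lowerHalf hv1 hθ hw', Function.comp_apply, e2,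
    e3, h₁.new_eq_old smul_mem_lowerHalf zero_mem_lowerHalf hu hρ hw]

/-- The normalizing factor in `lowerChart`. -/
noncomputable def lowerRoot (w : EucSucc q) : ℝ := √(‖w.fst‖ ^ 2 + ((1 - w.snd) / 64) ^ 2)

/-- The normalizing factor in `upperChart`. -/
noncomputable def upperRoot (x : Euc p × EucSucc q) : ℝ :=
  √(‖x.1‖ ^ 2 / 16 + (1 / (64 * (1 + x.2.snd))) ^ 2)

/-- A parametrization of an open part of the first handle by `B^p × S^q`, without the pole
`(0, 1)` of `S^q`. -/
noncomputable def lowerChart (x : Euc p × EucSucc q) : Euc p × EucSucc q :=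
  ((lowerRoot x.2 / 4) • x.1,
    (lowerRoot x.2)⁻¹ • WithLp.toLp 2 (x.2.fst, -(1 - x.2.snd) / 64))

/-- A parametrization of an open part of the second handle by `B^p × {w ∈ S^q | 0 < w_(q+1)}`. -/
noncomputable def upperChart (x : Euc p × EucSucc q) : Euc q × EucSucc p :=
  (upperRoot x • x.2.fst,
    (upperRoot x)⁻¹ • WithLp.toLp 2 ((1 / 4 : ℝ) • x.1, -(1 / (64 * (1 + x.2.snd)))))

/-- The inverse of `lowerChart`. -/
noncomputable def lowerChartInv (x : Euc p × EucSucc q) : Euc p × EucSucc q :=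
  ((4 * ((1 - (stereo 1 ((-(64 * x.2.snd))⁻¹ • x.2.fst)).snd) / (-(64 * x.2.snd)))⁻¹) • x.1,
    stereo 1 ((-(64 * x.2.snd))⁻¹ • x.2.fst))

/-- The inverse of `upperChart`. -/
noncomputable def upperChartInv (x : Euc q × EucSucc p) : Euc p × EucSucc q :=
  ((4 * ((1 + (stereo (-1) (-(64 * x.2.snd) • x.1)).snd) * (-(64 * x.2.snd)))⁻¹) • x.2.fst,
    stereo (-1) (-(64 * x.2.snd) • x.1))

theorem lowerRoot_sq (w : EucSucc q) :
    lowerRoot w ^ 2 = ‖w.fst‖ ^ 2 + ((1 - w.snd) / 64) ^ 2 :=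
  Real.sq_sqrt (by positivity)

theorem snd_lt_one {w : EucSucc q} (hw : w ∈ sphere (0 : EucSucc q) 1)
    (hw1 : w ≠ WithLp.toLp 2 (0, 1)) : w.snd < 1 := by
  rw [mem_sphere_eucSucc] at hw
  by_contra! h
  have h1 : w.snd = 1 := by nlinarith [sq_nonneg ‖w.fst‖]
  have h2 : w.fst = 0 := by
    have : ‖w.fst‖ ^ 2 = 0 := by rw [h1] at hw; linarith
    simpa using this
  exact hw1 (by rw [← toLp_fst_snd w, h1, h2])

/-- The source of `lowerChart`. -/
def lowerChartSource (p q : ℕ) : Set (Euc p × EucSucc q) :=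
  ball 0 1 ×ˢ sphere 0 1 ∩ {x | x.2 ≠ WithLp.toLp 2 (0, 1)}

/-- The target of `lowerChart`, as an open part of the first handle. -/
def lowerChartTarget (p q : ℕ) : Set (Euc p × EucSucc q) :=
  {x | x.2.snd < 0 ∧ ‖x.1‖ * (‖x.2.fst‖ ^ 2 + 4096 * x.2.snd ^ 2) < -(32 * x.2.snd)}

theorem lowerRoot_pos {w : EucSucc q} (hw : w.snd < 1) : 0 < lowerRoot w := by
  have : 0 < (1 - w.snd) / 64 := by linarith
  exact Real.sqrt_pos.2 (by positivity)

theorem lowerChart_contDiffOn :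
    ContDiffOn ℝ ∞ (lowerChart : Euc p × EucSucc q → _) (lowerChartSource p q) := by
  have h1 : ∀ x ∈ lowerChartSource p q, lowerRoot x.2 ≠ 0 := fun x hx =>
    (lowerRoot_pos (snd_lt_one hx.1.2 hx.2)).ne'
  have h0 : ∀ x ∈ lowerChartSource p q,
      ‖x.2.fst‖ ^ 2 + ((1 - x.2.snd) / 64) ^ 2 ≠ 0 := fun x hx =>
    (Real.sqrt_pos.1 (lowerRoot_pos (snd_lt_one hx.1.2 hx.2))).ne'
  have e1 : ContDiffOn ℝ ∞ (fun x : Euc p × EucSucc q => x.2.fst) (lowerChartSource p q) := by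
    fun_prop
  have e2 : ContDiffOn ℝ ∞ (fun x : Euc p × EucSucc q => x.2.snd) (lowerChartSource p q) := by
    fun_prop
  have e3 : ContDiffOn ℝ ∞ (fun x : Euc p × EucSucc q => lowerRoot x.2) (lowerChartSource p q) :=
    ((e1.norm_sq ℝ).add (((contDiffOn_const (c := (1 : ℝ))).sub e2).div_const 64 |>.pow 2)).sqrt h0
  refine ((e3.div_const 4).smul contDiffOn_fst).prodMk ((e3.inv h1).smul
    ((contDiff_eucSucc_toLp q).comp_contDiffOn (e1.prodMk ?_)))
  exact ((contDiffOn_const.sub e2).neg).div_const 64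

theorem stereo_one_snd_pos (σ : Euc q) : 0 < 1 - (stereo 1 σ).snd := by
  have := one_sub_stereo_snd (one_pow 2) σ
  rw [one_mul] at this
  rw [this]
  positivity

theorem lowerChartInv_contDiffOn :
    ContDiffOn ℝ ∞ (lowerChartInv : Euc p × EucSucc q → _) (lowerChartTarget p q) := by
  have hD : ∀ x ∈ lowerChartTarget p q, -(64 * x.2.snd) ≠ 0 := fun x hx => by
    have : x.2.snd < 0 := hx.1
    exact (show 0 < -(64 * x.2.snd) by linarith).ne'
  have e1 : ContDiffOn ℝ ∞ (fun x : Euc p × EucSucc q => x.2.fst) (lowerChartTarget p q) := by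
    fun_prop
  have e2 : ContDiffOn ℝ ∞ (fun x : Euc p × EucSucc q => x.2.snd) (lowerChartTarget p q) := by
    fun_prop
  have e4 : ContDiffOn ℝ ∞ (fun x : Euc p × EucSucc q => -(64 * x.2.snd))
      (lowerChartTarget p q) := (contDiffOn_const.mul e2).neg
  have h1 := (stereo_contDiff 1).comp_contDiffOn ((e4.inv hD).smul e1)
  have h3 := (contDiff_eucSucc_snd q).comp_contDiffOn h1
  refine (ContDiffOn.smul (contDiffOn_const.mul (ContDiffOn.inv
    ((contDiffOn_const.sub h3).div e4 hD) fun x hx => ?_)) contDiffOn_fst).prodMk h1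
  exact div_ne_zero (stereo_one_snd_pos _).ne' (hD x hx)

theorem lowerChart_mem {x : Euc p × EucSucc q} (hx : x ∈ lowerChartSource p q) :
    lowerChart x ∈ ball (0 : Euc p) 1 ×ˢ (sphere (0 : EucSucc q) 1 ∩ lowerHalf q) ∩
      lowerChartTarget p q := by
  obtain ⟨z, w⟩ := x
  have ht : w.snd < 1 := snd_lt_one hx.1.2 hx.2
  have hs : ‖w.fst‖ ^ 2 + w.snd ^ 2 = 1 := mem_sphere_eucSucc.1 hx.1.2
  have hz : ‖z‖ < 1 := mem_ball_zero_iff.1 hx.1.1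
  have hrs := lowerRoot_sq w
  have hn0 := lowerRoot_pos ht
  have e1 : (lowerChart (z, w)).1 = (lowerRoot w / 4) • z := rfl
  have e2 : (lowerChart (z, w)).2.fst =
    (lowerRoot w)⁻¹ • w.fst := rfl
  have e3 : (lowerChart (z, w)).2.snd =
    (lowerRoot w)⁻¹ * (-(1 - w.snd) / 64) := rfl
  generalize lowerRoot w = n at hrs hn0 e1 e2 e3
  have hneg : (lowerChart (z, w)).2.snd < 0 := by
    rw [e3]
    exact mul_neg_of_pos_of_neg (by positivity) (by linarith)
  have hZ : ‖(lowerChart (z, w)).1‖ = n / 4 * ‖z‖ := by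
    rw [e1, norm_smul, Real.norm_of_nonneg (by positivity)]
  have hx2 : ‖n⁻¹ • w.fst‖ ^ 2 = (n ^ 2)⁻¹ * ‖w.fst‖ ^ 2 := by
    rw [norm_smul, mul_pow, Real.norm_eq_abs, sq_abs, inv_pow]
  refine ⟨⟨?_, ?_, hneg.le⟩, hneg, ?_⟩
  · rw [mem_ball_zero_iff, hZ]
    have h1 : -1 ≤ w.snd := by nlinarith [sq_nonneg ‖w.fst‖]
    have : n < 2 := by nlinarith [sq_nonneg ‖w.fst‖, sq_nonneg w.snd]
    nlinarith
  · have h1 : ‖w.fst‖ ^ 2 + (-(1 - w.snd) / 64) ^ 2 = n ^ 2 := by rw [hrs]; ring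
    rw [mem_sphere_eucSucc, e2, e3, hx2, mul_pow, inv_pow, ← mul_add, h1,
      inv_mul_cancel₀ (by positivity)]
  · rw [hZ, e2, e3, hx2]
    have h5 : n / 4 * ‖z‖ * ((n ^ 2)⁻¹ * ‖w.fst‖ ^ 2 +
        4096 * (n⁻¹ * (-(1 - w.snd) / 64)) ^ 2) = ‖z‖ * ((1 - w.snd) / (2 * n)) := by
      field_simp
      linear_combination (8192 * ‖z‖) * hs
    have h6 : -(32 * (n⁻¹ * (-(1 - w.snd) / 64))) = (1 - w.snd) / (2 * n) := by
      field_simp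
      ring
    rw [h5, h6]
    have : 0 < (1 - w.snd) / (2 * n) := div_pos (by linarith) (by positivity)
    exact mul_lt_of_lt_one_left this hz

theorem lowerChartInv_mem {x : Euc p × EucSucc q} (hx : x ∈ lowerChartTarget p q) :
    lowerChartInv x ∈ lowerChartSource p q := by
  obtain ⟨Z, x⟩ := x
  have hneg : x.snd < 0 := hx.1
  have hO : ‖Z‖ * (‖x.fst‖ ^ 2 + 4096 * x.snd ^ 2) < -(32 * x.snd) := hx.2
  have hst := one_sub_stereo_snd (one_pow 2) ((-(64 * x.snd))⁻¹ • x.fst)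
  rw [one_mul] at hst
  have hpos : 0 < -(64 * x.snd) := by linarith
  have hσ : ‖(-(64 * x.snd))⁻¹ • x.fst‖ ^ 2 = ‖x.fst‖ ^ 2 / (-(64 * x.snd)) ^ 2 := by
    rw [norm_smul, mul_pow, Real.norm_eq_abs, sq_abs, inv_pow, inv_mul_eq_div]
  refine ⟨⟨?_, stereo_mem_sphere (one_pow 2) _⟩, ?_⟩
  · rw [mem_ball_zero_iff]
    simp only [lowerChartInv]
    rw [hst, hσ, norm_smul, Real.norm_of_nonneg (by positivity)]
    have h5 : 4 * (2 / (‖x.fst‖ ^ 2 / (-(64 * x.snd)) ^ 2 + 1) / -(64 * x.snd))⁻¹ * ‖Z‖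
        = ‖Z‖ * (‖x.fst‖ ^ 2 + 4096 * x.snd ^ 2) / (-(32 * x.snd)) := by
      have : x.snd ≠ 0 := hneg.ne
      generalize x.snd = t at this
      field_simp
      ring
    rw [h5, div_lt_one (by linarith)]
    exact hO
  · intro h
    have h' : stereo 1 ((-(64 * x.snd))⁻¹ • x.fst) = WithLp.toLp 2 (0, 1) := h
    have := stereo_one_snd_pos ((-(64 * x.snd))⁻¹ • x.fst)
    rw [h', WithLp.toLp_snd] at this
    simp at this

theorem lowerChartInv_lowerChart {x : Euc p × EucSucc q} (hx : x ∈ lowerChartSource p q) :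
    lowerChartInv (lowerChart x) = x := by
  obtain ⟨z, w⟩ := x
  have ht : w.snd < 1 := snd_lt_one hx.1.2 hx.2
  have hn0 := lowerRoot_pos ht
  have e1 : (lowerChart (z, w)).1 = (lowerRoot w / 4) • z := rfl
  have e2 : (lowerChart (z, w)).2.fst =
    (lowerRoot w)⁻¹ • w.fst := rfl
  have e3 : -(64 * (lowerChart (z, w)).2.snd) =
      (lowerRoot w)⁻¹ * (1 - w.snd) := by
    show -(64 * ((lowerRoot w)⁻¹ * (-(1 - w.snd) / 64))) = _
    ring
  generalize lowerRoot w = n at hn0 e1 e2 e3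
  have h1 : 1 - w.snd ≠ 0 := by linarith
  have hσ : (n⁻¹ * (1 - w.snd))⁻¹ • n⁻¹ • w.fst = stereoProj 1 w := by
    rw [stereoProj, smul_smul, one_mul]
    congr 1
    field_simp
  have hw : stereo 1 (stereoProj 1 w) = w :=
    stereo_stereoProj (one_pow 2) hx.1.2 (by rw [one_mul]; exact ht.ne)
  rw [lowerChartInv, e1, e2, e3, hσ, hw, smul_smul]
  have : 4 * ((1 - w.snd) / (n⁻¹ * (1 - w.snd)))⁻¹ * (n / 4) = 1 := by field_simp
  rw [this, one_smul]

theorem lowerChart_lowerChartInv {x : Euc p × EucSucc q}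
    (hs : x.2 ∈ sphere (0 : EucSucc q) 1) (hx : x ∈ lowerChartTarget p q) :
    lowerChart (lowerChartInv x) = x := by
  obtain ⟨Z, x⟩ := x
  have hneg : x.snd < 0 := hx.1
  have hx : ‖x.fst‖ ^ 2 + x.snd ^ 2 = 1 := mem_sphere_eucSucc.1 hs
  have hst := one_sub_stereo_snd (one_pow 2) ((-(64 * x.snd))⁻¹ • x.fst)
  rw [one_mul] at hst
  have hpos : 0 < -(64 * x.snd) := by linarith
  have hσ : ‖(-(64 * x.snd))⁻¹ • x.fst‖ ^ 2 = ‖x.fst‖ ^ 2 / (-(64 * x.snd)) ^ 2 := by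
    rw [norm_smul, mul_pow, Real.norm_eq_abs, sq_abs, inv_pow, inv_mul_eq_div]
  have hc : 0 < 2 / (‖(-(64 * x.snd))⁻¹ • x.fst‖ ^ 2 + 1) := by positivity
  have hfst : (stereo 1 ((-(64 * x.snd))⁻¹ • x.fst)).fst =
    (2 / (‖(-(64 * x.snd))⁻¹ • x.fst‖ ^ 2 + 1)) • (-(64 * x.snd))⁻¹ • x.fst := rfl
  have ht0 : x.snd ≠ 0 := hneg.ne
  have hroot : lowerRoot (stereo 1 ((-(64 * x.snd))⁻¹ • x.fst))
      = 2 / (‖(-(64 * x.snd))⁻¹ • x.fst‖ ^ 2 + 1) / -(64 * x.snd) := by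
    rw [lowerRoot, hfst, hst, Real.sqrt_eq_iff_mul_self_eq (by positivity) (by positivity),
      norm_smul, mul_pow, hσ,
      Real.norm_eq_abs, sq_abs]
    rw [hσ] at hc
    generalize 2 / (‖x.fst‖ ^ 2 / (-(64 * x.snd)) ^ 2 + 1) = c at hc
    field_simp
    linear_combination hx
  simp only [lowerChart, lowerChartInv, hroot, hfst, hst]
  generalize 2 / (‖(-(64 * x.snd))⁻¹ • x.fst‖ ^ 2 + 1) = c at hc
  rw [smul_smul]
  have h5 : c / -(64 * x.snd) / 4 * (4 * (c / -(64 * x.snd))⁻¹) = 1 := by field_simp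
  rw [h5, one_smul]
  congr 1
  rw [← WithLp.toLp_smul, Prod.smul_mk, smul_smul, smul_smul]
  have h6 : (c / -(64 * x.snd))⁻¹ * c * (-(64 * x.snd))⁻¹ = 1 := by field_simp
  have h7 : (c / -(64 * x.snd))⁻¹ * (-c / 64) = x.snd := by
    field_simp
  rw [h6, one_smul, smul_eq_mul, h7]
  rfl

theorem isOpenSmoothEmbeddingOn_lowerChart
    (hb : IsOpenSmoothEmbeddingOn 𝓘(ℝ, Euc p × EucSucc q) J b₁
      (ball 0 1 ×ˢ (sphere 0 1 ∩ lowerHalf q))) :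
    IsOpenSmoothEmbeddingOn 𝓘(ℝ, Euc p × EucSucc q) J (b₁ ∘ lowerChart)
      (lowerChartSource p q) := by
  have o1 : IsOpen {x : Euc p × EucSucc q | x.2.snd < 0} := isOpen_lt (by fun_prop) (by fun_prop)
  have o2 : IsOpen {x : Euc p × EucSucc q |
      ‖x.1‖ * (‖x.2.fst‖ ^ 2 + 4096 * x.2.snd ^ 2) < -(32 * x.2.snd)} :=
    isOpen_lt (by fun_prop) (by fun_prop)
  exact hb.comp_of_inverse (k := lowerChartInv) (O := lowerChartTarget p q) (o1.inter o2)
    lowerChart_contDiffOn.contMDiffOn (lowerChartInv_contDiffOn.contMDiffOn.mono inter_subset_right)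
    (fun x hx => lowerChart_mem hx) (fun x hx => lowerChartInv_mem hx.2)
    (fun x hx => lowerChartInv_lowerChart hx)
    (fun x hx => lowerChart_lowerChartInv hx.1.2.1 hx.2)

end DualCoordinates

/-! ### The chart of the second handle -/

section DualCoordinates

variable {p q : ℕ} {E H X : Type*} [NormedAddCommGroup E] [NormedSpace ℝ E] [TopologicalSpace H]
  [TopologicalSpace X] [ChartedSpace H X]
  {E' H' Y : Type*} [NormedAddCommGroup E'] [NormedSpace ℝ E'] [TopologicalSpace H']
  [TopologicalSpace Y] [ChartedSpace H' Y]
  {E'' H'' Z : Type*} [NormedAddCommGroup E''] [NormedSpace ℝ E''] [TopologicalSpace H'']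
  [TopologicalSpace Z] [ChartedSpace H'' Z]
  {I : ModelWithCorners ℝ E H} {J : ModelWithCorners ℝ E' H'} {J' : ModelWithCorners ℝ E'' H''}
  {F : Euc p × EucSucc q → X} {a₁ : X → Y} {b₁ : Euc p × EucSucc q → Y}
  {a₂ : Y → Z} {b₂ : Euc q × EucSucc p → Z}

/-- The source of `upperChart`. -/
def upperChartSource (p q : ℕ) : Set (Euc p × EucSucc q) :=
  ball 0 1 ×ˢ sphere 0 1 ∩ {x | 0 < x.2.snd}

/-- The target of `upperChart`, as an open part of the second handle. -/
def upperChartTarget (p q : ℕ) : Set (Euc q × EucSucc p) :=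
  {x | x.2.snd < 0 ∧ 4096 * x.2.snd ^ 2 * ‖x.1‖ ^ 2 < 1 ∧
    ‖x.2.fst‖ * (4096 * x.2.snd ^ 2 * ‖x.1‖ ^ 2 + 1) < -(32 * x.2.snd)}

theorem upperRoot_sq (x : Euc p × EucSucc q) :
    upperRoot x ^ 2 = ‖x.1‖ ^ 2 / 16 + (1 / (64 * (1 + x.2.snd))) ^ 2 :=
  Real.sq_sqrt (by positivity)

theorem upperRoot_pos {x : Euc p × EucSucc q} (hx : 0 < x.2.snd) : 0 < upperRoot x :=
  Real.sqrt_pos.2 (by positivity)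

theorem upperRoot_lt {x : Euc p × EucSucc q} (hx : 0 < x.2.snd) (h : ‖x.1‖ < 1) :
    upperRoot x ^ 2 < 1 / 2 := by
  have h1 : 1 / (64 * (1 + x.2.snd)) ≤ 1 / 64 :=
    one_div_le_one_div_of_le (by norm_num) (by linarith)
  have h2 : 0 ≤ 1 / (64 * (1 + x.2.snd)) := by positivity
  have h3 := norm_nonneg x.1
  rw [upperRoot_sq]
  nlinarith

theorem upperChart_contDiffOn :
    ContDiffOn ℝ ∞ (upperChart : Euc p × EucSucc q → _) (upperChartSource p q) := by
  have h1 : ∀ x ∈ upperChartSource p q, upperRoot x ≠ 0 := fun x hx => (upperRoot_pos hx.2).ne'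
  have h0 : ∀ x ∈ upperChartSource p q,
      ‖x.1‖ ^ 2 / 16 + (1 / (64 * (1 + x.2.snd))) ^ 2 ≠ 0 := fun x hx =>
    (Real.sqrt_pos.1 (upperRoot_pos hx.2)).ne'
  have h2 : ∀ x ∈ upperChartSource p q, 64 * (1 + x.2.snd) ≠ 0 := fun x hx => by
    have : 0 < x.2.snd := hx.2
    positivity
  have e0 : ContDiffOn ℝ ∞ (fun x : Euc p × EucSucc q => x.1) (upperChartSource p q) :=
    contDiffOn_fst
  have e1 : ContDiffOn ℝ ∞ (fun x : Euc p × EucSucc q => x.2.fst) (upperChartSource p q) := by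
    fun_prop
  have e2 : ContDiffOn ℝ ∞ (fun x : Euc p × EucSucc q => 1 / (64 * (1 + x.2.snd)))
      (upperChartSource p q) := by
    fun_prop (disch := assumption)
  have e3 : ContDiffOn ℝ ∞ (fun x : Euc p × EucSucc q => upperRoot x) (upperChartSource p q) :=
    (((e0.norm_sq ℝ).div_const 16).add (e2.pow 2)).sqrt h0
  exact (e3.smul e1).prodMk ((e3.inv h1).smul ((contDiff_eucSucc_toLp p).comp_contDiffOn
    (((contDiffOn_const (c := (1 / 4 : ℝ))).smul e0).prodMk e2.neg)))

theorem one_add_stereo_snd (σ : Euc q) : 1 + (stereo (-1) σ).snd = 2 / (‖σ‖ ^ 2 + 1) := by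
  rw [← one_sub_stereo_snd (by norm_num : (-1 : ℝ) ^ 2 = 1) σ]
  ring

theorem upperChartInv_contDiffOn :
    ContDiffOn ℝ ∞ (upperChartInv : Euc q × EucSucc p → _) (upperChartTarget p q) := by
  have hD : ∀ x ∈ upperChartTarget p q, -(64 * x.2.snd) ≠ 0 := fun x hx => by
    have : x.2.snd < 0 := hx.1
    exact (show 0 < -(64 * x.2.snd) by linarith).ne'
  have e2 : ContDiffOn ℝ ∞ (fun x : Euc q × EucSucc p => x.2.snd) (upperChartTarget p q) := by
    fun_prop
  have e1 : ContDiffOn ℝ ∞ (fun x : Euc q × EucSucc p => x.2.fst) (upperChartTarget p q) := by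
    fun_prop
  have e4 : ContDiffOn ℝ ∞ (fun x : Euc q × EucSucc p => -(64 * x.2.snd))
      (upperChartTarget p q) := (contDiffOn_const.mul e2).neg
  have h1 := (stereo_contDiff (-1)).comp_contDiffOn (e4.smul (contDiffOn_fst (s :=
    upperChartTarget p q)))
  have h3 := (contDiff_eucSucc_snd q).comp_contDiffOn h1
  refine (ContDiffOn.smul (contDiffOn_const.mul (ContDiffOn.inv
    ((contDiffOn_const.add h3).mul e4) fun x hx => ?_)) e1).prodMk h1
  refine mul_ne_zero ?_ (hD x hx)
  simp only [Function.comp, one_add_stereo_snd]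
  positivity

theorem upperChart_mem {x : Euc p × EucSucc q} (hx : x ∈ upperChartSource p q) :
    upperChart x ∈ ball (0 : Euc q) 1 ×ˢ (sphere (0 : EucSucc p) 1 ∩ lowerHalf p) ∩
      upperChartTarget p q := by
  obtain ⟨z, w⟩ := x
  have ht : 0 < w.snd := hx.2
  have hs : ‖w.fst‖ ^ 2 + w.snd ^ 2 = 1 := mem_sphere_eucSucc.1 hx.1.2
  have hz : ‖z‖ < 1 := mem_ball_zero_iff.1 hx.1.1
  have hrs : upperRoot (z, w) ^ 2 = ‖z‖ ^ 2 / 16 + (1 / (64 * (1 + w.snd))) ^ 2 := upperRoot_sq _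
  have hr1 := upperRoot_lt (x := (z, w)) ht hz
  have hn0 : 0 < upperRoot (z, w) := upperRoot_pos ht
  have e1 : (upperChart (z, w)).1 = upperRoot (z, w) • w.fst := rfl
  have e2 : (upperChart (z, w)).2.fst = (upperRoot (z, w))⁻¹ • (1 / 4 : ℝ) • z := rfl
  have e3 : (upperChart (z, w)).2.snd = (upperRoot (z, w))⁻¹ * -(1 / (64 * (1 + w.snd))) := rfl
  generalize upperRoot (z, w) = κ at hrs hr1 hn0 e1 e2 e3
  have hc : 0 < 1 / (64 * (1 + w.snd)) := by positivity
  have hneg : (upperChart (z, w)).2.snd < 0 := by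
    rw [e3]
    exact mul_neg_of_pos_of_neg (by positivity) (by linarith)
  have hY : ‖(upperChart (z, w)).1‖ ^ 2 = κ ^ 2 * ‖w.fst‖ ^ 2 := by
    rw [e1, norm_smul, mul_pow, Real.norm_eq_abs, sq_abs]
  have hx2 : ‖(upperChart (z, w)).2.fst‖ = κ⁻¹ * (1 / 4 * ‖z‖) := by
    rw [e2, norm_smul, norm_smul, Real.norm_of_nonneg (by positivity),
      Real.norm_of_nonneg (by positivity)]
  have hσ : 4096 * (upperChart (z, w)).2.snd ^ 2 * ‖(upperChart (z, w)).1‖ ^ 2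
      = (1 - w.snd) / (1 + w.snd) := by
    rw [hY, e3]
    field_simp
    linear_combination 4096 * hs
  refine ⟨⟨?_, ?_, hneg.le⟩, hneg, ?_, ?_⟩
  · rw [mem_ball_zero_iff, ← sq_lt_one_iff₀ (norm_nonneg _), hY]
    have h1 : ‖w.fst‖ ^ 2 ≤ 1 := by nlinarith [sq_nonneg w.snd]
    nlinarith [sq_nonneg ‖w.fst‖]
  · have h1 : (1 / 4 * ‖z‖) ^ 2 + (-(1 / (64 * (1 + w.snd)))) ^ 2 = κ ^ 2 := by rw [hrs]; ring
    rw [mem_sphere_eucSucc, hx2, e3, mul_pow, mul_pow κ⁻¹, inv_pow, ← mul_add, h1,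
      inv_mul_cancel₀ (by positivity)]
  · rw [hσ, div_lt_one (by linarith)]
    linarith
  · rw [hσ, hx2, e3]
    have h5 : κ⁻¹ * (1 / 4 * ‖z‖) * ((1 - w.snd) / (1 + w.snd) + 1)
        = ‖z‖ * (κ⁻¹ * (1 / (2 * (1 + w.snd)))) := by
      field_simp
      ring
    have h6 : -(32 * (κ⁻¹ * -(1 / (64 * (1 + w.snd))))) = κ⁻¹ * (1 / (2 * (1 + w.snd))) := by
      field_simp
      ring
    rw [h5, h6]
    exact mul_lt_of_lt_one_left (by positivity) hz

theorem upperChartInv_mem {x : Euc q × EucSucc p} (hx : x ∈ upperChartTarget p q) :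
    upperChartInv x ∈ upperChartSource p q := by
  obtain ⟨Y, x⟩ := x
  have hneg : x.snd < 0 := hx.1
  have h1 : 4096 * x.snd ^ 2 * ‖Y‖ ^ 2 < 1 := hx.2.1
  have hO : ‖x.fst‖ * (4096 * x.snd ^ 2 * ‖Y‖ ^ 2 + 1) < -(32 * x.snd) := hx.2.2
  have hst := one_add_stereo_snd (-(64 * x.snd) • Y)
  have hpos : 0 < -(64 * x.snd) := by linarith
  have hσ : ‖-(64 * x.snd) • Y‖ ^ 2 = 4096 * x.snd ^ 2 * ‖Y‖ ^ 2 := by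
    rw [norm_smul, mul_pow, Real.norm_eq_abs, sq_abs]
    ring
  rw [hσ] at hst
  refine ⟨⟨?_, stereo_mem_sphere (by norm_num) _⟩, ?_⟩
  · rw [mem_ball_zero_iff]
    simp only [upperChartInv]
    rw [hst, norm_smul, Real.norm_of_nonneg (by positivity)]
    have h5 : 4 * (2 / (4096 * x.snd ^ 2 * ‖Y‖ ^ 2 + 1) * -(64 * x.snd))⁻¹ * ‖x.fst‖
        = ‖x.fst‖ * (4096 * x.snd ^ 2 * ‖Y‖ ^ 2 + 1) / (-(32 * x.snd)) := by
      have : x.snd ≠ 0 := hneg.ne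
      generalize x.snd = t at this
      field_simp
      ring
    rw [h5, div_lt_one (by linarith)]
    exact hO
  · show 0 < (stereo (-1) (-(64 * x.snd) • Y)).snd
    have : 1 < 2 / (4096 * x.snd ^ 2 * ‖Y‖ ^ 2 + 1) := by
      rw [lt_div_iff₀ (by positivity)]
      linarith
    linarith

theorem upperChartInv_upperChart {x : Euc p × EucSucc q} (hx : x ∈ upperChartSource p q) :
    upperChartInv (upperChart x) = x := by
  obtain ⟨z, w⟩ := x
  have ht : 0 < w.snd := hx.2
  have hn0 : 0 < upperRoot (z, w) := upperRoot_pos ht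
  have e1 : (upperChart (z, w)).1 = upperRoot (z, w) • w.fst := rfl
  have e2 : (upperChart (z, w)).2.fst = (upperRoot (z, w))⁻¹ • (1 / 4 : ℝ) • z := rfl
  have e3 : -(64 * (upperChart (z, w)).2.snd) = (upperRoot (z, w))⁻¹ * (1 + w.snd)⁻¹ := by
    show -(64 * ((upperRoot (z, w))⁻¹ * -(1 / (64 * (1 + w.snd))))) = _
    field_simp
  generalize upperRoot (z, w) = κ at hn0 e1 e2 e3
  have hσ : (κ⁻¹ * (1 + w.snd)⁻¹) • κ • w.fst = stereoProj (-1) w := by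
    rw [stereoProj, smul_smul]
    congr 1
    have : (1 - -1 * w.snd) = 1 + w.snd := by ring
    rw [this]
    field_simp
  have hw : stereo (-1) (stereoProj (-1) w) = w :=
    stereo_stereoProj (by norm_num) hx.1.2 (by linarith)
  rw [upperChartInv, e1, e2, e3, hσ, hw, smul_smul, smul_smul]
  have : 4 * ((1 + w.snd) * (κ⁻¹ * (1 + w.snd)⁻¹))⁻¹ * κ⁻¹ * (1 / 4) = 1 := by field_simp
  rw [this, one_smul]

theorem upperChart_upperChartInv {x : Euc q × EucSucc p}
    (hs : x.2 ∈ sphere (0 : EucSucc p) 1) (hx : x ∈ upperChartTarget p q) :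
    upperChart (upperChartInv x) = x := by
  obtain ⟨Y, x⟩ := x
  have hneg : x.snd < 0 := hx.1
  have hx : ‖x.fst‖ ^ 2 + x.snd ^ 2 = 1 := mem_sphere_eucSucc.1 hs
  have hst := one_add_stereo_snd (-(64 * x.snd) • Y)
  have hpos : 0 < -(64 * x.snd) := by linarith
  have ht0 : x.snd ≠ 0 := hneg.ne
  have hc : 0 < 2 / (‖-(64 * x.snd) • Y‖ ^ 2 + 1) := by positivity
  have hfst : (stereo (-1) (-(64 * x.snd) • Y)).fst =
    (2 / (‖-(64 * x.snd) • Y‖ ^ 2 + 1)) • -(64 * x.snd) • Y := rfl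
  have hroot : upperRoot (upperChartInv (Y, x)) =
      (2 / (‖-(64 * x.snd) • Y‖ ^ 2 + 1) * -(64 * x.snd))⁻¹ := by
    simp only [upperRoot, upperChartInv, hst]
    rw [Real.sqrt_eq_iff_mul_self_eq (by positivity) (by positivity), norm_smul, mul_pow,
      Real.norm_eq_abs, sq_abs]
    generalize 2 / (‖-(64 * x.snd) • Y‖ ^ 2 + 1) = c at hc
    field_simp
    linear_combination 16 * hx
  rw [upperChart, hroot]
  simp only [upperChartInv, hfst, hst]
  generalize 2 / (‖-(64 * x.snd) • Y‖ ^ 2 + 1) = c at hc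
  rw [smul_smul, smul_smul]
  have h5 : (c * -(64 * x.snd))⁻¹ * c * -(64 * x.snd) = 1 := by field_simp
  rw [h5, one_smul]
  congr 1
  rw [inv_inv, ← WithLp.toLp_smul, Prod.smul_mk, smul_smul, smul_smul]
  have h6 : c * -(64 * x.snd) * (1 / 4) * (4 * (c * -(64 * x.snd))⁻¹) = 1 := by field_simp
  have h7 : c * -(64 * x.snd) * -(1 / (64 * c)) = x.snd := by
    field_simp
  rw [h6, one_smul, smul_eq_mul, h7]
  rfl

theorem isOpenSmoothEmbeddingOn_upperChart
    (hb : IsOpenSmoothEmbeddingOn 𝓘(ℝ, Euc q × EucSucc p) J' b₂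
      (ball 0 1 ×ˢ (sphere 0 1 ∩ lowerHalf p))) :
    IsOpenSmoothEmbeddingOn 𝓘(ℝ, Euc p × EucSucc q) J' (b₂ ∘ upperChart)
      (upperChartSource p q) := by
  have o1 : IsOpen {x : Euc q × EucSucc p | x.2.snd < 0} := isOpen_lt (by fun_prop) (by fun_prop)
  have o2 : IsOpen {x : Euc q × EucSucc p | 4096 * x.2.snd ^ 2 * ‖x.1‖ ^ 2 < 1} :=
    isOpen_lt (by fun_prop) (by fun_prop)
  have o3 : IsOpen {x : Euc q × EucSucc p |
      ‖x.2.fst‖ * (4096 * x.2.snd ^ 2 * ‖x.1‖ ^ 2 + 1) < -(32 * x.2.snd)} :=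
    isOpen_lt (by fun_prop) (by fun_prop)
  exact hb.comp_of_inverse (k := upperChartInv) (O := upperChartTarget p q) (o1.inter (o2.inter o3))
    upperChart_contDiffOn.contMDiffOn (upperChartInv_contDiffOn.contMDiffOn.mono inter_subset_right)
    (fun x hx => upperChart_mem hx) (fun x hx => upperChartInv_mem hx.2)
    (fun x hx => upperChartInv_upperChart hx)
    (fun x hx => upperChart_upperChartInv hx.1.2.1 hx.2)

/-- The two charts agree where both are defined. -/
theorem old_lowerChart_eq_upperChart
    (h₂ : IsSurgeryAlong J J' (lowerHalf p) (b₁ ∘ handleCollar) a₂ b₂)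
    {x : Euc p × EucSucc q} (hx : x ∈ upperChartSource p q)
    (hx' : x.2 ≠ WithLp.toLp 2 (0, 1)) :
    a₂ (b₁ (lowerChart x)) = b₂ (upperChart x) := by
  obtain ⟨z, w⟩ := x
  have ht : 0 < w.snd := hx.2
  have ht1 : w.snd < 1 := snd_lt_one hx.1.2 hx'
  have hs : ‖w.fst‖ ^ 2 + w.snd ^ 2 = 1 := mem_sphere_eucSucc.1 hx.1.2
  have hz : ‖z‖ < 1 := mem_ball_zero_iff.1 hx.1.1
  have hκs : upperRoot (z, w) ^ 2 = ‖z‖ ^ 2 / 16 + (1 / (64 * (1 + w.snd))) ^ 2 := upperRoot_sq _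
  have hκ1 := upperRoot_lt (x := (z, w)) ht hz
  have hκ0 : 0 < upperRoot (z, w) := upperRoot_pos ht
  have hy0 : 0 < ‖w.fst‖ := by
    rw [norm_pos_iff]
    intro h
    rw [h, norm_zero] at hs
    nlinarith
  have hv1 : ‖‖w.fst‖⁻¹ • w.fst‖ = 1 := by simp [norm_smul, hy0.ne']
  have hvy : ‖w.fst‖ • ‖w.fst‖⁻¹ • w.fst = w.fst := by
    rw [smul_smul, mul_inv_cancel₀ hy0.ne', one_smul]
  set v := ‖w.fst‖⁻¹ • w.fst with hv
  set c := 1 / (64 * (1 + w.snd)) with hc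
  have hc0 : 0 < c := by positivity
  have e1 : upperChart (z, w) = ((‖w.fst‖ * upperRoot (z, w)) • v,
      (upperRoot (z, w))⁻¹ • (WithLp.toLp 2 ((1 / 4 : ℝ) • z, -c) : EucSucc p)) := by
    rw [mul_comm, mul_smul, hvy]
    rfl
  have hn : lowerRoot w = √(1 + (‖w.fst‖ * -c) ^ 2) * ‖w.fst‖ := by
    have h1 : (1 - w.snd) / 64 = ‖w.fst‖ ^ 2 * c := by
      rw [hc]
      field_simp
      linear_combination (-1) * hs
    have h2 : ‖w.fst‖ ^ 2 + ((1 - w.snd) / 64) ^ 2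
        = (1 + (‖w.fst‖ * -c) ^ 2) * ‖w.fst‖ ^ 2 := by
      rw [h1]; ring
    rw [lowerRoot, h2, Real.sqrt_mul (by positivity), Real.sqrt_sq hy0.le]
  have e2 : handleCollar (v, (‖w.fst‖ * upperRoot (z, w)) • (upperRoot (z, w))⁻¹ •
      (WithLp.toLp 2 ((1 / 4 : ℝ) • z, -c) : EucSucc p)) = lowerChart (z, w) := by
    have h0 : √(1 + (‖w.fst‖ * -c) ^ 2) ≠ 0 := (Real.sqrt_pos.2 (by positivity)).ne'
    rw [smul_smul, mul_assoc, mul_inv_cancel₀ hκ0.ne', mul_one, ← WithLp.toLp_smul, Prod.smul_mk]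
    simp only [handleCollar, lowerChart, WithLp.toLp_fst, WithLp.toLp_snd, smul_eq_mul, hn]
    congr 1
    · rw [smul_smul, smul_smul]
      congr 1
      ring
    · rw [← WithLp.toLp_smul, ← WithLp.toLp_smul, Prod.smul_mk, Prod.smul_mk]
      congr 2
      · rw [hv, smul_smul, mul_inv]
      · rw [smul_eq_mul, smul_eq_mul, mul_inv, mul_assoc]
        congr 1
        rw [hc]
        field_simp
        linear_combination (-1) * hs
  have hw' : (upperRoot (z, w))⁻¹ • (WithLp.toLp 2 ((1 / 4 : ℝ) • z, -c) : EucSucc p) ∈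
      sphere 0 1 ∩ lowerHalf p := (upperChart_mem hx).1.2
  have hθ : ‖w.fst‖ * upperRoot (z, w) ∈ Ioo (0 : ℝ) 1 := by
    refine ⟨by positivity, ?_⟩
    rw [← sq_lt_one_iff₀ (by positivity), mul_pow]
    have h1 : ‖w.fst‖ ^ 2 ≤ 1 := by nlinarith [sq_nonneg w.snd]
    have h2 : upperRoot (z, w) ^ 2 < 1 / 2 := hκ1
    nlinarith [sq_nonneg ‖w.fst‖]
  rw [e1, h₂.new_eq_old smul_mem_lowerHalf zero_mem_lowerHalf hv1 hθ hw', Function.comp_apply, e2]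

end DualCoordinates

/-! ### The dual surgery -/

section DualSurgery

variable {p q : ℕ} {E H X : Type*} [NormedAddCommGroup E] [NormedSpace ℝ E] [TopologicalSpace H]
  [TopologicalSpace X] [ChartedSpace H X]
  {E' H' Y : Type*} [NormedAddCommGroup E'] [NormedSpace ℝ E'] [TopologicalSpace H']
  [TopologicalSpace Y] [ChartedSpace H' Y]
  {E'' H'' Z : Type*} [NormedAddCommGroup E''] [NormedSpace ℝ E''] [TopologicalSpace H'']
  [TopologicalSpace Z] [ChartedSpace H'' Z]
  {I : ModelWithCorners ℝ E H} {J : ModelWithCorners ℝ E' H'} {J' : ModelWithCorners ℝ E'' H''}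
  {F : Euc p × EucSucc q → X} {g : X → Euc p × EucSucc q} {a₁ : X → Y}
  {b₁ : Euc p × EucSucc q → Y} {a₂ : Y → Z} {b₂ : Euc q × EucSucc p → Z}

/-- The coordinates near the sphere `S^(p-1) × {(0, -1/2)}` along which the surgery that gives the
result of both handle attachments is performed. They are chosen such that the slide is
`(u, θ w) ↦ (u, (θ / 4) (w_y, -(1 - w_t) / 64))`. -/
noncomputable def coreMap (x : Euc p × EucSucc q) : Euc p × EucSucc q :=
  (x.1, WithLp.toLp 2 ((1 / 4 : ℝ) • x.2.fst, -(x.2.snd / 4 + 2)⁻¹))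

theorem coreMap_denom {w : EucSucc q} (hw : w ∈ ball (0 : EucSucc q) 1) :
    7 / 4 < w.snd / 4 + 2 ∧ w.snd / 4 + 2 < 9 / 4 := by
  rw [mem_ball_eucSucc] at hw
  have h1 : w.snd ^ 2 < 1 := by nlinarith [sq_nonneg ‖w.fst‖]
  have h2 := abs_lt.1 ((sq_lt_one_iff_abs_lt_one _).1 h1)
  constructor <;> linarith [h2.1, h2.2]

theorem inv_sq_lt {a : ℝ} (ha : 7 / 4 < a) : (a⁻¹) ^ 2 < 1 / 3 := by
  have h0 : 0 < a := by linarith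
  have h : a⁻¹ < 4 / 7 := by
    rw [inv_lt_comm₀ h0 (by norm_num)]
    norm_num
    linarith
  have : 0 < a⁻¹ := by positivity
  nlinarith

theorem norm_coreMap_fst_sq (x : Euc p × EucSucc q) :
    ‖(coreMap x).2.fst‖ ^ 2 = ‖x.2.fst‖ ^ 2 / 16 := by
  simp only [coreMap, WithLp.toLp_fst, norm_smul, mul_pow]
  norm_num
  ring

theorem coreMap_mem {x : Euc p × EucSucc q}
    (hx : x ∈ sphere (0 : Euc p) 1 ×ˢ ball (0 : EucSucc q) 1) :
    coreMap x ∈ sphere (0 : Euc p) 1 ×ˢ (ball (0 : EucSucc q) 1 ∩ lowerHalf q) ∧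
      ‖(coreMap x).2.fst‖ ^ 2 + (coreMap x).2.snd ^ 2 ≤ 1 / 2 := by
  obtain ⟨h1, h2⟩ := coreMap_denom hx.2
  have h3 := inv_sq_lt h1
  have h4 := mem_ball_eucSucc.1 hx.2
  have h5 : ‖(coreMap x).2.fst‖ ^ 2 + (coreMap x).2.snd ^ 2 ≤ 1 / 2 := by
    rw [norm_coreMap_fst_sq]
    show _ + (-(x.2.snd / 4 + 2)⁻¹) ^ 2 ≤ _
    rw [neg_sq]
    nlinarith [sq_nonneg x.2.snd]
  refine ⟨mem_prod_ball_lowerHalf.2 ⟨mem_sphere_zero_iff_norm.1 hx.1, by linarith, ?_⟩, h5⟩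
  show -(x.2.snd / 4 + 2)⁻¹ ≤ 0
  have : 0 < (x.2.snd / 4 + 2)⁻¹ := inv_pos.2 (by linarith)
  linarith

theorem isOpenSmoothEmbeddingOn_coreMap
    (hF : IsOpenSmoothEmbeddingOn 𝓘(ℝ, Euc p × EucSucc q) I F
      (sphere 0 1 ×ˢ (ball 0 1 ∩ lowerHalf q))) :
    IsOpenSmoothEmbeddingOn 𝓘(ℝ, Euc p × EucSucc q) I (F ∘ coreMap)
      (sphere 0 1 ×ˢ ball 0 1) := by
  have o1 : IsOpen {w : Euc p × EucSucc q | w.2.snd < 0} := isOpen_lt (by fun_prop) (by fun_prop)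
  have o2 : IsOpen {w : Euc p × EucSucc q |
      ‖w.2.fst‖ ^ 2 * w.2.snd ^ 2 + (1 + 2 * w.2.snd) ^ 2 < w.2.snd ^ 2 / 16} :=
    isOpen_lt (by fun_prop) (by fun_prop)
  refine hF.comp_of_inverse
    (k := fun w => (w.1, WithLp.toLp 2 ((4 : ℝ) • w.2.fst, 4 * (-(w.2.snd)⁻¹ - 2))))
    (o1.inter o2) ?_ ?_ ?_ ?_ ?_ ?_
  · refine ContDiffOn.contMDiffOn ?_
    have : ∀ x ∈ sphere (0 : Euc p) 1 ×ˢ ball (0 : EucSucc q) 1, x.2.snd / 4 + 2 ≠ 0 :=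
      fun x hx => by linarith [(coreMap_denom hx.2).1]
    unfold coreMap
    fun_prop (disch := first | assumption | norm_num)
  · refine ContDiffOn.contMDiffOn ?_
    have : ∀ w ∈ sphere (0 : Euc p) 1 ×ˢ (ball (0 : EucSucc q) 1 ∩ lowerHalf q) ∩
        ({w | w.2.snd < 0} ∩ {w |
      ‖w.2.fst‖ ^ 2 * w.2.snd ^ 2 + (1 + 2 * w.2.snd) ^ 2 < w.2.snd ^ 2 / 16}), w.2.snd ≠ 0 :=
      fun w hw => (show w.2.snd < 0 from hw.2.1).ne
    fun_prop (disch := assumption)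
  · rintro x hx
    refine ⟨(coreMap_mem hx).1, ?_, ?_⟩
    · show -(x.2.snd / 4 + 2)⁻¹ < 0
      have : 0 < (x.2.snd / 4 + 2)⁻¹ := inv_pos.2 (by linarith [(coreMap_denom hx.2).1])
      linarith
    · show ‖(coreMap x).2.fst‖ ^ 2 * (-(x.2.snd / 4 + 2)⁻¹) ^ 2 +
        (1 + 2 * -(x.2.snd / 4 + 2)⁻¹) ^ 2 < (-(x.2.snd / 4 + 2)⁻¹) ^ 2 / 16
      rw [norm_coreMap_fst_sq]
      have h1 := (coreMap_denom hx.2).1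
      have h2 := mem_ball_eucSucc.1 hx.2
      have h3 : (x.2.snd / 4 + 2)⁻¹ * (x.2.snd / 4 + 2) = 1 := inv_mul_cancel₀ (by linarith)
      have h4 : 0 < (x.2.snd / 4 + 2)⁻¹ := inv_pos.2 (by linarith)
      set c := (x.2.snd / 4 + 2)⁻¹
      have h5 : ‖x.2.fst‖ ^ 2 / 16 * (-c) ^ 2 + (1 + 2 * -c) ^ 2
          = (‖x.2.fst‖ ^ 2 + x.2.snd ^ 2) * (c ^ 2 / 16) := by
        have : 1 + 2 * -c = c * x.2.snd / 4 := by linear_combination (-1) * h3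
        rw [this]; ring
      rw [h5, neg_sq]
      exact mul_lt_of_lt_one_left (by positivity) h2
  · rintro w ⟨⟨h1, -⟩, h2, h3⟩
    refine ⟨h1, ?_⟩
    have h2 : w.2.snd < 0 := h2
    have h3 : ‖w.2.fst‖ ^ 2 * w.2.snd ^ 2 + (1 + 2 * w.2.snd) ^ 2 < w.2.snd ^ 2 / 16 := h3
    rw [mem_ball_eucSucc]
    simp only [WithLp.toLp_fst, WithLp.toLp_snd, norm_smul, mul_pow]
    have h4 : w.2.snd ≠ 0 := h2.ne
    have h5 : ‖(4 : ℝ)‖ ^ 2 * ‖w.2.fst‖ ^ 2 + 4 ^ 2 * (-(w.2.snd)⁻¹ - 2) ^ 2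
        = (‖w.2.fst‖ ^ 2 * w.2.snd ^ 2 + (1 + 2 * w.2.snd) ^ 2) / (w.2.snd ^ 2 / 16) := by
      generalize w.2.snd = t at h4
      rw [Real.norm_of_nonneg (by norm_num)]
      field_simp
      ring
    rw [h5, div_lt_one (by positivity)]
    exact h3
  · intro x hx
    have h1 := (coreMap_denom hx.2).1
    have h3 : 4 * (-(-(x.2.snd / 4 + 2)⁻¹)⁻¹ - 2) = x.2.snd := by
      rw [inv_neg, inv_inv]
      ring
    simp only [coreMap, WithLp.toLp_fst, WithLp.toLp_snd, h3, smul_smul]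
    norm_num
    rfl
  · rintro w ⟨⟨h1, -⟩, h2, h3⟩
    have h3 : -(4 * (-(w.2.snd)⁻¹ - 2) / 4 + 2)⁻¹ = w.2.snd := by
      have : 4 * (-(w.2.snd)⁻¹ - 2) / 4 + 2 = -(w.2.snd)⁻¹ := by ring
      rw [this, inv_neg, inv_inv, neg_neg]
    simp only [coreMap, WithLp.toLp_fst, WithLp.toLp_snd, h3, smul_smul]
    norm_num
    rfl

/-- The slide in the coordinates `coreMap`. Rescaling the second component of the right-hand side to a
unit vector shows `lowerChart` in the gluing relation of the first handle. -/
theorem slideMap_coreMap {u : Euc p} {w : EucSucc q} (hu : u ∈ sphere (0 : Euc p) 1)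
    (hw : w ∈ sphere (0 : EucSucc q) 1) {θ : ℝ} (hθ : θ ∈ Ioo (0 : ℝ) 1) :
    slideMap (coreMap (u, θ • w)) =
      (u, (θ / 4) • WithLp.toLp 2 (w.fst, -(1 - w.snd) / 64)) := by
  have hs := mem_sphere_eucSucc.1 hw
  have hmem : (u, θ • w) ∈ sphere (0 : Euc p) 1 ×ˢ ball (0 : EucSucc q) 1 := by
    refine ⟨hu, ?_⟩
    rw [mem_ball_zero_iff, norm_smul, mem_sphere_zero_iff_norm.1 hw, mul_one,
      Real.norm_of_nonneg hθ.1.le]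
    exact hθ.2
  have h1 := (coreMap_denom hmem.2).1
  have hsnd : (θ • w).snd = θ * w.snd := rfl
  rw [hsnd] at h1
  have hB : ‖(coreMap (u, θ • w)).2.fst‖ ^ 2 = (θ ^ 2 * ‖w.fst‖ ^ 2) / 16 := by
    rw [norm_coreMap_fst_sq]
    show ‖θ • w.fst‖ ^ 2 / 16 = _
    rw [norm_smul, mul_pow, Real.norm_eq_abs, sq_abs]
  have ht : (coreMap (u, θ • w)).2.snd = -(θ * w.snd / 4 + 2)⁻¹ := rfl
  have hsl := slide_eq_inner (coreMap_mem hmem).2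
  have hfst : (coreMap (u, θ • w)).2.fst = (1 / 4 : ℝ) • θ • w.fst := rfl
  have hroot : slideRoot (θ ^ 2 * ‖w.fst‖ ^ 2 / 16) (-(θ * w.snd / 4 + 2)⁻¹)
      = θ / 4 * (θ * w.snd / 4 + 2)⁻¹ := by
    have h0 : 0 < θ * w.snd / 4 + 2 := by linarith
    have hθ0 := hθ.1
    rw [slideRoot, Real.sqrt_eq_iff_mul_self_eq (by positivity) (by positivity)]
    generalize hc : θ * w.snd / 4 + 2 = c at h0
    have hc' : θ * w.snd = 4 * (c - 2) := by rw [← hc]; ring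
    have : 1 + 2 * -c⁻¹ = θ * w.snd / 4 * c⁻¹ := by
      rw [hc']
      field_simp
      ring
    rw [this]
    linear_combination (θ ^ 2 / 16 * c⁻¹ ^ 2) * hs
  have hT : slide (‖(coreMap (u, θ • w)).2.fst‖ ^ 2) (coreMap (u, θ • w)).2.snd
      = θ / 4 * (-(1 - w.snd) / 64) := by
    rw [hsl, hB, ht, slideInner, hroot]
    have h0 : θ * w.snd / 4 + 2 ≠ 0 := by linarith
    generalize hc : θ * w.snd / 4 + 2 = c at h0
    have hc' : θ * w.snd = 4 * (c - 2) := by rw [← hc]; ring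
    field_simp
    linear_combination (-1) * hc'
  rw [slideMap, hT, hfst, ← WithLp.toLp_smul, Prod.smul_mk, smul_smul, smul_eq_mul]
  have : 1 / 4 * θ = θ / 4 := by ring
  rw [this]
  rfl

open Classical in
/-- The inclusion in the result of both handle attachments of the complement of the sphere
`S^(p-1) × {(0, -1/2)}`: the complement of the arcs is included by means of the slide, and the
half-open arcs are mapped to the core of the second handle. -/
noncomputable def dualOld (F : Euc p × EucSucc q → X) (g : X → Euc p × EucSucc q) (a₁ : X → Y)
    (a₂ : Y → Z) (b₂ : Euc q × EucSucc p → Z) (x : X) : Z :=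
  if x ∈ F '' arcNeighbourhood p q then b₂ (handleCollar (slopeMap (g x)))
  else a₂ (a₁ (arcSlide F g x))

open Classical in
/-- The new part `B^p × S^q` in the result of both handle attachments. Where `0 < w_(q+1)` and `w` is
not the pole, the two cases agree; this is how smoothness at the transition is obtained. -/
noncomputable def dualNew (b₁ : Euc p × EucSucc q → Y) (a₂ : Y → Z) (b₂ : Euc q × EucSucc p → Z)
    (x : Euc p × EucSucc q) : Z :=
  if 0 < x.2.snd then b₂ (upperChart x) else a₂ (b₁ (lowerChart x))

theorem arcNeighbourhood_eq : arcNeighbourhood p q =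
    sphere (0 : Euc p) 1 ×ˢ (ball (0 : EucSucc q) 1 ∩ lowerHalf q) ∩
      {w | ‖w.2.fst‖ ^ 2 < 1 / 4 ∧ -1 / 2 < w.2.snd} := by
  ext w
  rw [mem_inter_iff, mem_prod_ball_lowerHalf]
  constructor
  · rintro ⟨h1, h2, h3, h4⟩
    exact ⟨⟨h1, by nlinarith, h4⟩, h2, h3⟩
  · rintro ⟨⟨h1, h2, h3⟩, h4, h5⟩
    exact ⟨h1, h4, h5, h3⟩

theorem isOpenSmoothEmbeddingOn_arcNeighbourhood
    (hF : IsOpenSmoothEmbeddingOn 𝓘(ℝ, Euc p × EucSucc q) I F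
      (sphere 0 1 ×ˢ (ball 0 1 ∩ lowerHalf q))) :
    IsOpenSmoothEmbeddingOn 𝓘(ℝ, Euc p × EucSucc q) I F (arcNeighbourhood p q) := by
  have o1 : IsOpen {w : Euc p × EucSucc q | ‖w.2.fst‖ ^ 2 < 1 / 4} :=
    isOpen_lt (by fun_prop) (by fun_prop)
  have o2 : IsOpen {w : Euc p × EucSucc q | -1 / 2 < w.2.snd} :=
    isOpen_lt (by fun_prop) (by fun_prop)
  rw [arcNeighbourhood_eq]
  exact hF.inter_open (o1.inter o2)

theorem arcNeighbourhood_subset :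
    arcNeighbourhood p q ⊆ sphere (0 : Euc p) 1 ×ˢ (ball (0 : EucSucc q) 1 ∩ lowerHalf q) := by
  rw [arcNeighbourhood_eq]
  exact inter_subset_left

/-- The complement of the first attaching sphere is disjoint from the second attaching sphere, which
lies in the core `{0} × S_-^q` of the first handle. -/
theorem old_mem_compl_handleCollar (h₁ : IsSurgeryAlong I J (lowerHalf q) F a₁ b₁) {x : X}
    (hx : x ∈ (F '' (sphere 0 1 ×ˢ {0}))ᶜ) :
    a₁ x ∈ ((b₁ ∘ handleCollar) '' (sphere (0 : Euc q) 1 ×ˢ {(0 : EucSucc p)}))ᶜ := by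
  rintro ⟨⟨v, w⟩, ⟨hv, hw⟩, h⟩
  obtain rfl : w = 0 := hw
  have e : handleCollar (v, (0 : EucSucc p)) = (0, WithLp.toLp 2 (v, 0)) := handleCollar_zero v 0
  rw [Function.comp_apply, e] at h
  refine h₁.new_zero_notMem (v := WithLp.toLp 2 (v, 0)) ⟨?_, (le_refl (0 : ℝ) :)⟩
    ⟨x, hx, h.symm⟩
  rw [mem_sphere_eucSucc]
  simp [mem_sphere_zero_iff_norm.1 hv]

theorem new_mem_compl_handleCollar
    (hb : IsOpenSmoothEmbeddingOn 𝓘(ℝ, Euc p × EucSucc q) J b₁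
      (ball 0 1 ×ˢ (sphere 0 1 ∩ lowerHalf q))) {x : Euc p × EucSucc q}
    (hx : x ∈ ball (0 : Euc p) 1 ×ˢ (sphere (0 : EucSucc q) 1 ∩ lowerHalf q)) (hx0 : x.2.snd ≠ 0) :
    b₁ x ∈ ((b₁ ∘ handleCollar) '' (sphere (0 : Euc q) 1 ×ˢ {(0 : EucSucc p)}))ᶜ := by
  rintro ⟨⟨v, w⟩, ⟨hv, hw⟩, h⟩
  obtain rfl : w = 0 := hw
  have e : handleCollar (v, (0 : EucSucc p)) = (0, WithLp.toLp 2 (v, 0)) := handleCollar_zero v 0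
  rw [Function.comp_apply, e] at h
  have hm : ((0 : Euc p), (WithLp.toLp 2 (v, 0) : EucSucc q)) ∈
      ball (0 : Euc p) 1 ×ˢ (sphere (0 : EucSucc q) 1 ∩ lowerHalf q) := by
    refine ⟨mem_ball_self one_pos, ?_, (le_refl (0 : ℝ) :)⟩
    rw [mem_sphere_eucSucc]
    simp [mem_sphere_zero_iff_norm.1 hv]
  rw [← hb.injOn hm hx h] at hx0
  exact hx0 rfl

theorem dualOld_of_mem
    (hg : ∀ w ∈ sphere (0 : Euc p) 1 ×ˢ (ball (0 : EucSucc q) 1 ∩ lowerHalf q), g (F w) = w)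
    {w : Euc p × EucSucc q} (hw : w ∈ arcNeighbourhood p q) :
    dualOld F g a₁ a₂ b₂ (F w) = b₂ (handleCollar (slopeMap w)) := by
  rw [dualOld, if_pos (mem_image_of_mem F hw), hg w (arcNeighbourhood_subset hw)]

theorem dualOld_of_notMem (h₁ : IsSurgeryAlong I J (lowerHalf q) F a₁ b₁)
    (h₂ : IsSurgeryAlong J J' (lowerHalf p) (b₁ ∘ handleCollar) a₂ b₂)
    (hg : ∀ w ∈ sphere (0 : Euc p) 1 ×ˢ (ball (0 : EucSucc q) 1 ∩ lowerHalf q), g (F w) = w)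
    {x : X} (hx : x ∈ (F '' arcSet p q)ᶜ) :
    dualOld F g a₁ a₂ b₂ x = a₂ (a₁ (arcSlide F g x)) := by
  by_cases hxN : x ∈ F '' arcNeighbourhood p q
  · obtain ⟨w, hw, rfl⟩ := hxN
    have hwD := arcNeighbourhood_subset hw
    have hw0 : w.2.fst ≠ 0 := fun h => hx ⟨w, ⟨hw.1, h, hw.2.2.1.le, hw.2.2.2⟩, rfl⟩
    have hd := slopeMap_mem hw
    rw [dualOld_of_mem hg hw, arcSlide_apply hg hwD, slideMap,
      slide_eq_mul_slope (sq_nonneg _) hw.2.1 hw.2.2.1 hw.2.2.2]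
    exact (old_old_eq_new h₁ h₂ hw.1 hw0 hd.2.2 hd.2.1).symm
  · rw [dualOld, if_neg hxN]

theorem handleCollar_slopeMap_fst {w : Euc p × EucSucc q} (hw : w.2.fst = 0) :
    (handleCollar (slopeMap w)).1 = 0 := by
  show _ • w.2.fst = 0
  rw [hw, smul_zero]

theorem notMem_old_of_fst_eq_zero
    (h₂ : IsSurgeryAlong J J' (lowerHalf p) (b₁ ∘ handleCollar) a₂ b₂) {x : Euc q × EucSucc p}
    (hx : x ∈ ball (0 : Euc q) 1 ×ˢ (sphere (0 : EucSucc p) 1 ∩ lowerHalf p)) (hx0 : x.1 = 0) :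
    b₂ x ∉ a₂ '' ((b₁ ∘ handleCollar) '' (sphere 0 1 ×ˢ {0}))ᶜ := by
  have : x = (0, x.2) := by rw [← hx0]
  rw [this]
  exact h₂.new_zero_notMem hx.2

theorem handleCollar_mem {w : Euc p × EucSucc q} (hw : w ∈ handleCollarDomain p q) :
    handleCollar w ∈ ball (0 : Euc q) 1 ×ˢ (sphere (0 : EucSucc p) 1 ∩ lowerHalf p) :=
  (handleCollar_mem_target hw).1

theorem coreMap_zero (u : Euc p) :
    coreMap (u, (0 : EucSucc q)) = (u, WithLp.toLp 2 (0, -1 / 2)) := by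
  simp [coreMap]
  norm_num

end DualSurgery

/-! ### The inclusions into the result of both attachments -/

section DualSurgery

variable {p q : ℕ} {E H X : Type*} [NormedAddCommGroup E] [NormedSpace ℝ E] [TopologicalSpace H]
  [TopologicalSpace X] [ChartedSpace H X]
  {E' H' Y : Type*} [NormedAddCommGroup E'] [NormedSpace ℝ E'] [TopologicalSpace H']
  [TopologicalSpace Y] [ChartedSpace H' Y]
  {E'' H'' Z : Type*} [NormedAddCommGroup E''] [NormedSpace ℝ E''] [TopologicalSpace H'']
  [TopologicalSpace Z] [ChartedSpace H'' Z]
  {I : ModelWithCorners ℝ E H} {J : ModelWithCorners ℝ E' H'} {J' : ModelWithCorners ℝ E'' H''}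
  {F : Euc p × EucSucc q → X} {g : X → Euc p × EucSucc q} {a₁ : X → Y}
  {b₁ : Euc p × EucSucc q → Y} {a₂ : Y → Z} {b₂ : Euc q × EucSucc p → Z}

theorem mem_coreMap_image {x : X} :
    x ∈ (F ∘ coreMap) '' (sphere (0 : Euc p) 1 ×ˢ {(0 : EucSucc q)}) ↔
      ∃ u ∈ sphere (0 : Euc p) 1, F (u, WithLp.toLp 2 (0, -1 / 2)) = x := by
  constructor
  · rintro ⟨⟨u, w⟩, ⟨hu, hw⟩, rfl⟩
    obtain rfl : w = 0 := hw
    exact ⟨u, hu, by rw [Function.comp_apply, coreMap_zero]⟩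
  · rintro ⟨u, hu, rfl⟩
    exact ⟨(u, 0), ⟨hu, rfl⟩, by rw [Function.comp_apply, coreMap_zero]⟩

theorem coreMap_zero_mem_arcSet {u : Euc p} (hu : u ∈ sphere (0 : Euc p) 1) :
    (u, (WithLp.toLp 2 (0, -1 / 2) : EucSucc q)) ∈ arcSet p q :=
  ⟨mem_sphere_zero_iff_norm.1 hu, rfl, le_refl _, by norm_num⟩

theorem coreMap_image_subset :
    (F ∘ coreMap) '' (sphere (0 : Euc p) 1 ×ˢ {(0 : EucSucc q)}) ⊆ F '' arcSet p q := by
  intro x hx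
  obtain ⟨u, hu, rfl⟩ := mem_coreMap_image.1 hx
  exact mem_image_of_mem F (coreMap_zero_mem_arcSet hu)

theorem arcNeighbourhood_mem_compl_core
    (hF : InjOn F (sphere 0 1 ×ˢ (ball 0 1 ∩ lowerHalf q)))
    {w : Euc p × EucSucc q} (hw : w ∈ arcNeighbourhood p q) :
    F w ∈ ((F ∘ coreMap) '' (sphere (0 : Euc p) 1 ×ˢ {(0 : EucSucc q)}))ᶜ := by
  intro h
  obtain ⟨u, hu, h⟩ := mem_coreMap_image.1 h
  have := hF (arcSet_subset (coreMap_zero_mem_arcSet hu)) (arcNeighbourhood_subset hw) h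
  have h3 := hw.2.2.1
  rw [← this] at h3
  exact lt_irrefl _ h3

theorem exists_arcNeighbourhood_of_mem_arc {x : X}
    (hx : x ∈ ((F ∘ coreMap) '' (sphere (0 : Euc p) 1 ×ˢ {(0 : EucSucc q)}))ᶜ)
    (hx' : x ∈ F '' arcSet p q) : ∃ w ∈ arcNeighbourhood p q, w.2.fst = 0 ∧ F w = x := by
  obtain ⟨⟨u, w⟩, hw, rfl⟩ := hx'
  have hw0 : w.fst = 0 := hw.2.1
  have hlt : w.snd ≠ -1 / 2 := by
    intro h
    refine hx (mem_coreMap_image.2 ⟨u, mem_sphere_zero_iff_norm.2 hw.1, ?_⟩)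
    rw [← h, ← hw0]
    rfl
  refine ⟨(u, w), ⟨hw.1, ?_, lt_of_le_of_ne hw.2.2.1 hlt.symm, hw.2.2.2⟩, hw0, rfl⟩
  show ‖w.fst‖ ^ 2 < 1 / 4
  rw [hw0]
  norm_num

/-- The two formulas for `dualOld` are open smooth embeddings on a neighbourhood of the half-open arcs
and on the complement of the arcs, and they agree on the overlap. For injectivity, the half-open arcs
are mapped to the core `{0} × S_-^p` of the second handle, which is disjoint from the image of
`a₂`. -/
theorem isOpenSmoothEmbeddingOn_dualOld [T2Space X]
    (h₁ : IsSurgeryAlong I J (lowerHalf q) F a₁ b₁)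
    (h₂ : IsSurgeryAlong J J' (lowerHalf p) (b₁ ∘ handleCollar) a₂ b₂)
    (hg : ∀ w ∈ sphere (0 : Euc p) 1 ×ˢ (ball (0 : EucSucc q) 1 ∩ lowerHalf q), g (F w) = w) :
    IsOpenSmoothEmbeddingOn I J' (dualOld F g a₁ a₂ b₂)
      ((F ∘ coreMap) '' (sphere 0 1 ×ˢ {0}))ᶜ := by
  have hF := h₁.embedding
  have hN := isOpenSmoothEmbeddingOn_arcNeighbourhood hF
  have hs := isOpenSmoothEmbeddingOn_arcSlide hF hg
  have e1 : IsOpenSmoothEmbeddingOn I J' (dualOld F g a₁ a₂ b₂) (F '' arcNeighbourhood p q) := by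
    refine (hN.transition (isOpenSmoothEmbeddingOn_slope
      (isOpenSmoothEmbeddingOn_handleCollar h₂.new_part)) (f' := g)
        fun w hw => hg w (arcNeighbourhood_subset hw)).congr ?_
    rintro _ ⟨w, hw, rfl⟩
    rw [dualOld_of_mem hg hw]
    simp only [Function.comp_apply, hg w (arcNeighbourhood_subset hw)]
  have e2 : IsOpenSmoothEmbeddingOn I J' (dualOld F g a₁ a₂ b₂) (F '' arcSet p q)ᶜ := by
    refine (h₂.old_part.comp (h₁.old_part.comp hs.1 ?_) ?_).congr
      fun x hx => dualOld_of_notMem h₁ h₂ hg hx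
    · exact fun x hx => hs.2 ▸ mem_image_of_mem _ hx
    · exact fun x hx => old_mem_compl_handleCollar h₁ (hs.2 ▸ mem_image_of_mem _ hx)
  have hU : IsOpen (F '' arcSet p q)ᶜ := by
    refine (IsCompact.isClosed ?_).isOpen_compl
    exact isCompact_arcSet.image_of_continuousOn (hF.2.1.continuousOn.mono arcSet_subset)
  have hmix := fun x hx hx' => exists_arcNeighbourhood_of_mem_arc (F := F) (x := x) hx hx'
  have hnot : ∀ x ∈ ((F ∘ coreMap) '' (sphere (0 : Euc p) 1 ×ˢ {(0 : EucSucc q)}))ᶜ,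
      x ∈ F '' arcSet p q → ∀ y ∈ (F '' arcSet p q)ᶜ,
      dualOld F g a₁ a₂ b₂ x ≠ dualOld F g a₁ a₂ b₂ y := by
    intro x hx hx' y hy h
    obtain ⟨w, hw, hw0, rfl⟩ := hmix x hx hx'
    rw [dualOld_of_mem hg hw, dualOld_of_notMem h₁ h₂ hg hy] at h
    refine notMem_old_of_fst_eq_zero h₂ (handleCollar_mem (slopeMap_mem hw))
      (handleCollar_slopeMap_fst hw0) ?_
    rw [h]
    exact mem_image_of_mem _ (old_mem_compl_handleCollar h₁ (hs.2 ▸ mem_image_of_mem _ hy))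
  refine IsOpenSmoothEmbeddingOn.of_union hN.1 hU ?_ ?_ ?_ ?_
  · intro x hx
    by_cases hx' : x ∈ F '' arcSet p q
    · obtain ⟨w, hw, -, rfl⟩ := hmix x hx hx'
      exact Or.inl (mem_image_of_mem F hw)
    · exact Or.inr hx'
  · convert e1 using 1
    refine inter_eq_right.2 ?_
    rintro _ ⟨w, hw, rfl⟩
    exact arcNeighbourhood_mem_compl_core hF.injOn hw
  · convert e2 using 1
    exact inter_eq_right.2 (compl_subset_compl.2 coreMap_image_subset)
  · intro x hx y hy h
    by_cases hx' : x ∈ F '' arcSet p q <;> by_cases hy' : y ∈ F '' arcSet p q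
    · obtain ⟨w, hw, -, rfl⟩ := hmix x hx hx'
      obtain ⟨w', hw', -, rfl⟩ := hmix y hy hy'
      exact e1.injOn (mem_image_of_mem F hw) (mem_image_of_mem F hw') h
    · exact absurd h (hnot x hx hx' y hy')
    · exact absurd h.symm (hnot y hy hy' x hx')
    · exact e2.injOn hx' hy' h

theorem new_lowerChart_mem (h₁ : IsSurgeryAlong I J (lowerHalf q) F a₁ b₁)
    {x : Euc p × EucSucc q} (hx : x ∈ lowerChartSource p q) :
    b₁ (lowerChart x) ∈ ((b₁ ∘ handleCollar) '' (sphere (0 : Euc q) 1 ×ˢ {(0 : EucSucc p)}))ᶜ :=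
  new_mem_compl_handleCollar h₁.new_part (lowerChart_mem hx).1
    (show (lowerChart x).2.snd < 0 from (lowerChart_mem hx).2.1).ne

theorem dualNew_of_ne
    (h₂ : IsSurgeryAlong J J' (lowerHalf p) (b₁ ∘ handleCollar) a₂ b₂) {x : Euc p × EucSucc q}
    (hx : x ∈ lowerChartSource p q) : dualNew b₁ a₂ b₂ x = a₂ (b₁ (lowerChart x)) := by
  by_cases h : 0 < x.2.snd
  · rw [dualNew, if_pos h, old_lowerChart_eq_upperChart h₂ ⟨hx.1, h⟩ hx.2]
  · rw [dualNew, if_neg h]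

theorem dualNew_of_pos {x : Euc p × EucSucc q} (h : 0 < x.2.snd) :
    dualNew b₁ a₂ b₂ x = b₂ (upperChart x) := by
  rw [dualNew, if_pos h]

/-- The two formulas for `dualNew` agree on the overlap of their domains, so that only the pole has to
be told apart from the other points. It is mapped to the core of the second handle. -/
theorem isOpenSmoothEmbeddingOn_dualNew
    (h₁ : IsSurgeryAlong I J (lowerHalf q) F a₁ b₁)
    (h₂ : IsSurgeryAlong J J' (lowerHalf p) (b₁ ∘ handleCollar) a₂ b₂) :
    IsOpenSmoothEmbeddingOn 𝓘(ℝ, Euc p × EucSucc q) J' (dualNew b₁ a₂ b₂)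
      (ball 0 1 ×ˢ sphere 0 1) := by
  have e1 : IsOpenSmoothEmbeddingOn 𝓘(ℝ, Euc p × EucSucc q) J' (dualNew b₁ a₂ b₂)
      (upperChartSource p q) :=
    (isOpenSmoothEmbeddingOn_upperChart h₂.new_part).congr fun x hx => dualNew_of_pos hx.2
  have e2 : IsOpenSmoothEmbeddingOn 𝓘(ℝ, Euc p × EucSucc q) J' (dualNew b₁ a₂ b₂)
      (lowerChartSource p q) :=
    (h₂.old_part.comp (isOpenSmoothEmbeddingOn_lowerChart h₁.new_part)
      fun x hx => new_lowerChart_mem h₁ hx).congr fun x hx => dualNew_of_ne h₂ hx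
  have o1 : IsOpen {x : Euc p × EucSucc q | 0 < x.2.snd} := isOpen_lt (by fun_prop) (by fun_prop)
  have o2 : IsOpen {x : Euc p × EucSucc q | x.2 ≠ WithLp.toLp 2 (0, 1)} :=
    isOpen_ne_fun continuous_snd continuous_const
  have hpole : ∀ x : Euc p × EucSucc q, x.2 = WithLp.toLp 2 (0, 1) → 0 < x.2.snd := by
    intro x hx
    rw [hx]
    exact one_pos
  have hnot : ∀ x ∈ ball (0 : Euc p) 1 ×ˢ sphere (0 : EucSucc q) 1, x.2 = WithLp.toLp 2 (0, 1) →
      ∀ y ∈ lowerChartSource p q, dualNew b₁ a₂ b₂ x ≠ dualNew b₁ a₂ b₂ y := by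
    intro x hx hx' y hy h
    have hxu : x ∈ upperChartSource p q := ⟨hx, hpole x hx'⟩
    rw [dualNew_of_pos hxu.2, dualNew_of_ne h₂ hy] at h
    refine notMem_old_of_fst_eq_zero h₂ (upperChart_mem hxu).1 ?_
      (h ▸ mem_image_of_mem a₂ (new_lowerChart_mem h₁ hy))
    show upperRoot x • x.2.fst = 0
    rw [hx']
    exact smul_zero _
  refine IsOpenSmoothEmbeddingOn.of_union o1 o2 ?_ e1 e2 ?_
  · intro x hx
    by_cases h : x.2 = WithLp.toLp 2 (0, 1)
    · exact Or.inl (hpole x h)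
    · exact Or.inr h
  · intro x hx y hy h
    by_cases hx' : x.2 = WithLp.toLp 2 (0, 1) <;> by_cases hy' : y.2 = WithLp.toLp 2 (0, 1)
    · exact e1.injOn ⟨hx, hpole x hx'⟩ ⟨hy, hpole y hy'⟩ h
    · exact absurd h (hnot x hx hx' y ⟨hy, hy'⟩)
    · exact absurd h.symm (hnot y hy hy' x ⟨hx, hx'⟩)
    · exact e2.injOn ⟨hx, hx'⟩ ⟨hy, hy'⟩ h

end DualSurgery

/-! ### Both attachments as a single surgery -/

section DualSurgery

variable {p q : ℕ} {E H X : Type*} [NormedAddCommGroup E] [NormedSpace ℝ E] [TopologicalSpace H]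
  [TopologicalSpace X] [ChartedSpace H X]
  {E' H' Y : Type*} [NormedAddCommGroup E'] [NormedSpace ℝ E'] [TopologicalSpace H']
  [TopologicalSpace Y] [ChartedSpace H' Y]
  {E'' H'' Z : Type*} [NormedAddCommGroup E''] [NormedSpace ℝ E''] [TopologicalSpace H'']
  [TopologicalSpace Z] [ChartedSpace H'' Z]
  {I : ModelWithCorners ℝ E H} {J : ModelWithCorners ℝ E' H'} {J' : ModelWithCorners ℝ E'' H''}
  {F : Euc p × EucSucc q → X} {g : X → Euc p × EucSucc q} {a₁ : X → Y}
  {b₁ : Euc p × EucSucc q → Y} {a₂ : Y → Z} {b₂ : Euc q × EucSucc p → Z}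

theorem snd_eq_neg_one_of_fst_eq_zero {d : ℕ} {w : EucSucc d}
    (hw : w ∈ sphere (0 : EucSucc d) 1) (h0 : w.fst = 0) (h1 : w.snd < 1) : w.snd = -1 := by
  rw [mem_sphere_eucSucc, h0] at hw
  have : (w.snd - 1) * (w.snd + 1) = 0 := by
    rw [norm_zero] at hw
    linear_combination hw
  rcases mul_eq_zero.1 this with h | h <;> linarith

theorem coreMap_notMem_arcSet {u : Euc p} {w : EucSucc q} (hu : u ∈ sphere (0 : Euc p) 1)
    (hw : w ∈ sphere (0 : EucSucc q) 1) (hw1 : w.snd < 1) {θ : ℝ} (hθ : θ ∈ Ioo (0 : ℝ) 1) :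
    coreMap (u, θ • w) ∉ arcSet p q := by
  have hmem : (u, θ • w) ∈ sphere (0 : Euc p) 1 ×ˢ ball (0 : EucSucc q) 1 := by
    refine ⟨hu, ?_⟩
    rw [mem_ball_zero_iff, norm_smul, mem_sphere_zero_iff_norm.1 hw, mul_one,
      Real.norm_of_nonneg hθ.1.le]
    exact hθ.2
  rw [notMem_arcSet (coreMap_mem hmem).1]
  by_contra! h
  have hfst : (1 / 4 : ℝ) • θ • w.fst = 0 := h.1
  have hw0 : w.fst = 0 := by
    simpa [hθ.1.ne'] using hfst
  have hsnd : -1 / 2 ≤ -(θ * w.snd / 4 + 2)⁻¹ := h.2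
  rw [snd_eq_neg_one_of_fst_eq_zero hw hw0 hw1] at hsnd
  have h2 : (2 : ℝ)⁻¹ < (θ * -1 / 4 + 2)⁻¹ := by
    apply inv_strictAnti₀ <;> linarith [hθ.1, hθ.2]
  linarith

theorem lowerRoot_lt_two {w : EucSucc q} (hw : w ∈ sphere (0 : EucSucc q) 1) :
    lowerRoot w < 2 := by
  have h := mem_sphere_eucSucc.1 hw
  have h1 : lowerRoot w ^ 2 < 2 ^ 2 := by
    rw [lowerRoot_sq]
    nlinarith [sq_nonneg ‖w.fst‖, sq_nonneg (w.snd + 1)]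
  exact lt_of_pow_lt_pow_left₀ 2 (by norm_num) h1

theorem pole_snd_pos : (0 : ℝ) < (WithLp.toLp 2 (0, 1) : EucSucc q).snd := by
  rw [WithLp.toLp_snd]
  exact one_pos

/-- The gluing relation at the pole `(0, 1)` of `S^q`. Here `coreMap (u, θ w)` is a point of a half-open
arc, and the comparison takes place in the core of the second handle. -/
theorem handleCollar_slopeMap_coreMap_pole {u : Euc p} (hu : ‖u‖ = 1) {θ : ℝ}
    (hθ : θ ∈ Ioo (0 : ℝ) 1) :
    handleCollar (slopeMap (coreMap (u, θ • (WithLp.toLp 2 (0, 1) : EucSucc q)))) =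
      upperChart (θ • u, (WithLp.toLp 2 (0, 1) : EucSucc q)) := by
  have hθ0 := hθ.1
  have hfst : (coreMap (u, θ • (WithLp.toLp 2 (0, 1) : EucSucc q))).2.fst = 0 := by
    show (1 / 4 : ℝ) • θ • (0 : Euc q) = 0
    rw [smul_zero, smul_zero]
  have hsnd : (coreMap (u, θ • (WithLp.toLp 2 (0, 1) : EucSucc q))).2.snd =
      -(θ / 4 + 2)⁻¹ := by
    show -(θ * 1 / 4 + 2)⁻¹ = _
    rw [mul_one]
  have hslope : slideSlope 0 (-(θ / 4 + 2)⁻¹) = -(32 * θ)⁻¹ := by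
    have h1 : 1 + 2 * -(θ / 4 + 2)⁻¹ = (θ / 4) * (θ / 4 + 2)⁻¹ := by
      field_simp
      ring
    rw [slideSlope, slideRoot, h1, zero_mul, zero_add, Real.sqrt_sq (by positivity)]
    field_simp
    ring
  have hs : slopeMap (coreMap (u, θ • (WithLp.toLp 2 (0, 1) : EucSucc q))) =
      (u, WithLp.toLp 2 (0, -(32 * θ)⁻¹)) := by
    rw [slopeMap, hfst, hsnd, norm_zero, zero_pow two_ne_zero, hslope]
    rfl
  rw [hs]
  have hr : upperRoot (θ • u, (WithLp.toLp 2 (0, 1) : EucSucc q)) =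
      θ / 4 * √(1 + (-(32 * θ)⁻¹) ^ 2) := by
    have h1 : 1 + (-(32 * θ)⁻¹) ^ 2 ≥ 0 := by positivity
    rw [upperRoot, Real.sqrt_eq_iff_mul_self_eq (by positivity) (by positivity)]
    have h2 : √(1 + (-(32 * θ)⁻¹) ^ 2) ^ 2 = 1 + (-(32 * θ)⁻¹) ^ 2 := Real.sq_sqrt h1
    rw [show θ / 4 * √(1 + (-(32 * θ)⁻¹) ^ 2) * (θ / 4 * √(1 + (-(32 * θ)⁻¹) ^ 2)) =
      (θ / 4) ^ 2 * √(1 + (-(32 * θ)⁻¹) ^ 2) ^ 2 by ring, h2]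
    simp only [norm_smul, hu, mul_one, Real.norm_of_nonneg hθ0.le, WithLp.toLp_snd]
    field_simp
    ring
  have hpos : 0 < √(1 + (-(32 * θ)⁻¹) ^ 2) := Real.sqrt_pos.2 (by positivity)
  simp only [handleCollar, upperChart, hr, WithLp.toLp_fst, WithLp.toLp_snd, smul_zero]
  generalize √(1 + (-(32 * θ)⁻¹) ^ 2) = s at hpos
  rw [← WithLp.toLp_smul, ← WithLp.toLp_smul, Prod.smul_mk, Prod.smul_mk, smul_smul, smul_smul,
    smul_eq_mul, smul_eq_mul]
  have e1 : (θ / 4 * s)⁻¹ * (1 / 4) * θ = s⁻¹ := by field_simp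
  have e2 : (θ / 4 * s)⁻¹ * -(1 / (64 * (1 + 1))) = s⁻¹ * -(32 * θ)⁻¹ := by
    field_simp
    norm_num
  rw [e1, e2]

/-- The gluing relation of the surgery that results from both handle attachments. Away from the pole
it follows from that of the first handle by means of `slideMap_coreMap`. -/
theorem dualOld_coreMap (h₁ : IsSurgeryAlong I J (lowerHalf q) F a₁ b₁)
    (h₂ : IsSurgeryAlong J J' (lowerHalf p) (b₁ ∘ handleCollar) a₂ b₂)
    (hg : ∀ w ∈ sphere (0 : Euc p) 1 ×ˢ (ball (0 : EucSucc q) 1 ∩ lowerHalf q), g (F w) = w)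
    {u : Euc p} {w : EucSucc q} (hu : u ∈ sphere (0 : Euc p) 1)
    (hw : w ∈ sphere (0 : EucSucc q) 1) {θ : ℝ} (hθ : θ ∈ Ioo (0 : ℝ) 1) :
    dualNew b₁ a₂ b₂ (θ • u, w) = dualOld F g a₁ a₂ b₂ (F (coreMap (u, θ • w))) := by
  have hu1 : ‖u‖ = 1 := mem_sphere_zero_iff_norm.1 hu
  have hball : θ • u ∈ ball (0 : Euc p) 1 := by
    rw [mem_ball_zero_iff, norm_smul, hu1, mul_one, Real.norm_of_nonneg hθ.1.le]
    exact hθ.2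
  have hmem : (u, θ • w) ∈ sphere (0 : Euc p) 1 ×ˢ ball (0 : EucSucc q) 1 := by
    refine ⟨hu, ?_⟩
    rw [mem_ball_zero_iff, norm_smul, mem_sphere_zero_iff_norm.1 hw, mul_one,
      Real.norm_of_nonneg hθ.1.le]
    exact hθ.2
  by_cases he : w = WithLp.toLp 2 (0, 1)
  · subst he
    have hN : coreMap (u, θ • (WithLp.toLp 2 (0, 1) : EucSucc q)) ∈ arcNeighbourhood p q := by
      have ht : (coreMap (u, θ • (WithLp.toLp 2 (0, 1) : EucSucc q))).2.snd =
          -(θ / 4 + 2)⁻¹ := by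
        show -(θ * 1 / 4 + 2)⁻¹ = _
        rw [mul_one]
      have h2 : (θ / 4 + 2)⁻¹ < (2 : ℝ)⁻¹ := by
        apply inv_strictAnti₀ <;> linarith [hθ.1]
      have h3 : 0 < (θ / 4 + 2)⁻¹ := inv_pos.2 (by linarith [hθ.1])
      refine ⟨hu1, ?_, ?_, ?_⟩
      · show ‖(1 / 4 : ℝ) • θ • (0 : Euc q)‖ ^ 2 < 1 / 4
        rw [smul_zero, smul_zero]
        norm_num
      · rw [ht]
        linarith
      · rw [ht]
        linarith
    rw [dualOld_of_mem hg hN, handleCollar_slopeMap_coreMap_pole hu1 hθ,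
      dualNew_of_pos pole_snd_pos]
  · have hw1 := snd_lt_one hw he
    have hx : (θ • u, w) ∈ lowerChartSource p q := ⟨⟨hball, hw⟩, he⟩
    have hn := lowerRoot_pos hw1
    have hcm := (coreMap_mem hmem).1
    have hna : F (coreMap (u, θ • w)) ∈ (F '' arcSet p q)ᶜ := by
      rintro ⟨z, hz, hzc⟩
      rw [h₁.embedding.injOn (arcSet_subset hz) hcm hzc] at hz
      exact coreMap_notMem_arcSet hu hw hw1 hθ hz
    rw [dualNew_of_ne h₂ hx, dualOld_of_notMem h₁ h₂ hg hna, arcSlide_apply hg hcm,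
      slideMap_coreMap hu hw hθ]
    have hn2 := lowerRoot_lt_two hw
    have hθ0 := hθ.1
    have hθ' : lowerRoot w / 4 * θ ∈ Ioo (0 : ℝ) 1 := ⟨by positivity, by nlinarith [hθ.2]⟩
    have h := h₁.new_eq_old smul_mem_lowerHalf zero_mem_lowerHalf hu1 hθ' (lowerChart_mem hx).1.2
    have e1 : lowerChart (θ • u, w) = ((lowerRoot w / 4 * θ) • u, (lowerChart (θ • u, w)).2) := by
      simp only [lowerChart, smul_smul]
    have e2 : (lowerRoot w / 4 * θ) • (lowerChart (θ • u, w)).2 =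
        (θ / 4) • WithLp.toLp 2 (w.fst, -(1 - w.snd) / 64) := by
      simp only [lowerChart, smul_smul]
      congr 1
      field_simp
    rw [e1, h, e2]

/-- The core `{0} × S^q` of the new part is disjoint from the old part. The pole is the pole of the
core of the second handle; all other points lie in the core of the first one. -/
theorem dualNew_zero_notMem (h₁ : IsSurgeryAlong I J (lowerHalf q) F a₁ b₁)
    (h₂ : IsSurgeryAlong J J' (lowerHalf p) (b₁ ∘ handleCollar) a₂ b₂) [T2Space X]
    (hg : ∀ w ∈ sphere (0 : Euc p) 1 ×ˢ (ball (0 : EucSucc q) 1 ∩ lowerHalf q), g (F w) = w)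
    {w : EucSucc q} (hw : w ∈ sphere (0 : EucSucc q) 1) :
    dualNew b₁ a₂ b₂ (0, w) ∉ dualOld F g a₁ a₂ b₂ ''
      ((F ∘ coreMap) '' (sphere (0 : Euc p) 1 ×ˢ {(0 : EucSucc q)}))ᶜ := by
  have hs := isOpenSmoothEmbeddingOn_arcSlide h₁.embedding hg
  rintro ⟨x, hx, h⟩
  by_cases hx' : x ∈ F '' arcSet p q
  · obtain ⟨c, hc, hc0, rfl⟩ := exists_arcNeighbourhood_of_mem_arc hx hx'
    rw [dualOld_of_mem hg hc] at h
    by_cases he : w = WithLp.toLp 2 (0, 1)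
    · have hu : ((0 : Euc p), w) ∈ upperChartSource p q := by
        refine ⟨⟨mem_ball_self one_pos, hw⟩, ?_⟩
        rw [he]
        exact pole_snd_pos
      rw [dualNew_of_pos hu.2] at h
      have := h₂.new_part.injOn (handleCollar_mem (slopeMap_mem hc)) (upperChart_mem hu).1 h
      refine (handleCollar_mem_target (slopeMap_mem hc)).2 ?_
      rw [this]
      show (upperRoot ((0 : Euc p), w))⁻¹ • (1 / 4 : ℝ) • (0 : Euc p) = 0
      rw [smul_zero, smul_zero]
    · have hl : ((0 : Euc p), w) ∈ lowerChartSource p q := ⟨⟨mem_ball_self one_pos, hw⟩, he⟩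
      rw [dualNew_of_ne h₂ hl] at h
      refine notMem_old_of_fst_eq_zero h₂ (handleCollar_mem (slopeMap_mem hc))
        (handleCollar_slopeMap_fst hc0) ?_
      rw [h]
      exact mem_image_of_mem a₂ (new_lowerChart_mem h₁ hl)
  · rw [dualOld_of_notMem h₁ h₂ hg hx'] at h
    have hold := hs.2 ▸ mem_image_of_mem (arcSlide F g) hx'
    by_cases he : w = WithLp.toLp 2 (0, 1)
    · have hu : ((0 : Euc p), w) ∈ upperChartSource p q := by
        refine ⟨⟨mem_ball_self one_pos, hw⟩, ?_⟩
        rw [he]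
        exact pole_snd_pos
      rw [dualNew_of_pos hu.2] at h
      refine notMem_old_of_fst_eq_zero h₂ (upperChart_mem hu).1 ?_
        (h ▸ mem_image_of_mem a₂ (old_mem_compl_handleCollar h₁ hold))
      show upperRoot ((0 : Euc p), w) • w.fst = 0
      rw [he]
      exact smul_zero _
    · have hl : ((0 : Euc p), w) ∈ lowerChartSource p q := ⟨⟨mem_ball_self one_pos, hw⟩, he⟩
      rw [dualNew_of_ne h₂ hl] at h
      have h' := h₂.old_part.injOn (old_mem_compl_handleCollar h₁ hold)
        (new_lowerChart_mem h₁ hl) h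
      have e : lowerChart ((0 : Euc p), w) = (0, (lowerChart ((0 : Euc p), w)).2) := by
        simp only [lowerChart, smul_zero]
      rw [e] at h'
      exact h₁.new_zero_notMem (lowerChart_mem hl).1.2 ⟨_, hold, h'⟩

/-- The old part and the core `{0} × S^q` of the new part cover everything. The core of the first
handle, without the second attaching sphere, is the core of the new part without its pole; the core
of the second handle consists of the half-open arcs and the pole. -/
theorem dual_cover (h₁ : IsSurgeryAlong I J (lowerHalf q) F a₁ b₁)
    (h₂ : IsSurgeryAlong J J' (lowerHalf p) (b₁ ∘ handleCollar) a₂ b₂) [T2Space X]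
    (hg : ∀ w ∈ sphere (0 : Euc p) 1 ×ˢ (ball (0 : EucSucc q) 1 ∩ lowerHalf q), g (F w) = w)
    (y : Z) :
    y ∈ dualOld F g a₁ a₂ b₂ '' ((F ∘ coreMap) '' (sphere (0 : Euc p) 1 ×ˢ {(0 : EucSucc q)}))ᶜ ∨
      ∃ w ∈ sphere (0 : EucSucc q) 1, y = dualNew b₁ a₂ b₂ (0, w) := by
  have hs := isOpenSmoothEmbeddingOn_arcSlide h₁.embedding hg
  rcases h₂.mem_old_or_new_zero smul_mem_lowerHalf zero_mem_lowerHalf y with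
    ⟨y', hy', rfl⟩ | ⟨v, ⟨hv, hvK⟩, rfl⟩
  · rcases h₁.mem_old_or_new_zero smul_mem_lowerHalf zero_mem_lowerHalf y' with
      ⟨x', hx', rfl⟩ | ⟨v, ⟨hv, hvK⟩, rfl⟩
    · rw [← hs.2] at hx'
      obtain ⟨x, hx, rfl⟩ := hx'
      exact Or.inl ⟨x, compl_subset_compl.2 coreMap_image_subset hx,
        dualOld_of_notMem h₁ h₂ hg hx⟩
    · have hv0 : v.snd ≠ 0 := by
        intro h
        refine hy' ⟨(v.fst, 0), ⟨?_, rfl⟩, ?_⟩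
        · rw [mem_sphere_eucSucc, h] at hv
          rw [mem_sphere_zero_iff_norm, ← pow_eq_one_iff_of_nonneg (norm_nonneg _) two_ne_zero]
          linarith
        · have e : handleCollar (v.fst, (0 : EucSucc p)) = (0, WithLp.toLp 2 (v.fst, 0)) :=
            handleCollar_zero v.fst 0
          rw [Function.comp_apply, e, ← h]
          rfl
      have hvneg : v.snd < 0 := lt_of_le_of_ne hvK hv0
      have ht : ((0 : Euc p), v) ∈ lowerChartTarget p q := by
        refine ⟨hvneg, ?_⟩
        rw [norm_zero, zero_mul]
        show (0 : ℝ) < -(32 * v.snd)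
        linarith
      have hx := lowerChartInv_mem ht
      have h0 : lowerChartInv ((0 : Euc p), v) = (0, (lowerChartInv ((0 : Euc p), v)).2) := by
        simp only [lowerChartInv, smul_zero]
      refine Or.inr ⟨_, hx.1.2, ?_⟩
      rw [← h0, dualNew_of_ne h₂ hx, lowerChart_lowerChartInv (x := ((0 : Euc p), v)) hv ht]
  · by_cases hv0 : v.fst = 0
    · refine Or.inr ⟨WithLp.toLp 2 (0, 1), ?_, ?_⟩
      · rw [mem_sphere_eucSucc]
        simp
      · have hv1 : v.snd = -1 :=
          snd_eq_neg_one_of_fst_eq_zero hv hv0 (by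
            have h : v.snd ≤ 0 := hvK
            linarith)
        rw [dualNew_of_pos pole_snd_pos]
        have hr : upperRoot ((0 : Euc p), (WithLp.toLp 2 (0, 1) : EucSucc q)) = 1 / 128 := by
          rw [upperRoot, Real.sqrt_eq_iff_mul_self_eq (by positivity) (by norm_num)]
          simp only [norm_zero, WithLp.toLp_snd]
          norm_num
        congr 1
        rw [← toLp_fst_snd v, hv0, hv1, upperChart, hr]
        simp only [WithLp.toLp_fst, WithLp.toLp_snd, smul_zero]
        rw [← WithLp.toLp_smul, Prod.smul_mk, smul_zero]
        norm_num
    · have hn : 0 < ‖v.fst‖ := norm_pos_iff.2 hv0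
      have hτ : ‖v.fst‖⁻¹ * v.snd ≤ 0 :=
        mul_nonpos_of_nonneg_of_nonpos (inv_pos.2 hn).le hvK
      obtain ⟨k1, k2, k3⟩ := slideSlope_of_inverse (le_refl (0 : ℝ)) hτ (by norm_num)
      have hN : (‖v.fst‖⁻¹ • v.fst, (WithLp.toLp 2 (0, 128 * (‖v.fst‖⁻¹ * v.snd) /
          (1 - 256 * (‖v.fst‖⁻¹ * v.snd) - 4096 * 0 * (‖v.fst‖⁻¹ * v.snd) ^ 2)) : EucSucc q)) ∈
          arcNeighbourhood p q := by
        refine ⟨?_, ?_, k1, k2⟩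
        · rw [norm_smul, norm_inv, norm_norm, inv_mul_cancel₀ hn.ne']
        · show ‖(0 : Euc q)‖ ^ 2 < 1 / 4
          rw [norm_zero]
          norm_num
      refine Or.inl ⟨_, arcNeighbourhood_mem_compl_core h₁.embedding.injOn hN, ?_⟩
      rw [dualOld_of_mem hg hN]
      congr 1
      rw [← handleCollar_handleCollarInv (Z := (0 : Euc q)) hv hv0]
      simp only [slopeMap, WithLp.toLp_fst, WithLp.toLp_snd, norm_zero, zero_pow two_ne_zero, k3,
        handleCollarInv, smul_zero]

/-- If the two surgeries (on a manifold with boundary) that attach a handle and its dual handle are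
performed one after the other, then the result is that of a single surgery in the interior. -/
theorem exists_isSurgeryAlong_univ [T2Space X] (h₁ : IsSurgeryAlong I J (lowerHalf q) F a₁ b₁)
    (h₂ : IsSurgeryAlong J J' (lowerHalf p) (b₁ ∘ handleCollar) a₂ b₂) :
    ∃ (ψ : Euc p × EucSucc q → X) (a : X → Z) (b : Euc p × EucSucc q → Z),
      IsSurgeryAlong I J' univ ψ a b := by
  obtain ⟨g, -, hg⟩ := h₁.embedding.2.2
  refine ⟨F ∘ coreMap, dualOld F g a₁ a₂ b₂, dualNew b₁ a₂ b₂, ?_⟩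
  refine IsSurgeryAlong.of_polar (fun θ _ v _ => mem_univ _) (mem_univ _) ?_
    (isOpenSmoothEmbeddingOn_dualOld h₁ h₂ hg) isOpen_univ (fun v _ => mem_univ _) ?_ ?_ ?_ ?_
  · rw [inter_univ]
    exact isOpenSmoothEmbeddingOn_coreMap h₁.embedding
  · rw [inter_univ, inter_univ]
    exact isOpenSmoothEmbeddingOn_dualNew h₁ h₂
  · rintro z hz hz0 w ⟨hw, -⟩
    have hn : 0 < ‖z‖ := norm_pos_iff.2 hz0
    have hu : ‖z‖⁻¹ • z ∈ sphere (0 : Euc p) 1 := by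
      rw [mem_sphere_zero_iff_norm, norm_smul, norm_inv, norm_norm, inv_mul_cancel₀ hn.ne']
    have := dualOld_coreMap h₁ h₂ hg hu hw (θ := ‖z‖) ⟨hn, mem_ball_zero_iff.1 hz⟩
    rwa [smul_smul, mul_inv_cancel₀ hn.ne', one_smul] at this
  · exact fun w hw => dualNew_zero_notMem h₁ h₂ hg hw.1
  · intro y
    rcases dual_cover h₁ h₂ hg y with h | ⟨w, hw, h⟩
    · exact Or.inl h
    · exact Or.inr ⟨w, ⟨hw, mem_univ _⟩, h⟩

end DualSurgery

/-! ### Immersions and changes of the model space -/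

section ModelChange

variable {E H : Type*} [NormedAddCommGroup E] [NormedSpace ℝ E] [TopologicalSpace H]
  {E' H' : Type*} [NormedAddCommGroup E'] [NormedSpace ℝ E'] [TopologicalSpace H']
  {I : ModelWithCorners ℝ E H} {J : ModelWithCorners ℝ E' H'} {L : E ≃L[ℝ] E'}

theorem modelHomeomorph_aux (hL : MapsTo L (range I) (range J)) (x : H) :
    J (J.symm (L (I x))) = L (I x) :=
  J.right_inv (hL (mem_range_self x))

/-- The homeomorphism between the model spaces of two models with corners that is induced by a
linear isomorphism which maps the range of the one to the range of the other. -/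
noncomputable def modelHomeomorph (hL : MapsTo L (range I) (range J))
    (hL' : MapsTo L.symm (range J) (range I)) : H ≃ₜ H' where
  toFun x := J.symm (L (I x))
  invFun y := I.symm (L.symm (J y))
  left_inv x := by
    beta_reduce
    rw [modelHomeomorph_aux hL, L.symm_apply_apply, I.left_inv]
  right_inv y := by
    beta_reduce
    rw [modelHomeomorph_aux hL', L.apply_symm_apply, J.left_inv]
  continuous_toFun := J.continuous_symm.comp (L.continuous.comp I.continuous)
  continuous_invFun := I.continuous_symm.comp (L.symm.continuous.comp J.continuous)

theorem contMDiff_model_comp (hL : MapsTo L (range I) (range J)) :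
    ContMDiff I J ∞ fun x => J.symm (L (I x)) := by
  have h : ContMDiff I 𝓘(ℝ, E') ∞ fun x => L (I x) :=
    L.contDiff.contMDiff.comp I.contMDiff
  exact J.contMDiffOn_symm.comp_contMDiff h fun x => hL (mem_range_self x)

variable {X : Type*} [TopologicalSpace X] [ChartedSpace H X]
  {Z : Type*} [TopologicalSpace Z] [ChartedSpace H' Z]

theorem IsOpenSmoothEmbeddingOn.exists_openPartialHomeomorph {a : X → Z} {s : Set X}
    (ha : IsOpenSmoothEmbeddingOn I J a s) (hs : IsOpen s) :
    ∃ e : OpenPartialHomeomorph X Z, e.source = s ∧ ⇑e = a ∧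
      ContMDiffOn I J ∞ e e.source ∧ ContMDiffOn J I ∞ e.symm e.target := by
  obtain ⟨ho, hf, g, hg, hgf⟩ := ha
  refine ⟨{ toFun := a, invFun := g, source := s, target := a '' s,
            map_source' := fun x hx => ⟨x, hx, rfl⟩, map_target' := ?_,
            left_inv' := hgf, right_inv' := ?_, open_source := hs, open_target := ho,
            continuousOn_toFun := hf.continuousOn, continuousOn_invFun := hg.continuousOn },
            rfl, rfl, hf, hg⟩
  · rintro _ ⟨x, hx, rfl⟩
    rwa [hgf x hx]
  · rintro _ ⟨x, hx, rfl⟩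
    rw [hgf x hx]

variable {E₀ H₀ N F : Type*} [NormedAddCommGroup E₀] [NormedSpace ℝ E₀] [TopologicalSpace H₀]
  {I₀ : ModelWithCorners ℝ E₀ H₀} [TopologicalSpace N] [ChartedSpace H₀ N]
  [NormedAddCommGroup F] [NormedSpace ℝ F]

/-- Open smooth embeddings preserve immersions, even if the models of the two manifolds differ by
a linear isomorphism. -/
theorem IsOpenSmoothEmbeddingOn.comp_isImmersionAt [IsManifold I ∞ X] [IsManifold J ∞ Z]
    {a : X → Z} {s : Set X} (ha : IsOpenSmoothEmbeddingOn I J a s) (hs : IsOpen s)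
    (hL : MapsTo L (range I) (range J)) (hL' : MapsTo L.symm (range J) (range I))
    {f : N → X} (hfs : ∀ y, f y ∈ s) {x : N}
    (hf : Manifold.IsImmersionAtOfComplement F I₀ I ∞ f x) :
    Manifold.IsImmersionAtOfComplement F I₀ J ∞ (a ∘ f) x := by
  obtain ⟨e, rfl, rfl, he, he'⟩ := ha.exists_openPartialHomeomorph hs
  set h := modelHomeomorph hL hL'
  have hh : ContMDiff I J ∞ h := contMDiff_model_comp hL
  have hh' : ContMDiff J I ∞ h.symm := contMDiff_model_comp hL'
  have hc := hf.codChart_mem_maximalAtlas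
  refine .mk_of_continuousAt ?_ (hf.equiv.trans L) hf.domChart
    (e.symm ≫ₕ hf.codChart ≫ₕ h.toOpenPartialHomeomorph) hf.mem_domChart_source ?_
    hf.domChart_mem_maximalAtlas ?_ ?_
  · exact (e.continuousAt (hfs x)).comp hf.continuousAt
  · simp only [mfld_simps]
    refine ⟨e.map_source (hfs x), ?_⟩
    rw [e.left_inv (hfs x)]
    exact hf.mem_codChart_source
  · refine OpenPartialHomeomorph.mem_maximalAtlas_of_contMDiffOn _ ?_ ?_
    · refine hh.comp_contMDiffOn ((contMDiffOn_of_mem_maximalAtlas hc).comp (he'.mono ?_) ?_)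
      · intro y hy
        simp only [mfld_simps] at hy
        exact hy.1
      · intro y hy
        simp only [mfld_simps] at hy
        exact hy.2
    · refine he.comp ((contMDiffOn_symm_of_mem_maximalAtlas hc).comp hh'.contMDiffOn ?_) ?_
      · intro y hy
        simp only [mfld_simps] at hy
        exact hy.1
      · intro y hy
        simp only [mfld_simps] at hy
        exact hy.2
  · intro u hu
    have := hf.writtenInCharts hu
    simp only [Function.comp_apply, OpenPartialHomeomorph.extend_coe,
      OpenPartialHomeomorph.coe_trans] at this ⊢
    rw [e.left_inv (hfs _)]
    show J (J.symm (L (I _))) = L (hf.equiv _)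
    rw [modelHomeomorph_aux hL, this]

end ModelChange

/-! ### The boundary of `M × [0, 1]` -/

section HalfSpace

/-- The linear isomorphism that identifies the models of `M × [0, 1]` and of a manifold with
boundary: the boundary coordinate of the latter is the first one. -/
noncomputable def consEquiv (n : ℕ) : (Euc n × Euc 1) ≃L[ℝ] Euc (n + 1) :=
  LinearEquiv.toContinuousLinearEquiv
    { toFun := fun z => WithLp.toLp 2 (Fin.cons (z.2 0) z.1 : Fin (n + 1) → ℝ)
      invFun := fun y => (WithLp.toLp 2 fun i => y i.succ, WithLp.toLp 2 fun _ => y 0)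
      map_add' := fun z w => by
        ext i
        refine Fin.cases ?_ (fun i => ?_) i <;> simp
      map_smul' := fun c z => by
        ext i
        refine Fin.cases ?_ (fun i => ?_) i <;> simp
      left_inv := fun z => by
        ext i
        · simp
        · simp [Subsingleton.elim i 0]
      right_inv := fun y => by
        ext i
        refine Fin.cases ?_ (fun i => ?_) i <;> simp }

theorem consEquiv_apply_zero {n : ℕ} (z : Euc n × Euc 1) : consEquiv n z 0 = z.2 0 := rfl

theorem mem_range_prod_halfSpace {n : ℕ} {z : Euc n × Euc 1} :
    z ∈ range ((𝓡 n).prod (𝓡∂ 1)) ↔ 0 ≤ z.2 0 := by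
  rw [modelWithCorners_prod_coe, range_prodMap, mem_prod,
    range_modelWithCornersEuclideanHalfSpace]
  simp

theorem mapsTo_consEquiv (n : ℕ) :
    MapsTo (consEquiv n) (range ((𝓡 n).prod (𝓡∂ 1))) (range (𝓡∂ (n + 1))) := by
  intro z hz
  rw [range_modelWithCornersEuclideanHalfSpace]
  exact mem_range_prod_halfSpace.1 hz

theorem mapsTo_consEquiv_symm (n : ℕ) :
    MapsTo (consEquiv n).symm (range (𝓡∂ (n + 1))) (range ((𝓡 n).prod (𝓡∂ 1))) := by
  intro y hy
  rw [range_modelWithCornersEuclideanHalfSpace] at hy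
  rw [mem_range_prod_halfSpace, ← consEquiv_apply_zero, ContinuousLinearEquiv.apply_symm_apply]
  exact hy

/-- The inclusion of the boundary of `M × [0, 1]`. -/
def endsMap (M : Type*) : M ⊕ M → M × Icc (0 : ℝ) 1 :=
  Sum.elim (fun x => (x, 1)) (fun x => (x, 0))

variable {n : ℕ} {M : Type*} [TopologicalSpace M] [ChartedSpace (EuclideanSpace ℝ (Fin n)) M]

theorem continuous_endsMap : Continuous (endsMap M) := by
  unfold endsMap
  fun_prop

theorem injective_endsMap : Function.Injective (endsMap M) := by
  rintro (x | x) (y | y) h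
  · exact congrArg Sum.inl (congrArg Prod.fst h)
  · exact absurd (congrArg (fun z => (z.2 : ℝ)) h) (by simp [endsMap])
  · exact absurd (congrArg (fun z => (z.2 : ℝ)) h) (by simp [endsMap])
  · exact congrArg Sum.inr (congrArg Prod.fst h)

theorem range_endsMap : range (endsMap M) = ((𝓡 n).prod (𝓡∂ 1)).boundary (M × Icc (0 : ℝ) 1) := by
  rw [boundary_product]
  ext ⟨x, t⟩
  constructor
  · rintro ⟨y | y, h⟩
    · exact ⟨mem_univ _, Or.inr (congrArg Prod.snd h).symm⟩
    · exact ⟨mem_univ _, Or.inl (congrArg Prod.snd h).symm⟩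
  · rintro ⟨-, h | h⟩
    · exact ⟨Sum.inr x, by rw [show t = 0 from h]; rfl⟩
    · exact ⟨Sum.inl x, by rw [show t = 1 from h]; rfl⟩

theorem chartAt_Icc_extend_zero {t : Icc (0 : ℝ) 1} (ht : t = 0 ∨ t = 1) :
    (chartAt (EuclideanHalfSpace 1) t).extend (𝓡∂ 1) t = 0 := by
  rcases ht with rfl | rfl
  · rw [Icc_chartedSpaceChartAt_of_le_top (by simp)]
    exact IccLeftChart_extend_bot
  · rw [Icc_chartedSpaceChartAt_of_top_le (by simp)]
    exact IccRightChart_extend_top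

theorem isImmersionAt_endsMap [IsManifold (𝓡 n) ∞ M] (x : M ⊕ M) :
    Manifold.IsImmersionAtOfComplement (Euc 1) (𝓡 n) ((𝓡 n).prod (𝓡∂ 1)) ∞ (endsMap M) x := by
  refine .mk_of_continuousAt continuous_endsMap.continuousAt (ContinuousLinearEquiv.refl ℝ _)
    (chartAt _ x) (chartAt _ (endsMap M x)) (mem_chart_source _ _) (mem_chart_source _ _)
    (IsManifold.chart_mem_maximalAtlas _) (IsManifold.chart_mem_maximalAtlas _) ?_
  rcases x with x | x
  · intro u hu
    have h0 := chartAt_Icc_extend_zero (t := 1) (Or.inr rfl)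
    have h1 : (((chartAt _ (Sum.inl x : M ⊕ M)).extend (𝓡 n)).symm u) =
        Sum.inl (((chartAt _ x).extend (𝓡 n)).symm u) := by
      rw [ChartedSpace.sum_chartAt_inl]
      simp
    have h2 : u ∈ ((chartAt _ x).extend (𝓡 n)).target := by
      simpa [ChartedSpace.sum_chartAt_inl] using hu
    rw [Function.comp_apply, Function.comp_apply, h1]
    exact Prod.ext (((chartAt _ x).extend (𝓡 n)).right_inv h2) h0
  · intro u hu
    have h0 := chartAt_Icc_extend_zero (t := 0) (Or.inl rfl)
    have h1 : (((chartAt _ (Sum.inr x : M ⊕ M)).extend (𝓡 n)).symm u) =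
        Sum.inr (((chartAt _ x).extend (𝓡 n)).symm u) := by
      rw [ChartedSpace.sum_chartAt_inr]
      simp
    have h2 : u ∈ ((chartAt _ x).extend (𝓡 n)).target := by
      simpa [ChartedSpace.sum_chartAt_inr] using hu
    rw [Function.comp_apply, Function.comp_apply, h1]
    exact Prod.ext (((chartAt _ x).extend (𝓡 n)).right_inv h2) h0

end HalfSpace

/-! ### The boundary after an interior surgery -/

section InteriorSurgery

theorem finrank_eucSucc (d : ℕ) : Module.finrank ℝ (EucSucc d) = d + 1 := by
  rw [(WithLp.linearEquiv 2 ℝ (Euc d × ℝ)).finrank_eq]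
  simp

/-- An isometry between `ℝ^d × ℝ` and `ℝ^(d+1)`. -/
noncomputable def eucSuccIsometry (d : ℕ) : EucSucc d ≃ₗᵢ[ℝ] Euc (d + 1) :=
  ((stdOrthonormalBasis ℝ (EucSucc d)).reindex (finCongr (finrank_eucSucc d))).repr

variable {p q : ℕ} {E H X : Type*} [NormedAddCommGroup E] [NormedSpace ℝ E] [TopologicalSpace H]
  [TopologicalSpace X] [ChartedSpace H X]
  {E' H' Y : Type*} [NormedAddCommGroup E'] [NormedSpace ℝ E'] [TopologicalSpace H']
  [TopologicalSpace Y] [ChartedSpace H' Y]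
  {I : ModelWithCorners ℝ E H} {J : ModelWithCorners ℝ E' H'}

/-- The version of `isInteriorPoint_of_ball_prod_sphere` for `S^p × B^(q+1)`, where `ℝ^(p+1)` has to be
written as `ℝ^p × ℝ` for the stereographic coordinates. -/
theorem IsOpenSmoothEmbeddingOn.isInteriorPoint_of_sphere_prod_ball
    {φ : Euc (p + 1) × EucSucc q → X}
    (hφ : IsOpenSmoothEmbeddingOn 𝓘(ℝ, Euc (p + 1) × EucSucc q) I φ (sphere 0 1 ×ˢ ball 0 1))
    {x : Euc (p + 1) × EucSucc q}
    (hx : x ∈ sphere (0 : Euc (p + 1)) 1 ×ˢ ball (0 : EucSucc q) 1) :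
    I.IsInteriorPoint (φ x) := by
  have h : IsOpenSmoothEmbeddingOn 𝓘(ℝ, EucSucc q × EucSucc p) I
      (φ ∘ fun y : EucSucc q × EucSucc p => (eucSuccIsometry p y.2, y.1))
      (ball 0 1 ×ˢ sphere 0 1) := by
    refine hφ.comp_of_inverse (k := fun w => (w.2, (eucSuccIsometry p).symm w.1)) isOpen_univ
      ?_ ?_ ?_ ?_ ?_ ?_
    · exact ContDiff.contMDiff (by fun_prop) |>.contMDiffOn
    · exact ContDiff.contMDiff (by fun_prop) |>.contMDiffOn
    · intro y hy
      refine ⟨⟨?_, hy.1⟩, mem_univ _⟩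
      rw [mem_sphere_zero_iff_norm, LinearIsometryEquiv.norm_map]
      exact mem_sphere_zero_iff_norm.1 hy.2
    · rintro w ⟨hw, -⟩
      refine ⟨hw.2, ?_⟩
      rw [mem_sphere_zero_iff_norm, LinearIsometryEquiv.norm_map]
      exact mem_sphere_zero_iff_norm.1 hw.1
    · exact fun y _ => by simp
    · exact fun w _ => by simp
  have := h.isInteriorPoint_of_ball_prod_sphere (x := (x.2, (eucSuccIsometry p).symm x.1))
    ⟨hx.2, by
      rw [mem_sphere_zero_iff_norm, LinearIsometryEquiv.norm_map]
      exact mem_sphere_zero_iff_norm.1 hx.1⟩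
  simpa using this

namespace IsSurgeryAlong

variable {φ : Euc (p + 1) × EucSucc q → X} {a : X → Y} {b : Euc (p + 1) × EucSucc q → Y}

theorem isInteriorPoint_new (h : IsSurgeryAlong I J univ φ a b) {x : Euc (p + 1) × EucSucc q}
    (hx : x ∈ ball (0 : Euc (p + 1)) 1 ×ˢ sphere (0 : EucSucc q) 1) : J.IsInteriorPoint (b x) := by
  have hb := h.new_part
  rw [inter_univ] at hb
  exact hb.isInteriorPoint_of_ball_prod_sphere hx

theorem isClosed_core [T2Space X] (h : IsSurgeryAlong I J univ φ a b) :
    IsClosed (φ '' (sphere (0 : Euc (p + 1)) 1 ×ˢ {(0 : EucSucc q)})) := by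
  refine (((isCompact_sphere _ _).prod isCompact_singleton).image_of_continuousOn
    (h.embedding.2.1.continuousOn.mono ?_)).isClosed
  rintro x ⟨hx, hx'⟩
  refine ⟨hx, ?_, mem_univ _⟩
  rw [mem_singleton_iff.1 hx']
  exact mem_ball_self one_pos

theorem boundary_subset_compl_core (h : IsSurgeryAlong I J univ φ a b) :
    I.boundary X ⊆ (φ '' (sphere (0 : Euc (p + 1)) 1 ×ˢ {(0 : EucSucc q)}))ᶜ := by
  rintro _ hx ⟨x, ⟨hx1, hx2⟩, rfl⟩
  have hφ := h.embedding
  rw [inter_univ] at hφ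
  refine (ModelWithCorners.isInteriorPoint_iff_not_isBoundaryPoint _).1
    (hφ.isInteriorPoint_of_sphere_prod_ball ⟨hx1, ?_⟩) hx
  rw [mem_singleton_iff.1 hx2]
  exact mem_ball_self one_pos

/-- A surgery in the interior does not change the boundary. -/
theorem boundary_eq [T2Space X] (h : IsSurgeryAlong I J univ φ a b) :
    J.boundary Y = a '' I.boundary X := by
  have hO := h.isClosed_core.isOpen_compl
  have key : ∀ x ∈ (φ '' (sphere (0 : Euc (p + 1)) 1 ×ˢ {(0 : EucSucc q)}))ᶜ,
      a x ∈ J.boundary Y ↔ x ∈ I.boundary X := by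
    intro x hx
    have := h.old_part.isInteriorPoint_iff hO hx
    rw [ModelWithCorners.isInteriorPoint_iff_not_isBoundaryPoint,
      ModelWithCorners.isInteriorPoint_iff_not_isBoundaryPoint, not_iff_not] at this
    exact this
  ext y
  constructor
  · intro hy
    rcases h.mem_old_or_new_zero (fun _ _ _ _ => mem_univ _) (mem_univ _) y with
      ⟨x, hx, rfl⟩ | ⟨v, hv, rfl⟩
    · exact ⟨x, (key x hx).1 hy, rfl⟩
    · exact absurd hy ((ModelWithCorners.isInteriorPoint_iff_not_isBoundaryPoint _).1
        (h.isInteriorPoint_new ⟨mem_ball_self one_pos, hv.1⟩))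
  · rintro ⟨x, hx, rfl⟩
    exact (key x (h.boundary_subset_compl_core hx)).2 hx

/-- An interior surgery can be undone by an interior surgery of the complementary dimension. -/
theorem isObtainedByInteriorSurgery [T2Space X] (h : IsSurgeryAlong I J univ φ a b) :
    IsObtainedByInteriorSurgery q (p + 1) J I Y X := by
  obtain ⟨a', -, ha'⟩ := h.old_part.2.2
  refine ⟨_, _, _, ?_, (h.symm h.isClosed_core ha').comp_isometry (eucSuccIsometry q).symm⟩
  rintro _ ⟨y, hy, rfl⟩
  refine h.isInteriorPoint_new (x := (y.2, (eucSuccIsometry q).symm y.1)) ⟨hy.2, ?_⟩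
  rw [mem_sphere_zero_iff_norm, LinearIsometryEquiv.norm_map]
  exact mem_sphere_zero_iff_norm.1 hy.1

end IsSurgeryAlong

end InteriorSurgery

/-! ### Attaching a handle and its dual handle -/

theorem lemma2p5 (n k : ℕ) (hk : k < n)
    (M : Type*) [TopologicalSpace M] [T2Space M] [CompactSpace M]
    [ChartedSpace (EuclideanSpace ℝ (Fin n)) M] [IsManifold (𝓡 n) ∞ M]
    (f : Euc (k + 1) × Euc (n - k) → M)
    (hf : IsOpenSmoothEmbeddingOn 𝓘(ℝ, Euc (k + 1) × Euc (n - k)) (𝓡 n) f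
      (sphere 0 1 ×ˢ ball 0 1))
    (Ω₁ : Type*) [TopologicalSpace Ω₁] [T2Space Ω₁]
    [ChartedSpace (EuclideanHalfSpace (n + 1)) Ω₁] [IsManifold (𝓡∂ (n + 1)) ∞ Ω₁]
    (a₁ : M × Icc (0 : ℝ) 1 → Ω₁) (b₁ : Euc (k + 1) × EucSucc (n - k) → Ω₁)
    (h₁ : IsHandleAttachment ((𝓡 n).prod (𝓡∂ 1)) (𝓡∂ (n + 1))
      (fun w => (f w, (0 : Icc (0 : ℝ) 1))) a₁ b₁)
    (Ω₂ : Type*) [TopologicalSpace Ω₂] [T2Space Ω₂]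
    [ChartedSpace (EuclideanHalfSpace (n + 1)) Ω₂] [IsManifold (𝓡∂ (n + 1)) ∞ Ω₂]
    (a₂ : Ω₁ → Ω₂) (b₂ : Euc (n - k) × EucSucc (k + 1) → Ω₂)
    (h₂ : IsHandleAttachment (𝓡∂ (n + 1)) (𝓡∂ (n + 1)) (dualAttachingMap b₁) a₂ b₂) :
    (∃ j : M ⊕ M → Ω₂, Manifold.IsSmoothEmbedding (𝓡 n) (𝓡∂ (n + 1)) ∞ j ∧
      range j = (𝓡∂ (n + 1)).boundary Ω₂) ∧
    IsObtainedByInteriorSurgery (n - k) (k + 1) (𝓡∂ (n + 1)) ((𝓡 n).prod (𝓡∂ 1))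
      Ω₂ (M × Icc (0 : ℝ) 1) := by
  obtain ⟨F, -, h₁⟩ := h₁
  obtain ⟨F₂, hF₂, h₂⟩ := h₂
  obtain ⟨a₂', b₂', h₂'⟩ := exists_isSurgeryAlong_handleCollar h₁.new_part h₂ hF₂
  obtain ⟨ψ, a, b, h⟩ := exists_isSurgeryAlong_univ h₁ h₂'
  have hmem : ∀ y : M ⊕ M, endsMap M y ∈ (ψ '' (sphere 0 1 ×ˢ {0}))ᶜ := by
    intro y
    apply h.boundary_subset_compl_core
    rw [← range_endsMap]
    exact mem_range_self y
  refine ⟨⟨a ∘ endsMap M, ⟨⟨Euc 1, inferInstance, inferInstance, fun x => ?_⟩, ?_⟩, ?_⟩,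
    h.isObtainedByInteriorSurgery⟩
  · exact h.old_part.comp_isImmersionAt h.isClosed_core.isOpen_compl (mapsTo_consEquiv n)
      (mapsTo_consEquiv_symm n) hmem (isImmersionAt_endsMap x)
  · refine (Continuous.isClosedEmbedding ?_ ?_).isEmbedding
    · exact h.old_part.2.1.continuousOn.comp_continuous continuous_endsMap hmem
    · exact fun x y hxy => injective_endsMap (h.old_part.injOn (hmem x) (hmem y) hxy)
  · rw [range_comp, range_endsMap (n := n), h.boundary_eq]
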